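/- **Proposition 1.** $\mathsf{postQMA}(2)\subseteq\mathsf{NEXP}$. That is, let $c,s:\mathbb{N}\to[0,1]$ be functions computable in polynomial time (from $n$ and $k$ in unary, a dyadic approximation within $2^{-k}$ is computable in polynomial time) such that for some polynomial $q$, $c(n)-s(n)>1/q(n)>0$ for all sufficiently large $n$. Then $\mathsf{postQMA}(2)(c,s)\subseteq\mathsf{NEXP}$. Here a language $L\subseteq\{0,1\}^*$ is in $\mathsf{postQMA}(2)(c,s)$ if there are polynomials $w,m,l$ and a family of quantum circuits $\{V_x\}_{x\in\{0,1\}^*}$ such that a deterministic Turing machine computes a description of $V_x$ from $x$ in time polynomial in $|x|$, and such that the following holds for every $n$ and every $x$ with $|x|=n$. The circuit $V_x$ consists of gates of the standard basis $\{H,\ K=\mathrm{diag}(1,i),\ K^{-1},\ \mathrm{CNOT},\ \mathrm{Toffoli}\}$ and acts as a unitary $Q_x$ on $2w(n)+m(n)\ge 2$ qubits, namely two registers of $w(n)$ witness qubits and $m(n)$ ancilla qubits. For $w(n)$-qubit pure states $|\psi_1\rangle,|\psi_2\rangle$, let $o$ and $p$ be the outcomes of measuring the first and the second qubit of $Q_x|\psi_1\rangle|\psi_2\rangle|0\rangle^{\otimes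 m(n)}$ in the computational basis. Then 1. for all $w(n)$-qubit states $|\psi_1\rangle,|\psi_2\rangle$: $\Pr[p=1]\ge 2^{-l(n)}$; 2. if $x\in L$, there exist $w(n)$-qubit states $|\psi_1\rangle,|\psi_2\rangle$ with $\Pr[o=1\mid p=1]\ge c(n)$, where $\Pr[o=1\mid p=1]=\Pr[o=1,p=1]/\Pr[p=1]$; 3. if $x\notin L$, then $\Pr[o=1\mid p=1]\le s(n)$ for all $w(n)$-qubit states $|\psi_1\rangle,|\psi_2\rangle$. $\mathsf{NEXP}$ is the class of languages decided by a nondeterministic Turing machine in time $2^{r(n)}$ for some polynomial $r$: on every input of length $n$ all computation paths halt within $2^{r(n)}$ steps, and the input is in the language iff some path accepts. -/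

import Mathlib

open Filter

namespace QuantumComplexity

/-! ### Turing machines -/

/-- `f` is computable in polynomial time by a deterministic multi-stack Turing machine, all of whose
stack alphabets are finite; arguments and values are written as strings by `ea` and `eb`. -/
def PolyTimeComputable {α β αΓ βΓ : Type} (ea : α → List αΓ) (eb : β → List βΓ) (f : α → β) :
    Prop :=
  ∃ M : Turing.TM2ComputableInPolyTime ea eb f, ∀ k, Finite (M.tm.Γ k)

/-- A nondeterministic multi-stack Turing machine over the input alphabet `Bool`: a machine with
two programs, `m` and `m₁`. In every step it executes one of the two, chosen freely.
When it halts, it accepts or rejects according to its internal state. -/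
structure NTM extends Turing.FinTM2 where
  /-- all stack alphabets are finite -/
  finiteAlphabet : ∀ k, Finite (Γ k)
  /-- the input bits are symbols of the alphabet of the input stack -/
  input : Bool ↪ Γ k₀
  /-- the second program -/
  m₁ : Λ → Turing.TM2.Stmt Γ Λ σ
  /-- the accepting internal states -/
  accept : σ → Prop

namespace NTM

variable (M : NTM)

/-- Configurations. -/
abbrev Cfg : Type := Turing.TM2.Cfg M.Γ M.Λ M.σ

/-- The initial configuration on input `x`. -/
def init (x : List Bool) : M.Cfg := Turing.initList M.toFinTM2 (x.map M.input)

/-- One step with the choice `b`; a halted configuration does not change. -/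
def next (b : Bool) (C : M.Cfg) : M.Cfg :=
  (Turing.TM2.step (if b then M.m₁ else M.m) C).getD C

/-- The configuration after `t` steps on input `x`, with the choices made according to `r`. -/
def run (x : List Bool) (r : ℕ → Bool) : ℕ → M.Cfg
  | 0 => M.init x
  | t + 1 => M.next (r t) (run x r t)

/-- `M` decides `L` nondeterministically in time `T`: on every input `x` every computation
path halts within `T |x|` steps, and `x ∈ L` iff some computation path accepts. -/
def DecidesInTime (L : Language Bool) (T : ℕ → ℕ) : Prop :=
  ∀ x : List Bool,
    (∀ r : ℕ → Bool, (M.run x r (T x.length)).l = none) ∧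
    (x ∈ L ↔ ∃ r : ℕ → Bool, M.accept (M.run x r (T x.length)).var)

end NTM

/-- Nondeterministic exponential time: the languages decided by some nondeterministic Turing machine
in time `2 ^ p(n)` for some polynomial `p`. -/
def NEXP : Set (Language Bool) :=
  {L | ∃ (M : NTM) (p : Polynomial ℕ), M.DecidesInTime L (fun n => 2 ^ p.eval n)}

/-! ### Quantum circuits -/

/-- The gates of the standard basis `{H, K, K⁻¹, CNOT, Toffoli}`, acting on distinct qubits out
of `N`; here `K = diag(1, i)`, and the last qubit of `CNOT` and of `Toffoli` is the target. -/
inductive Gate (N : ℕ) : Type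
  | H (j : Fin N)
  | K (j : Fin N)
  | Kinv (j : Fin N)
  | CNOT (i j : Fin N) (hij : i ≠ j)
  | Toffoli (i j k : Fin N) (hij : i ≠ j) (hik : i ≠ k) (hjk : j ≠ k)

/-- The Hadamard matrix. -/
noncomputable def hadamard : Matrix Bool Bool ℂ :=
  Matrix.of fun a b => (if a && b then -1 else 1) / (Real.sqrt 2 : ℂ)

/-- The matrix `diag(1, a)`. -/
def phase (a : ℂ) : Matrix Bool Bool ℂ :=
  Matrix.diagonal fun b => if b then a else 1

/-- The one-qubit operator `U` applied to qubit `j` of `N` qubits. -/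
def onQubit {N : ℕ} (U : Matrix Bool Bool ℂ) (j : Fin N) :
    Matrix (Fin N → Bool) (Fin N → Bool) ℂ :=
  Matrix.of fun z z' => if ∀ k, k ≠ j → z k = z' k then U (z j) (z' j) else 0

/-- The linear operator `|z⟩ ↦ |f z⟩`. -/
def basisMap {N : ℕ} (f : (Fin N → Bool) → (Fin N → Bool)) :
    Matrix (Fin N → Bool) (Fin N → Bool) ℂ :=
  Matrix.of fun z z' => if z = f z' then 1 else 0

/-- The operator of a gate on the space of `N` qubits, in the computational basis. -/
noncomputable def Gate.toMatrix {N : ℕ} : Gate N → Matrix (Fin N → Bool) (Fin N → Bool) ℂ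
  | .H j => onQubit hadamard j
  | .K j => onQubit (phase Complex.I) j
  | .Kinv j => onQubit (phase (-Complex.I)) j
  | .CNOT i j _ => basisMap fun z => Function.update z j (xor (z j) (z i))
  | .Toffoli i j k _ _ _ => basisMap fun z => Function.update z k (xor (z k) (z i && z j))

/-- A verifier circuit: it acts on two registers of `w` witness qubits each, followed by `m` ancilla
qubits, by a list of gates (the head of the list is applied first). There are at
least two qubits, since the first two are measured at the end. -/
structure Verifier where
  /-- the number of qubits of each of the two witnesses -/
  w : ℕ
  /-- the number of ancilla qubits -/
  m : ℕ
  /-- there are at least two qubits -/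
  two_le : 2 ≤ 2 * w + m
  /-- the gates -/
  gates : List (Gate (2 * w + m))

/-- Symbols for writing down circuits. -/
inductive CircuitSymbol : Type
  | H | K | Kinv | CNOT | Toffoli | tick | sep
  deriving DecidableEq

/-- A number in unary, terminated by a separator. -/
def encodeIndex (n : ℕ) : List CircuitSymbol :=
  List.replicate n .tick ++ [.sep]

/-- The description of a gate: its name and the qubits it acts on. -/
def Gate.encode {N : ℕ} : Gate N → List CircuitSymbol
  | .H j => .H :: encodeIndex j
  | .K j => .K :: encodeIndex j
  | .Kinv j => .Kinv :: encodeIndex j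
  | .CNOT i j _ => .CNOT :: (encodeIndex i ++ encodeIndex j)
  | .Toffoli i j k _ _ _ => .Toffoli :: (encodeIndex i ++ encodeIndex j ++ encodeIndex k)

namespace Verifier

variable (V : Verifier)

/-- The description of a verifier circuit: the register sizes and the list of gates. -/
def encode : List CircuitSymbol :=
  encodeIndex V.w ++ encodeIndex V.m ++ V.gates.flatMap Gate.encode

/-- The strings that label the computational basis of all qubits. -/
abbrev Basis : Type := Fin (2 * V.w + V.m) → Bool

/-- The operator of the circuit. -/
noncomputable def toMatrix : Matrix V.Basis V.Basis ℂ :=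
  V.gates.foldl (fun U g => g.toMatrix * U) 1

/-- The input vector `|ψ₁⟩|ψ₂⟩|0…0⟩`. -/
noncomputable def inputVec (ψ₁ ψ₂ : EuclideanSpace ℂ (Fin V.w → Bool)) : V.Basis → ℂ :=
  fun z =>
    ψ₁ (fun i => z ⟨i, by have := i.2; omega⟩) *
    ψ₂ (fun i => z ⟨V.w + i, by have := i.2; omega⟩) *
    (if ∀ i : Fin V.m, z ⟨2 * V.w + i, by have := i.2; omega⟩ = false then 1 else 0)

/-- The output qubit `o`, which is the first one. -/
def o : Fin (2 * V.w + V.m) := ⟨0, by have := V.two_le; omega⟩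

/-- The postselection qubit `p`, which is the second one. -/
def p : Fin (2 * V.w + V.m) := ⟨1, by have := V.two_le; omega⟩

/-- The probability `Tr[Π Q (|ψ₁⟩⟨ψ₁| ⊗ |ψ₂⟩⟨ψ₂| ⊗ |0…0⟩⟨0…0|) Q†]` that measuring
all qubits after the circuit `Q` gives a string in the event `E`; here `Π` is
the projection onto the span of these strings. -/
noncomputable def prob (ψ₁ ψ₂ : EuclideanSpace ℂ (Fin V.w → Bool)) (E : V.Basis → Bool) : ℝ :=
  (Matrix.trace
    (Matrix.diagonal (fun z => if E z then (1 : ℂ) else 0) *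
      (V.toMatrix *
        Matrix.vecMulVec (V.inputVec ψ₁ ψ₂) (star (V.inputVec ψ₁ ψ₂)) *
        V.toMatrix.conjTranspose))).re

/-- `Pr[p = 1]` -/
noncomputable def probPost (ψ₁ ψ₂ : EuclideanSpace ℂ (Fin V.w → Bool)) : ℝ :=
  V.prob ψ₁ ψ₂ fun z => z V.p

/-- `Pr[o = 1, p = 1]` -/
noncomputable def probOutPost (ψ₁ ψ₂ : EuclideanSpace ℂ (Fin V.w → Bool)) : ℝ :=
  V.prob ψ₁ ψ₂ fun z => z V.o && z V.p

/-- `Pr[o = 1 | p = 1]` -/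
noncomputable def probCond (ψ₁ ψ₂ : EuclideanSpace ℂ (Fin V.w → Bool)) : ℝ :=
  V.probOutPost ψ₁ ψ₂ / V.probPost ψ₁ ψ₂

end Verifier

/-! ### The class `postQMA(2)` -/

/-- The real function `c` is computable in polynomial time: from `n` and `k` in unary one can
compute in polynomial time (in binary) an `a` such that `a / 2 ^ k` is within `2 ^ (-k)`
of `c n`. -/
def PolyTimeReal (c : ℕ → ℝ) : Prop :=
  ∃ f : ℕ × ℕ → ℕ,
    PolyTimeComputable
      (Computability.encodingProd Computability.unaryEncodingNat
        Computability.unaryEncodingNat).encode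
      Computability.encodingNatBool.encode f ∧
    ∀ n k : ℕ, |c n - (f (n, k) : ℝ) / 2 ^ k| ≤ 1 / 2 ^ k

/-- The requirements on completeness `c` and soundness `s`. -/
structure Thresholds (c s : ℕ → ℝ) : Prop where
  c_mem : ∀ n, c n ∈ Set.Icc (0 : ℝ) 1
  s_mem : ∀ n, s n ∈ Set.Icc (0 : ℝ) 1
  c_poly : PolyTimeReal c
  s_poly : PolyTimeReal s
  gap : ∃ q : Polynomial ℕ, ∀ᶠ n : ℕ in atTop,
    0 < q.eval n ∧ 1 / ((q.eval n : ℕ) : ℝ) < c n - s n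

/-- The class `postQMA(2)(c, s)`. -/
def PostQMA2 (c s : ℕ → ℝ) : Set (Language Bool) :=
  {L | ∃ (w m l : Polynomial ℤ) (V : List Bool → Verifier),
    PolyTimeComputable (fun x : List Bool => x) Verifier.encode V ∧
    ∀ x : List Bool,
      ((V x).w : ℤ) = w.eval (x.length : ℤ) ∧
      ((V x).m : ℤ) = m.eval (x.length : ℤ) ∧
      (∀ ψ₁ ψ₂ : EuclideanSpace ℂ (Fin (V x).w → Bool), ‖ψ₁‖ = 1 → ‖ψ₂‖ = 1 →
        (2 : ℝ) ^ (-(l.eval (x.length : ℤ))) ≤ (V x).probPost ψ₁ ψ₂) ∧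
      (x ∈ L → ∃ ψ₁ ψ₂ : EuclideanSpace ℂ (Fin (V x).w → Bool), ‖ψ₁‖ = 1 ∧ ‖ψ₂‖ = 1 ∧
        c x.length ≤ (V x).probCond ψ₁ ψ₂) ∧
      (x ∉ L → ∀ ψ₁ ψ₂ : EuclideanSpace ℂ (Fin (V x).w → Bool), ‖ψ₁‖ = 1 → ‖ψ₂‖ = 1 →
        (V x).probCond ψ₁ ψ₂ ≤ s x.length)}

end QuantumComplexity

/-!
A nondeterministic machine in exponential time can guess the two witnesses of a `postQMA(2)`
verifier explicitly, as vectors of exponentially many amplitudes, compute the output vector of the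
circuit, and compare the conditional acceptance probability with a threshold between soundness and
completeness. Postselection costs nothing: `Pr[o = 1 | p = 1] > a / 2 ^ k` means
`2 ^ k * Pr[o = 1, p = 1] > a * Pr[p = 1]`, which is homogeneous in each of the witnesses, so that
these need not be normalized.

All of this can be done with natural numbers. The amplitudes of the guessed witnesses are Gaussian
integers, written as sums of powers of `i`. Up to factors `1 / √2`, which cancel in the comparison,
the entries of the gates are zero or powers of `i`. So each amplitude of the output is, up to a
common factor, a sum of powers of `i` over computational paths (`PathSum.sum_paths`,
`PathSum.sum_count`); a path is a natural number whose digits are basis states, and the four powers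
of `i` are counted separately (`PathSum.count`). This turns the comparison into an inequality
between sums of natural numbers, `PathSum.Accepts`, which `PathSum.accepts_iff` relates to
the acceptance probabilities.

For `x ∈ L` there are unit vectors for which the two sides of the comparison differ at least by
`2 ^ (1 - l(n))`, because `Pr[p = 1] ≥ 2 ^ (-l(n))` and because the threshold, computed to
`q(n) + 2` bits from the algorithm for `s`, stays below `c(n)` by a margin. The probabilities are
Lipschitz in the amplitudes with a constant `2 ^ poly(n)` (`PathSum.abs_prob_sub_le`), so rounding
the amplitudes to polynomially many bits preserves the strict inequality (`PathSum.exists_accepts`).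
For `x ∉ L` the inequality fails for all vectors (`PathSum.not_accepts`); since it is strict, zero
vectors do no harm.

On the side of machines, `Prog` is a small language of structured programs over stacks, with
given Turing machines as subroutines, and `Exec.simulate` compiles it to stack machines. `Expr` is
the class of functions built by addition, truncated subtraction, division by powers of two and
bounded sums from the lengths and the symbols of given strings. They can be evaluated in unary
arithmetic in polynomial time (`Expr.compile`). As `Accepts` is such an expression in the
guessed string, whose length `2 ^ poly(n)` bounds all the ranges of summation, it can be decided in
exponential time. `Setup.mem_NEXP` assembles the machine: it computes the circuit, the threshold and
the length of the guess, guesses, and evaluates.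
-/

namespace StackProgram

/-! ### Structured programs for stack machines -/

section

open Turing

/-- A machine that is to be run as a subroutine of a program over the stack alphabet `B` with
auxiliary state `τ`. Stack `k` of the machine becomes stack `e k` of the program, with symbols
translated by `enc k`; the internal state of the machine is a component of `τ`. -/
structure Subroutine (B τ : Type) where
  /-- the machine -/
  M : FinTM2
  /-- the stacks of the program that the machine uses -/
  e : M.K → ℕ
  e_inj : Function.Injective e
  /-- the translation of stack symbols -/
  enc : ∀ k, M.Γ k → B
  enc_inj : ∀ k, Function.Injective (enc k)
  /-- the internal state of the machine -/
  get : τ → M.σ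
  /-- replaces the internal state of the machine -/
  put : M.σ → τ → τ
  get_put : ∀ s v, get (put s v) = s
  put_put : ∀ s s' v, put s (put s' v) = put s v
  put_get : ∀ v, put (get v) v = v

/-- Structured programs for machines with stacks indexed by `ℕ`, all over the alphabet `B`.
The internal state is a pair of an auxiliary state in `τ`, which only subroutines touch, and the
current symbol, the result of the last attempt to pop. -/
inductive Prog (B τ : Type) : Type 1
  /-- push a symbol that depends on the current symbol -/
  | push (k : ℕ) (g : Option B → B)
  /-- pop into the current symbol -/
  | pop (k : ℕ)
  | skip
  | seq (p q : Prog B τ)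
  /-- branch on the current symbol -/
  | ite (test : Option B → Bool) (p q : Prog B τ)
  /-- as long as popping stack `k` into the current symbol succeeds, run the body -/
  | loop (k : ℕ) (p : Prog B τ)
  | call (M : Subroutine B τ)

variable {B τ : Type}

namespace Prog

/-- The control points of a program. -/
def Lab : Prog B τ → Type
  | push _ _ => Unit
  | pop _ => Unit
  | skip => Unit
  | seq p q => p.Lab ⊕ q.Lab
  | ite _ p q => Option (p.Lab ⊕ q.Lab)
  | loop _ p => Option p.Lab
  | call M => M.M.Λ

/-- The control point at which a program starts. -/
def entry : (p : Prog B τ) → p.Lab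
  | push _ _ => ()
  | pop _ => ()
  | skip => ()
  | seq p _ => Sum.inl p.entry
  | ite _ _ _ => none
  | loop _ _ => none
  | call M => M.M.main

noncomputable instance fintypeLab : (p : Prog B τ) → Fintype p.Lab
  | push _ _ => inferInstanceAs (Fintype Unit)
  | pop _ => inferInstanceAs (Fintype Unit)
  | skip => inferInstanceAs (Fintype Unit)
  | seq p q =>
    have := fintypeLab p
    have := fintypeLab q
    inferInstanceAs (Fintype (p.Lab ⊕ q.Lab))
  | ite _ p q =>
    have := fintypeLab p
    have := fintypeLab q
    inferInstanceAs (Fintype (Option (p.Lab ⊕ q.Lab)))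
  | loop _ p =>
    have := fintypeLab p
    inferInstanceAs (Fintype (Option p.Lab))
  | call M => M.M.ΛFin

/-- All stacks used by the program have an index below `p.bound`. -/
noncomputable def bound : Prog B τ → ℕ
  | push k _ => k + 1
  | pop k => k + 1
  | skip => 0
  | seq p q => max p.bound q.bound
  | ite _ p q => max p.bound q.bound
  | loop k p => max (k + 1) p.bound
  | call M => (@Finset.univ _ M.M.kFin).sup fun k => M.e k + 1

end Prog

variable {K Λ : Type}

/-- The statement of a subroutine, as a statement of the program that calls it: halting becomes a
jump to `exit`. -/
noncomputable def Subroutine.stmt (M : Subroutine B τ) (h : ℕ → K) (emb : M.M.Λ → Λ) (exit : Λ) :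
    TM2.Stmt M.M.Γ M.M.Λ M.M.σ → TM2.Stmt (fun _ : K => B) Λ (τ × Option B)
  | .push k f q => .push (h (M.e k)) (fun v => M.enc k (f (M.get v.1))) (M.stmt h emb exit q)
  | .peek k f q => .peek (h (M.e k))
      (fun v o => (M.put (f (M.get v.1) (o.bind (Function.partialInv (M.enc k)))) v.1, v.2))
      (M.stmt h emb exit q)
  | .pop k f q => .pop (h (M.e k))
      (fun v o => (M.put (f (M.get v.1) (o.bind (Function.partialInv (M.enc k)))) v.1, v.2))
      (M.stmt h emb exit q)
  | .load f q => .load (fun v => (M.put (f (M.get v.1)) v.1, v.2)) (M.stmt h emb exit q)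
  | .branch f q q' => .branch (fun v => f (M.get v.1)) (M.stmt h emb exit q) (M.stmt h emb exit q')
  | .goto f => .goto fun v => emb (f (M.get v.1))
  | .halt => .goto fun _ => exit

/-- The machine code of a program: `h` places the stacks, `emb` places the control points among
the labels `Λ` of the machine, and `exit` is the label to go to in the end. -/
noncomputable def Prog.code (h : ℕ → K) : (p : Prog B τ) → (emb : p.Lab → Λ) → (exit : Λ) →
    p.Lab → TM2.Stmt (fun _ : K => B) Λ (τ × Option B)
  | .push k g, _, exit => fun _ => .push (h k) (fun v => g v.2) (.goto fun _ => exit)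
  | .pop k, _, exit => fun _ => .pop (h k) (fun v o => (v.1, o)) (.goto fun _ => exit)
  | .skip, _, exit => fun _ => .goto fun _ => exit
  | .seq p q, emb, exit => fun l => match l with
    | Sum.inl l => p.code h (fun l => emb (Sum.inl l)) (emb (Sum.inr q.entry)) l
    | Sum.inr l => q.code h (fun l => emb (Sum.inr l)) exit l
  | .ite test p q, emb, exit => fun l => match l with
    | none => .branch (fun v => test v.2) (.goto fun _ => emb (some (Sum.inl p.entry)))
        (.goto fun _ => emb (some (Sum.inr q.entry)))
    | some (Sum.inl l) => p.code h (fun l => emb (some (Sum.inl l))) exit l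
    | some (Sum.inr l) => q.code h (fun l => emb (some (Sum.inr l))) exit l
  | .loop k p, emb, exit => fun l => match l with
    | none => .pop (h k) (fun v o => (v.1, o)) (.branch (fun v => v.2.isSome)
        (.goto fun _ => emb (some p.entry)) (.goto fun _ => exit))
    | some l => p.code h (fun l => emb (some l)) (emb none) l
  | .call M, emb, exit => fun l => M.stmt h emb exit (M.M.m l)

/-- `Exec p v S t v' S'`: in `t` steps the program leads from the internal state `v` and stacks `S`
to the internal state `v'` and the stacks `S'`. -/
inductive Exec : Prog B τ → τ × Option B → (ℕ → List B) → ℕ → τ × Option B → (ℕ → List B) → Prop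
  | push (k : ℕ) (g : Option B → B) (v : τ × Option B) (S : ℕ → List B) :
      Exec (.push k g) v S 1 v (Function.update S k (g v.2 :: S k))
  | pop (k : ℕ) (v : τ × Option B) (S : ℕ → List B) :
      Exec (.pop k) v S 1 (v.1, (S k).head?) (Function.update S k (S k).tail)
  | skip (v : τ × Option B) (S : ℕ → List B) : Exec .skip v S 1 v S
  | seq {p q : Prog B τ} {v v₁ v₂ : τ × Option B} {S S₁ S₂ : ℕ → List B} {t t' : ℕ} :
      Exec p v S t v₁ S₁ → Exec q v₁ S₁ t' v₂ S₂ → Exec (.seq p q) v S (t + t') v₂ S₂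
  | ite_true {test : Option B → Bool} {p : Prog B τ} (q : Prog B τ) {v v' : τ × Option B}
      {S S' : ℕ → List B} {t : ℕ} :
      test v.2 = true → Exec p v S t v' S' → Exec (.ite test p q) v S (1 + t) v' S'
  | ite_false {test : Option B → Bool} (p : Prog B τ) {q : Prog B τ} {v v' : τ × Option B}
      {S S' : ℕ → List B} {t : ℕ} :
      test v.2 = false → Exec q v S t v' S' → Exec (.ite test p q) v S (1 + t) v' S'
  | loop_nil {k : ℕ} (p : Prog B τ) (v : τ × Option B) {S : ℕ → List B} :
      S k = [] → Exec (.loop k p) v S 1 (v.1, none) S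
  | loop_cons {k : ℕ} {p : Prog B τ} {v v₁ v₂ : τ × Option B} {S S₁ S₂ : ℕ → List B} {t t' : ℕ}
      {b : B} {l : List B} :
      S k = b :: l → Exec p (v.1, some b) (Function.update S k l) t v₁ S₁ →
      Exec (.loop k p) v₁ S₁ t' v₂ S₂ → Exec (.loop k p) v S (1 + t + t') v₂ S₂
  | call (M : Subroutine B τ) {v : τ × Option B} {S S' : ℕ → List B} {t : ℕ} {C C' : M.M.Cfg} :
      C.l = some M.M.main → C.var = M.get v.1 → (∀ k, S (M.e k) = (C.stk k).map (M.enc k)) →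
      (flip Bind.bind M.M.step)^[t] (some C) = some C' → C'.l = none →
      (∀ k, S' (M.e k) = (C'.stk k).map (M.enc k)) → (∀ i, (∀ k, i ≠ M.e k) → S' i = S i) →
      Exec (.call M) v S t (M.put C'.var v.1, v.2) S'

theorem head_bind_partialInv {α : Type} {f : α → B} (hf : Function.Injective f) (l : List α) :
    (l.map f).head?.bind (Function.partialInv f) = l.head? := by
  cases l with
  | nil => rfl
  | cons a l => simp [Function.partialInv_left hf]

section Simulation

variable [DecidableEq K]

/-- One step of a subroutine. The stacks outside of the range of `h ∘ e` are given by `T₀`. -/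
theorem Subroutine.stepAux_stmt (M : Subroutine B τ) {h : ℕ → K}
    (hinj : Function.Injective fun k => h (M.e k)) (emb : M.M.Λ → Λ) (exit : Λ)
    (q : TM2.Stmt M.M.Γ M.M.Λ M.M.σ) (s : M.M.σ) (stk : ∀ k, List (M.M.Γ k)) (v : τ)
    (c : Option B) (T₀ T : K → List B) (hT : ∀ k, T (h (M.e k)) = (stk k).map (M.enc k))
    (hT₀ : ∀ i, (∀ k, i ≠ h (M.e k)) → T i = T₀ i) :
    ∃ T' : K → List B,
      (∀ k, T' (h (M.e k)) = ((TM2.stepAux q s stk).stk k).map (M.enc k)) ∧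
      (∀ i, (∀ k, i ≠ h (M.e k)) → T' i = T₀ i) ∧
      TM2.stepAux (M.stmt h emb exit q) (M.put s v, c) T =
        ⟨some (((TM2.stepAux q s stk).l.map emb).getD exit),
          (M.put (TM2.stepAux q s stk).var v, c), T'⟩ := by
  induction q generalizing s stk T with
  | push k f q ih =>
    simp only [Subroutine.stmt, TM2.stepAux.eq_1]
    rw [M.get_put]
    apply ih
    · intro k'
      by_cases hk : k' = k
      · subst hk; simp [hT]
      · rw [Function.update_of_ne hk, Function.update_of_ne (fun h' => hk (hinj h')), hT]
    · intro i hi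
      rw [Function.update_of_ne (hi k), hT₀ i hi]
  | peek k f q ih =>
    simp only [Subroutine.stmt, TM2.stepAux.eq_2]
    rw [M.get_put, M.put_put, hT, head_bind_partialInv (M.enc_inj k)]
    exact ih _ _ _ hT hT₀
  | pop k f q ih =>
    simp only [Subroutine.stmt, TM2.stepAux.eq_3]
    rw [M.get_put, M.put_put, hT, head_bind_partialInv (M.enc_inj k)]
    apply ih
    · intro k'
      by_cases hk : k' = k
      · subst hk; simp
      · rw [Function.update_of_ne hk, Function.update_of_ne (fun h' => hk (hinj h')), hT]
    · intro i hi
      rw [Function.update_of_ne (hi k), hT₀ i hi]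
  | load f q ih =>
    simp only [Subroutine.stmt, TM2.stepAux.eq_4]
    rw [M.get_put, M.put_put]
    exact ih _ _ _ hT hT₀
  | branch f q q' ih ih' =>
    simp only [Subroutine.stmt, TM2.stepAux.eq_5]
    rw [M.get_put]
    cases f s
    · exact ih' _ _ _ hT hT₀
    · exact ih _ _ _ hT hT₀
  | goto f =>
    refine ⟨T, hT, hT₀, ?_⟩
    simp [Subroutine.stmt, M.get_put]
  | halt =>
    refine ⟨T, hT, hT₀, ?_⟩
    simp [Subroutine.stmt]

/-- The first `n` stacks, as the stacks of a machine with `n` stacks. -/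
def firstStacks (n : ℕ) (S : ℕ → List B) : Fin n → List B := fun i => S i

theorem firstStacks_update {n k : ℕ} [NeZero n] (hk : k < n) (S : ℕ → List B) (l : List B) :
    Function.update (firstStacks n S) (Fin.ofNat n k) l = firstStacks n (Function.update S k l) := by
  funext i
  have : (Fin.ofNat n k : ℕ) = k := Nat.mod_eq_of_lt hk
  by_cases hi : i = Fin.ofNat n k
  · subst hi; simp [firstStacks, Nat.mod_eq_of_lt hk]
  · rw [Function.update_of_ne hi]
    have : (i : ℕ) ≠ k := fun h => hi (Fin.ext (by rw [this, h]))
    simp [firstStacks, Function.update_of_ne this]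

theorem firstStacks_ofNat {n k : ℕ} [NeZero n] (hk : k < n) (S : ℕ → List B) :
    firstStacks n S (Fin.ofNat n k) = S k := by
  simp [firstStacks, Nat.mod_eq_of_lt hk]

variable {n : ℕ} [NeZero n]

/-- A halting run of a subroutine, for any sequence `R` of configurations that obeys its code. The
stacks outside of the range of `e` are given by `T₀`. -/
theorem Subroutine.simulate (M : Subroutine B τ) (hn : ∀ k, M.e k < n) (emb : M.M.Λ → Λ)
    (exit : Λ) (R : ℕ → TM2.Cfg (fun _ : Fin n => B) Λ (τ × Option B))
    (hR : ∀ i l v T, R i = ⟨some (emb l), v, T⟩ →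
      R (i + 1) = TM2.stepAux (M.stmt (Fin.ofNat n) emb exit (M.M.m l)) v T)
    (T₀ : Fin n → List B) (v : τ) (c : Option B) (t : ℕ) (C C' : M.M.Cfg) (l : M.M.Λ)
    (hl : C.l = some l) (hCC : (flip Bind.bind M.M.step)^[t] (some C) = some C') (hl' : C'.l = none)
    (i : ℕ) (T : Fin n → List B) (hT : ∀ k, T (Fin.ofNat n (M.e k)) = (C.stk k).map (M.enc k))
    (hT₀ : ∀ i, (∀ k, i ≠ Fin.ofNat n (M.e k)) → T i = T₀ i)
    (hi : R i = ⟨some (emb l), (M.put C.var v, c), T⟩) :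
    ∃ T' : Fin n → List B, R (i + t) = ⟨some exit, (M.put C'.var v, c), T'⟩ ∧
      (∀ k, T' (Fin.ofNat n (M.e k)) = (C'.stk k).map (M.enc k)) ∧
      (∀ i, (∀ k, i ≠ Fin.ofNat n (M.e k)) → T' i = T₀ i) := by
  have hinj : Function.Injective fun k => Fin.ofNat n (M.e k) := by
    intro a b hab
    have := congrArg Fin.val hab
    simp only [Fin.ofNat, Nat.mod_eq_of_lt (hn a), Nat.mod_eq_of_lt (hn b)] at this
    exact M.e_inj this
  have hnone : ∀ t, (flip Bind.bind M.M.step)^[t] none = none := by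
    intro t
    induction t with
    | zero => rfl
    | succ t ih => rw [Function.iterate_succ_apply]; exact ih
  induction t generalizing C i T l with
  | zero =>
    simp only [Function.iterate_zero, id_eq, Option.some.injEq] at hCC
    rw [hCC, hl'] at hl
    simp at hl
  | succ t ih =>
    obtain ⟨Cl, Cv, CS⟩ := C
    simp only at hl hT hi
    subst hl
    rw [Function.iterate_succ_apply] at hCC
    have hstep : flip Bind.bind M.M.step (some (⟨some l, Cv, CS⟩ : M.M.Cfg)) =
      some (TM2.stepAux (M.M.m l) Cv CS) := rfl
    rw [hstep] at hCC
    have h1 := hR i l _ T hi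
    obtain ⟨T', hT1, hT2, hT3⟩ := M.stepAux_stmt hinj emb exit (M.M.m l) Cv CS v c T₀ T hT hT₀
    rw [hT3] at h1
    rcases hlab : (TM2.stepAux (M.M.m l) Cv CS).l with _ | l'
    · cases t with
      | zero =>
        have hD : TM2.stepAux (M.M.m l) Cv CS = C' := Option.some.inj hCC
        rw [hD] at hT1 h1
        refine ⟨T', ?_, hT1, hT2⟩
        rw [h1, hl']
        rfl
      | succ t =>
        exfalso
        have hCC : (flip Bind.bind M.M.step)^[t] (flip Bind.bind M.M.step
          (some (TM2.stepAux (M.M.m l) Cv CS : M.M.Cfg))) = some C' := hCC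
        have : flip Bind.bind M.M.step (some (TM2.stepAux (M.M.m l) Cv CS : M.M.Cfg)) = none := by
          revert hlab
          generalize TM2.stepAux (M.M.m l) Cv CS = D
          obtain ⟨Dl, Dv, DS⟩ := D
          rintro rfl
          rfl
        rw [this, hnone] at hCC
        simp at hCC
    · have := ih (TM2.stepAux (M.M.m l) Cv CS) l' hlab hCC (i + 1) T' hT1 hT2
        (by rw [h1, hlab]; rfl)
      rwa [add_assoc, add_comm 1 t] at this

/-- Correctness of the machine code, for any sequence `R` of configurations of a machine that
obeys the code: the machine may well do something else at labels outside of the program. -/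
theorem Exec.simulate {p : Prog B τ} {v v' : τ × Option B} {S S' : ℕ → List B} {t : ℕ}
    (h : Exec p v S t v' S') (hn : p.bound ≤ n) (emb : p.Lab → Λ) (exit : Λ)
    (R : ℕ → TM2.Cfg (fun _ : Fin n => B) Λ (τ × Option B))
    (hR : ∀ i l v T, R i = ⟨some (emb l), v, T⟩ →
      R (i + 1) = TM2.stepAux (p.code (Fin.ofNat n) emb exit l) v T)
    (i : ℕ) (hi : R i = ⟨some (emb p.entry), v, firstStacks n S⟩) :
    R (i + t) = ⟨some exit, v', firstStacks n S'⟩ := by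
  induction h generalizing exit i with
  | push k g v S =>
    rw [hR i () v _ hi]
    simp only [Prog.bound] at hn
    simp only [Prog.code, TM2.stepAux.eq_1, TM2.stepAux.eq_6]
    rw [firstStacks_ofNat hn, firstStacks_update hn]
  | pop k v S =>
    rw [hR i () v _ hi]
    simp only [Prog.bound] at hn
    simp only [Prog.code, TM2.stepAux.eq_3, TM2.stepAux.eq_6]
    rw [firstStacks_ofNat hn, firstStacks_update hn]
  | skip v S =>
    rw [hR i () v _ hi]
    simp only [Prog.code, TM2.stepAux.eq_6]
  | @seq p q v v₁ v₂ S S₁ S₂ t t' _ _ ih ih' =>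
    simp only [Prog.bound, max_le_iff] at hn
    have h1 := ih hn.1 (fun l => emb (Sum.inl l)) (emb (Sum.inr q.entry))
      (fun i l v T h => hR i (Sum.inl l) v T h) i hi
    have h2 := ih' hn.2 (fun l => emb (Sum.inr l)) exit
      (fun i l v T h => hR i (Sum.inr l) v T h) (i + t) h1
    rwa [add_assoc] at h2
  | @ite_true test p q v v' S S' t ht _ ih =>
    simp only [Prog.bound, max_le_iff] at hn
    have h1 := hR i none v _ hi
    simp only [Prog.code, TM2.stepAux.eq_5, TM2.stepAux.eq_6, ht, cond_true] at h1
    have h2 := ih hn.1 (fun l => emb (some (Sum.inl l))) exit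
      (fun i l v T h => hR i (some (Sum.inl l)) v T h) (i + 1) h1
    rwa [add_assoc] at h2
  | @ite_false test p q v v' S S' t ht _ ih =>
    simp only [Prog.bound, max_le_iff] at hn
    have h1 := hR i none v _ hi
    simp only [Prog.code, TM2.stepAux.eq_5, TM2.stepAux.eq_6, ht, cond_false] at h1
    have h2 := ih hn.2 (fun l => emb (some (Sum.inr l))) exit
      (fun i l v T h => hR i (some (Sum.inr l)) v T h) (i + 1) h1
    rwa [add_assoc] at h2
  | @loop_nil k p v S hk =>
    simp only [Prog.bound, max_le_iff] at hn
    rw [hR i none v _ hi]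
    simp only [Prog.code, TM2.stepAux.eq_3, TM2.stepAux.eq_5, TM2.stepAux.eq_6]
    have h0 : Function.update S k [] = S := by rw [← hk]; exact Function.update_eq_self k S
    rw [firstStacks_ofNat hn.1, firstStacks_update hn.1, hk]
    simp [h0]
  | @loop_cons k p v v₁ v₂ S S₁ S₂ t t' b l hk _ _ ih ih' =>
    have hn' := hn
    simp only [Prog.bound, max_le_iff] at hn
    have h1 := hR i none v _ hi
    simp only [Prog.code, TM2.stepAux.eq_3, TM2.stepAux.eq_5, TM2.stepAux.eq_6] at h1
    rw [firstStacks_ofNat hn.1, firstStacks_update hn.1, hk] at h1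
    simp only [List.head?_cons, Option.isSome_some, cond_true, List.tail_cons] at h1
    have h2 := ih hn.2 (fun l => emb (some l)) (emb none)
      (fun i l v T h => hR i (some l) v T h) (i + 1) h1
    have h3 := ih' hn' emb exit hR (i + 1 + t) h2
    rwa [add_assoc i, add_assoc i] at h3
  | @call M v S S' t C C' hl hv hS hCC hl' hS' hS'' =>
    have hn' : ∀ k, M.e k < n := fun k =>
      (Finset.le_sup (f := fun k => M.e k + 1) (@Finset.mem_univ _ M.M.kFin k)).trans hn
    obtain ⟨T', h1, h2, h3⟩ := M.simulate hn' emb exit R hR (firstStacks n S) v.1 v.2 t C C' _ hl hCC hl'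
      i (firstStacks n S) (fun k => by rw [firstStacks_ofNat (hn' k), hS]) (fun _ _ => rfl)
      (by rw [hv, M.put_get]; exact hi)
    rw [h1]
    congr 1
    funext j
    by_cases hj : ∃ k, j = Fin.ofNat n (M.e k)
    · obtain ⟨k, rfl⟩ := hj
      rw [h2, firstStacks_ofNat (hn' k), hS']
    · push Not at hj
      rw [h3 j hj]
      refine (hS'' j fun k hk => hj k ?_).symm
      exact Fin.ext (by simp [hk, Fin.ofNat, Nat.mod_eq_of_lt (hn' k)])

end Simulation

end

/-! ### Basic programs -/

section

open Turing

variable {B τ : Type}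

/-- The program leads in at most `T` steps from the state `v` and the stacks `S` to the auxiliary
state `w` and the stacks `S'`. -/
def Runs (p : Prog B τ) (v : τ × Option B) (S : ℕ → List B) (T : ℕ) (w : τ) (S' : ℕ → List B) :
    Prop :=
  ∃ c t, t ≤ T ∧ Exec p v S t (w, c) S'

namespace Runs

variable {p q : Prog B τ} {v : τ × Option B} {w w' : τ} {S S₁ S₂ : ℕ → List B} {T T' k : ℕ}

theorem mono (h : Runs p v S T w S₁) (hT : T ≤ T') : Runs p v S T' w S₁ :=
  let ⟨c, t, ht, h⟩ := h
  ⟨c, t, ht.trans hT, h⟩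

theorem of_eq (h : Runs p v S T w S₁) {S' S₁' : ℕ → List B} (hS : S = S') (hS₁ : S₁ = S₁')
    (hT : T ≤ T') : Runs p v S' T' w S₁' := by
  subst hS hS₁
  exact h.mono hT

theorem seq (h : Runs p v S T w S₁) (h' : ∀ c, Runs q (w, c) S₁ T' w' S₂) :
    Runs (.seq p q) v S (T + T') w' S₂ := by
  obtain ⟨c, t, ht, h⟩ := h
  obtain ⟨c', t', ht', h'⟩ := h' c
  exact ⟨c', t + t', by omega, .seq h h'⟩

theorem push (g : Option B → B) (c : Option B) :
    Runs (.push k g) (w, c) S 1 w (Function.update S k (g c :: S k)) :=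
  ⟨c, 1, le_rfl, .push k g (w, c) S⟩

theorem pop (c : Option B) :
    Runs (.pop k) (w, c) S 1 w (Function.update S k (S k).tail) :=
  ⟨_, 1, le_rfl, .pop k (w, c) S⟩

theorem skip : Runs .skip v S 1 v.1 S := ⟨v.2, 1, le_rfl, .skip v S⟩

/-- A loop that pops the symbols of `l` one after the other; `A i` are the stacks after
`i` iterations. -/
theorem loop (l : List B) (A : ℕ → ℕ → List B) (hA : ∀ i, A i k = l.drop i)
    (hp : ∀ i (hi : i < l.length),
      Runs p (w, some l[i]) (Function.update (A i) k (l.drop (i + 1))) T w (A (i + 1)))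
    (c : Option B) : Runs (.loop k p) (w, c) (A 0) (l.length * (T + 1) + 1) w (A l.length) := by
  suffices H : ∀ n i, i + n = l.length → ∀ c,
      Runs (.loop k p) (w, c) (A i) (n * (T + 1) + 1) w (A l.length) by
    exact H l.length 0 (by omega) c
  intro n
  induction n with
  | zero =>
    intro i hi c
    obtain rfl : i = l.length := by omega
    exact ⟨none, 1, by omega, .loop_nil p (w, c) (by rw [hA]; simp)⟩
  | succ n ih =>
    intro i hi c
    have hi' : i < l.length := by omega
    obtain ⟨c', t, ht, h⟩ := hp i hi'
    obtain ⟨c'', t', ht', h'⟩ := ih (i + 1) (by omega) c'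
    refine ⟨c'', 1 + t + t', by rw [add_mul]; omega, .loop_cons (b := l[i]) ?_ h h'⟩
    rw [hA, List.drop_eq_getElem_cons hi']

end Runs

/-- The program that moves stack `k` onto stack `d`, translating the symbols by `g`;
the order is reversed. -/
def Prog.move (k d : ℕ) (g : Option B → B) : Prog B τ := .loop k (.push d g)

theorem Runs.move {k d : ℕ} (hkd : k ≠ d) (g : Option B → B) (w : τ) (c : Option B)
    (S : ℕ → List B) :
    Runs (Prog.move k d g) (w, c) S (2 * (S k).length + 1) w
      (Function.update (Function.update S k []) d
        (((S k).map fun b => g (some b)).reverse ++ S d)) := by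
  have := Runs.loop (p := .push d g) (w := w) (T := 1) (S k)
    (fun i => Function.update (Function.update S k ((S k).drop i)) d
        ((((S k).take i).map fun b => g (some b)).reverse ++ S d)) (k := k)
    (fun i => by simp [Function.update_of_ne hkd]) (by
      intro i hi
      convert Runs.push (w := w) g (some (S k)[i]) (k := d) using 1
      funext j
      by_cases hj : j = d
      · subst hj
        simp [Function.update_of_ne (Ne.symm hkd), List.take_succ_eq_append_getElem hi,
          -List.take_append_getElem]
      · by_cases hj' : j = k
        · subst hj'; simp [Function.update_of_ne hj]
        · simp [Function.update_of_ne hj, Function.update_of_ne hj']) c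
  refine Runs.of_eq this ?_ ?_ (by omega)
  · funext j
    by_cases hj : j = d
    · subst hj; simp
    · rw [Function.update_of_ne hj]; simp
  · simp

/-- Empty stack `k`. -/
def Prog.clear (k : ℕ) : Prog B τ := .loop k .skip

theorem Runs.clear (k : ℕ) (w : τ) (c : Option B) (S : ℕ → List B) :
    Runs (Prog.clear k) (w, c) S (2 * (S k).length + 1) w (Function.update S k []) := by
  have := Runs.loop (p := .skip) (w := w) (T := 1) (S k)
    (fun i => Function.update S k ((S k).drop i)) (k := k) (fun i => by simp)
    (fun i hi => by simpa using Runs.skip) c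
  simp only [List.drop_zero, Function.update_eq_self, List.drop_length] at this
  exact this.mono (by omega)

/-- Add a symbol `u` to stack `d` for each symbol of stack `k`, using the empty stack `e` as
intermediate storage. -/
def Prog.count (u : B) (k d e : ℕ) : Prog B τ :=
  .seq (.loop k (.seq (.push d fun _ => u) (.push e fun c => c.getD u)))
    (Prog.move e k fun c => c.getD u)

theorem Runs.count (u : B) {k d e : ℕ} (hkd : k ≠ d) (hke : k ≠ e) (hde : d ≠ e) (w : τ)
    (c : Option B) (S : ℕ → List B) (he : S e = []) :
    Runs (Prog.count u k d e) (w, c) S (5 * (S k).length + 2) w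
      (Function.update S d (List.replicate (S k).length u ++ S d)) := by
  have h1 := Runs.loop (p := .seq (.push d fun _ => u) (.push e fun c => c.getD u)) (w := w)
    (T := 2) (S k)
    (fun i => Function.update (Function.update (Function.update S k ((S k).drop i)) d
        (List.replicate i u ++ S d)) e ((S k).take i).reverse) (k := k)
    (fun i => by simp [Function.update_of_ne hkd, Function.update_of_ne hke]) (by
      intro i hi
      refine ⟨some (S k)[i], 1 + 1, le_rfl, ?_⟩
      convert Exec.seq (Exec.push d (fun _ => u) (w, some (S k)[i]) _)
        (Exec.push e (fun c => c.getD u) (w, some (S k)[i]) _) using 1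
      funext j
      by_cases hj : j = e
      · subst hj
        simp [Function.update_of_ne (Ne.symm hde), Function.update_of_ne (Ne.symm hke),
          List.take_succ_eq_append_getElem hi,
          -List.take_append_getElem]
      · by_cases hj' : j = d
        · subst hj'; simp [Function.update_of_ne hj, Function.update_of_ne (Ne.symm hkd),
            List.replicate_succ]
        · by_cases hj'' : j = k
          · subst hj''; simp [Function.update_of_ne hj, Function.update_of_ne hj']
          · simp [Function.update_of_ne hj, Function.update_of_ne hj', Function.update_of_ne hj'']) c
  have h2 := fun c' => Runs.move (Ne.symm hke) (fun c => c.getD u) w c' (Function.update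
    (Function.update (Function.update S k ((S k).drop (S k).length)) d
        (List.replicate (S k).length u ++ S d)) e ((S k).take (S k).length).reverse)
  refine Runs.of_eq (h1.seq h2) ?_ ?_ (by simp; omega)
  · funext j
    by_cases hj : j = e
    · subst hj; simp [he]
    · by_cases hj' : j = d
      · subst hj'; simp [Function.update_of_ne hj]
      · simp [Function.update_of_ne hj]
  · funext j
    by_cases hj : j = k
    · subst hj
      simp [Function.update_of_ne hkd, Function.update_of_ne hke]
    · by_cases hj' : j = e
      · subst hj'; simp [Function.update_of_ne hj, Function.update_of_ne (Ne.symm hde), he]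
      · by_cases hj'' : j = d
        · subst hj''; simp [Function.update_of_ne hj, Function.update_of_ne hj']
        · simp [Function.update_of_ne hj, Function.update_of_ne hj', Function.update_of_ne hj'']

/-- Pop from stack `k` as many symbols as there are on the stack `r`. -/
theorem Runs.sub {k r : ℕ} (hkr : k ≠ r) (w : τ) (c : Option B) (S : ℕ → List B) :
    Runs (.loop r (.pop k)) (w, c) S (2 * (S r).length + 1) w
      (Function.update (Function.update S r []) k ((S k).drop (S r).length)) := by
  have := Runs.loop (p := .pop k) (w := w) (T := 1) (S r)
    (fun i => Function.update (Function.update S r ((S r).drop i)) k ((S k).drop i)) (k := r)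
    (fun i => by simp [Function.update_of_ne (Ne.symm hkr)]) (by
      intro i hi
      convert Runs.pop (w := w) (some (S r)[i]) (k := k) using 1
      funext j
      by_cases hj : j = k
      · subst hj; simp [Function.update_of_ne hkr]
      · by_cases hj' : j = r
        · subst hj'; simp [Function.update_of_ne hj]
        · simp [Function.update_of_ne hj, Function.update_of_ne hj']) c
  refine this.of_eq ?_ ?_ (by omega)
  · funext j
    by_cases hj : j = k
    · subst hj; simp
    · rw [Function.update_of_ne hj]; simp
  · simp

/-- Halve the number in stack `k`, using the empty stack `e` as intermediate storage. -/
def Prog.halve (u : B) (k e : ℕ) : Prog B τ :=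
  .seq (.loop k (.seq (.pop k) (.ite Option.isSome (.push e fun _ => u) .skip)))
    (Prog.move e k fun _ => u)

theorem Runs.halve (u : B) {k e : ℕ} (hke : k ≠ e) (w : τ) (c : Option B) (S : ℕ → List B)
    (n : ℕ) (hk : S k = List.replicate n u) (he : S e = []) :
    Runs (Prog.halve u k e) (w, c) S (6 * n + 2) w
      (Function.update S k (List.replicate (n / 2) u)) := by
  have key : ∀ n (S : ℕ → List B) c, S k = List.replicate n u →
      Runs (.loop k (.seq (.pop k) (.ite Option.isSome (.push e fun _ => u) .skip))) (w, c) S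
        (4 * n + 1) w
        (Function.update (Function.update S k []) e (List.replicate (n / 2) u ++ S e)) := by
    intro n
    induction n using Nat.strong_induction_on with
    | _ n ih =>
      intro S c hS
      match n, hS, ih with
      | 0, hS, _ =>
        refine ⟨none, 1, by omega, ?_⟩
        convert Exec.loop_nil _ (w, c) hS using 1
        funext j
        by_cases hj : j = e
        · subst hj; simp
        · rw [Function.update_of_ne hj]
          by_cases hj' : j = k
          · subst hj'; simp [hS]
          · rw [Function.update_of_ne hj']
      | 1, hS, _ =>
        refine ⟨none, 1 + (1 + (1 + 1)) + 1, by omega, ?_⟩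
        refine Exec.loop_cons (b := u) (l := []) hS
          (.seq (.pop k _ _) (.ite_false _ (by simp) (.skip _ _))) ?_
        convert Exec.loop_nil _ _ _ using 1
        · funext j
          by_cases hj : j = e
          · subst hj; simp [Function.update_of_ne (Ne.symm hke)]
          · simp [Function.update_of_ne hj]
        · simp
      | n + 2, hS, ih =>
        have h1 : Exec (.seq (.pop k) (.ite Option.isSome (.push e fun _ => u) .skip))
          (w, some u) (Function.update S k (List.replicate (n + 1) u)) (1 + (1 + 1)) (w, some u)
          (Function.update (Function.update S k (List.replicate n u)) e (u :: S e)) := by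
          refine .seq (.pop k _ _) (.ite_true _ (by simp [List.replicate_succ]) ?_)
          convert Exec.push e (fun _ => u) _ _ using 1
          · simp [List.replicate_succ]
          · simp [List.replicate_succ, Function.update_of_ne (Ne.symm hke)]
        obtain ⟨c', t, ht, h⟩ := ih n (by omega) (Function.update (Function.update S k
          (List.replicate n u)) e (u :: S e)) (some u) (by simp [Function.update_of_ne hke])
        refine ⟨c', 1 + (1 + (1 + 1)) + t, by omega,
          .loop_cons (b := u) (by rw [hS, List.replicate_succ]) h1 ?_⟩
        · convert h using 1
          funext j
          by_cases hj : j = e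
          · subst hj; simp [show (n + 2) / 2 = n / 2 + 1 by omega, List.replicate_succ']
          · simp [Function.update_of_ne hj]
            by_cases hj' : j = k
            · subst hj'; simp
            · simp [Function.update_of_ne hj, Function.update_of_ne hj']
  refine Runs.of_eq ((key n S c hk).seq (fun c => Runs.move (Ne.symm hke) (fun _ => u) w c _))
    rfl ?_ (by simp [he]; omega)
  funext j
  by_cases hj : j = k
  · subst hj; simp [he, Function.update_of_ne hke]
  · by_cases hj' : j = e
    · subst hj'; simp [he, Function.update_of_ne hj]
    · simp [Function.update_of_ne hj, Function.update_of_ne hj']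

end

/-! ### Arithmetic expressions -/

section

open Turing

variable {B τ : Type}

/-- `T` is bounded by a polynomial. -/
def PolyBdd (T : ℕ → ℕ) : Prop := ∃ e, ∀ X, T X ≤ (X + 2) ^ e

namespace PolyBdd

theorem const (c : ℕ) : PolyBdd fun _ => c :=
  ⟨c, fun X => (Nat.lt_two_pow_self).le.trans (Nat.pow_le_pow_left (by omega) c)⟩

theorem id : PolyBdd fun X => X := ⟨1, fun X => by rw [pow_one]; exact Nat.le_add_right X 2⟩

theorem mul {T T' : ℕ → ℕ} (h : PolyBdd T) (h' : PolyBdd T') : PolyBdd fun X => T X * T' X := by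
  obtain ⟨e, h⟩ := h
  obtain ⟨e', h'⟩ := h'
  exact ⟨e + e', fun X => by rw [pow_add]; exact Nat.mul_le_mul (h X) (h' X)⟩

theorem add {T T' : ℕ → ℕ} (h : PolyBdd T) (h' : PolyBdd T') : PolyBdd fun X => T X + T' X := by
  obtain ⟨e, h⟩ := h
  obtain ⟨e', h'⟩ := h'
  refine ⟨e + e' + 1, fun X => ?_⟩
  have h1 : (X + 2) ^ e ≤ (X + 2) ^ (e + e') := Nat.pow_le_pow_right (by omega) (by omega)
  have h2 : (X + 2) ^ e' ≤ (X + 2) ^ (e + e') := Nat.pow_le_pow_right (by omega) (by omega)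
  have h3 : (X + 2) ^ (e + e') * 2 ≤ (X + 2) ^ (e + e' + 1) := by
    rw [pow_succ]; exact Nat.mul_le_mul_left _ (by omega)
  have := h X
  have := h' X
  show T X + T' X ≤ _
  omega

theorem comp {T T' : ℕ → ℕ} (h : PolyBdd T) (h' : PolyBdd T') : PolyBdd fun X => T (T' X) := by
  obtain ⟨e, h⟩ := h
  obtain ⟨e', h'⟩ := h'
  refine ⟨(e' + 2) * e, fun X => (h _).trans ?_⟩
  rw [pow_mul]
  refine Nat.pow_le_pow_left ?_ e
  have h1 : 1 ≤ (X + 2) ^ e' := Nat.one_le_pow _ _ (by omega)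
  have h2 : (X + 2) ^ (e' + 2) = (X + 2) ^ e' * ((X + 2) * (X + 2)) := by ring
  have h3 : (X + 2) ^ e' * 4 ≤ (X + 2) ^ (e' + 2) := by
    rw [h2]; exact Nat.mul_le_mul_left _ (by nlinarith)
  have := h' X
  omega

end PolyBdd

/-- The variables `x`, together with one more variable: a number written in unary. -/
def lift {ι α : Type} (u : B) (x : ι → α → List B) : Option ι → α × ℕ → List B
  | none, p => List.replicate p.2 u
  | some i, p => x i p.1

/-- The functions `f : α → ℕ` that are given by an arithmetic expression in the variables `x i`,
which are strings over `B`; `u` is a fixed symbol, for writing numbers in unary. Values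
of expressions grow at most polynomially in the lengths of the variables, which is why they
can be evaluated in polynomial time in unary arithmetic. -/
inductive Expr (u : B) : {ι α : Type} → (ι → α → List B) → (α → ℕ) → Prop
  | one {ι α : Type} {x : ι → α → List B} : Expr u x fun _ => 1
  | len {ι α : Type} {x : ι → α → List B} (i : ι) : Expr u x fun a => (x i a).length
  | sym {ι α : Type} {x : ι → α → List B} (i : ι) (b : B) {f : α → ℕ} (hf : Expr u x f) :
      Expr u x fun a => open Classical in if (x i a)[f a]? = some b then 1 else 0
  | add {ι α : Type} {x : ι → α → List B} {f g : α → ℕ} (hf : Expr u x f) (hg : Expr u x g) :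
      Expr u x fun a => f a + g a
  | sub {ι α : Type} {x : ι → α → List B} {f g : α → ℕ} (hf : Expr u x f) (hg : Expr u x g) :
      Expr u x fun a => f a - g a
  | shr {ι α : Type} {x : ι → α → List B} {f g : α → ℕ} (hf : Expr u x f) (hg : Expr u x g) :
      Expr u x fun a => f a / 2 ^ g a
  | sum {ι α : Type} {x : ι → α → List B} {f : α → ℕ} {g : α → ℕ → ℕ} (hf : Expr u x f)
      (hg : Expr u (lift u x) fun p => g p.1 p.2) :
      Expr u x fun a => ∑ i ∈ Finset.range (f a), g a i

/-- `f` can be evaluated in polynomial time by a program that reads the variables from the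
stacks `loc i`, and uses the stacks from `d` on as workspace and for the result. -/
def Compiles (τ : Type) (u : B) {ι α : Type} (x : ι → α → List B) (f : α → ℕ) (loc : ι → ℕ)
    (d : ℕ) : Prop :=
  ∃ (p : Prog B τ) (T : ℕ → ℕ), PolyBdd T ∧ ∀ a X (w : τ) c S, (∀ i, S (loc i) = x i a) →
    (∀ j, d ≤ j → S j = []) → (∀ i, (x i a).length ≤ X) →
    f a ≤ T X ∧ Runs p (w, c) S (T X) w (Function.update S d (List.replicate (f a) u))

section Compile

variable {u : B} {ι α : Type} {x : ι → α → List B} {f g : α → ℕ} {loc : ι → ℕ} {d : ℕ}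

theorem Compiles.one : Compiles τ u x (fun _ => 1) loc d := by
  refine ⟨.push d fun _ => u, fun _ => 1, .const 1, fun a X w c S hS hd hX => ⟨le_rfl, ?_⟩⟩
  refine (Runs.push _ c).of_eq rfl ?_ le_rfl
  rw [hd d le_rfl]
  rfl

theorem Compiles.len (i : ι) (hloc : ∀ i, loc i < d) :
    Compiles τ u x (fun a => (x i a).length) loc d := by
  refine ⟨.count u (loc i) d (d + 1), fun X => 5 * X + 2, .add (.mul (.const 5) .id) (.const 2),
    fun a X w c S hS hd hX => ⟨by have := hX i; dsimp only; omega, ?_⟩⟩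
  have := hloc i
  refine (Runs.count u (by omega) (by omega) (by omega) w c S (hd _ (by omega))).of_eq rfl ?_ ?_
  · rw [hd d le_rfl, hS i, List.append_nil]
  · rw [hS i]; have := hX i; dsimp only; omega

theorem Compiles.add (hf : Compiles τ u x f loc d) (hg : Compiles τ u x g loc (d + 1))
    (hloc : ∀ i, loc i < d) : Compiles τ u x (fun a => f a + g a) loc d := by
  obtain ⟨p, T, hT, hp⟩ := hf
  obtain ⟨q, T', hT', hq⟩ := hg
  refine ⟨.seq p (.seq q (.move (d + 1) d fun _ => u)), fun X => T X + (T' X + (2 * T' X + 1)),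
    hT.add (hT'.add ((PolyBdd.mul (.const 2) hT').add (.const 1))),
    fun a X w c S hS hd hX => ?_⟩
  obtain ⟨h1, h2⟩ := hp a X w c S hS hd hX
  have H := fun c => hq a X w c (Function.update S d (List.replicate (f a) u))
    (fun i => by rw [Function.update_of_ne (hloc i).ne]; exact hS i)
    (fun j hj => by rw [Function.update_of_ne (by omega)]; exact hd j (by omega)) hX
  have h3 := (H c).1
  refine ⟨by dsimp only; omega, Runs.of_eq (h2.seq fun c => (H c).2.seq fun c =>
    Runs.move (by omega) _ w c _) rfl ?_ (by simp; omega)⟩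
  funext j
  rcases eq_or_ne j d with rfl | hj
  · simp [add_comm (f a)]
  rcases eq_or_ne j (d + 1) with rfl | hj'
  · simp [hd]
  · simp [Function.update_of_ne hj, Function.update_of_ne hj']

theorem Compiles.sub (hf : Compiles τ u x f loc d) (hg : Compiles τ u x g loc (d + 1))
    (hloc : ∀ i, loc i < d) : Compiles τ u x (fun a => f a - g a) loc d := by
  obtain ⟨p, T, hT, hp⟩ := hf
  obtain ⟨q, T', hT', hq⟩ := hg
  refine ⟨.seq p (.seq q (.loop (d + 1) (.pop d))), fun X => T X + (T' X + (2 * T' X + 1)),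
    hT.add (hT'.add ((PolyBdd.mul (.const 2) hT').add (.const 1))),
    fun a X w c S hS hd hX => ?_⟩
  obtain ⟨h1, h2⟩ := hp a X w c S hS hd hX
  have H := fun c => hq a X w c (Function.update S d (List.replicate (f a) u))
    (fun i => by rw [Function.update_of_ne (hloc i).ne]; exact hS i)
    (fun j hj => by rw [Function.update_of_ne (by omega)]; exact hd j (by omega)) hX
  have h3 := (H c).1
  refine ⟨by dsimp only; omega, Runs.of_eq (h2.seq fun c => (H c).2.seq fun c =>
    Runs.sub (by omega) w c _) rfl ?_ (by simp; omega)⟩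
  funext j
  rcases eq_or_ne j d with rfl | hj
  · simp
  rcases eq_or_ne j (d + 1) with rfl | hj'
  · simp [hd]
  · simp [Function.update_of_ne hj, Function.update_of_ne hj']

theorem Compiles.shr (hf : Compiles τ u x f loc d) (hg : Compiles τ u x g loc (d + 1))
    (hloc : ∀ i, loc i < d) : Compiles τ u x (fun a => f a / 2 ^ g a) loc d := by
  obtain ⟨p, T, hT, hp⟩ := hf
  obtain ⟨q, T', hT', hq⟩ := hg
  refine ⟨.seq p (.seq q (.loop (d + 1) (.halve u d (d + 2)))),
    fun X => T X + (T' X + (T' X * (6 * T X + 3) + 1)),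
    hT.add (hT'.add ((hT'.mul (.add (.mul (.const 6) hT) (.const 3))).add (.const 1))),
    fun a X w c S hS hd hX => ?_⟩
  obtain ⟨h1, h2⟩ := hp a X w c S hS hd hX
  have H := fun c => hq a X w c (Function.update S d (List.replicate (f a) u))
    (fun i => by rw [Function.update_of_ne (hloc i).ne]; exact hS i)
    (fun j hj => by rw [Function.update_of_ne (by omega)]; exact hd j (by omega)) hX
  have h3 := (H c).1
  have h4 := fun c => Runs.loop (p := Prog.halve u d (d + 2)) (w := w) (k := d + 1) (c := c)
    (T := 6 * f a + 2) (List.replicate (g a) u)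
    (fun i => Function.update (Function.update S d (List.replicate (f a / 2 ^ i) u)) (d + 1)
      ((List.replicate (g a) u).drop i)) (fun i => by simp) (by
      intro i hi
      have h5 : f a / 2 ^ i ≤ f a := Nat.div_le_self _ _
      refine (Runs.halve u (by omega) w _ _ (f a / 2 ^ i) ?_ ?_).of_eq rfl ?_ (by omega)
      · simp
      · simp [hd]
      · funext j
        rcases eq_or_ne j d with rfl | hj
        · simp [Nat.div_div_eq_div_mul, pow_succ]
        rcases eq_or_ne j (d + 1) with rfl | hj'
        · simp
        · simp [Function.update_of_ne hj, Function.update_of_ne hj'])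
  refine ⟨(Nat.div_le_self _ _).trans (by dsimp only; omega), Runs.of_eq (h2.seq fun c => (H c).2.seq fun c =>
    (h4 c).of_eq ?_ rfl le_rfl) rfl ?_ ?_⟩
  · funext j
    rcases eq_or_ne j d with rfl | hj
    · simp
    rcases eq_or_ne j (d + 1) with rfl | hj'
    · simp
    · simp [Function.update_of_ne hj, Function.update_of_ne hj']
  · funext j
    rcases eq_or_ne j d with rfl | hj
    · simp
    rcases eq_or_ne j (d + 1) with rfl | hj'
    · simp [hd]
    · simp [Function.update_of_ne hj, Function.update_of_ne hj']
  · have : g a * (6 * f a + 2 + 1) ≤ T' X * (6 * T X + 3) := Nat.mul_le_mul h3 (by omega)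
    simp only [List.length_replicate]
    omega

theorem Compiles.sum {g : α → ℕ → ℕ} (hf : Compiles τ u x f loc (d + 1))
    (hg : Compiles τ u (lift u x) (fun p => g p.1 p.2) (fun i => i.elim (d + 2) loc) (d + 3))
    (hloc : ∀ i, loc i < d) :
    Compiles τ u x (fun a => ∑ i ∈ Finset.range (f a), g a i) loc d := by
  obtain ⟨p, T, hT, hp⟩ := hf
  obtain ⟨q, T', hT', hq⟩ := hg
  refine ⟨.seq p (.seq (.loop (d + 1) (.seq q (.seq (.move (d + 3) d fun _ => u)
      (.push (d + 2) fun _ => u)))) (.clear (d + 2))),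
    fun X => T X + ((T X * (3 * T' (X + T X) + 3) + 1) + (2 * T X + 1)),
    hT.add (((hT.mul (.add (.mul (.const 3) (hT'.comp (.add .id hT))) (.const 3))).add
      (.const 1)).add (.add (.mul (.const 2) hT) (.const 1))),
    fun a X w c S hS hd hX => ?_⟩
  obtain ⟨h1, h2⟩ := hp a X w c S hS (fun j hj => hd j (by omega)) hX
  set s : ℕ → ℕ := fun n => ∑ i ∈ Finset.range n, g a i with hs
  let A : ℕ → ℕ → List B := fun i => Function.update (Function.update (Function.update S d
    (List.replicate (s i) u)) (d + 1) ((List.replicate (f a) u).drop i)) (d + 2)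
      (List.replicate i u)
  have H := fun i (hi : i < f a) c => hq (a, i) (X + T X) w c
    (Function.update (A i) (d + 1) ((List.replicate (f a) u).drop (i + 1)))
    (fun o => by
      cases o with
      | none => simp [A, lift]
      | some k =>
        have := hloc k
        simp only [Option.elim_some, A, lift]
        rw [Function.update_of_ne (by omega), Function.update_of_ne (by omega),
          Function.update_of_ne (by omega), Function.update_of_ne (by omega), hS])
    (fun j hj => by
        simp only [A]
        rw [Function.update_of_ne (by omega), Function.update_of_ne (by omega),
          Function.update_of_ne (by omega), Function.update_of_ne (by omega), hd j (by omega)])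
    (fun o => by
      cases o with
      | none => simp only [lift, List.length_replicate]; omega
      | some k => exact (hX k).trans (by omega))
  have hle : ∀ i < f a, g a i ≤ T' (X + T X) := fun i hi => (H i hi none).1
  have h4 := fun c => Runs.loop (p := .seq q (.seq (.move (d + 3) d fun _ => u)
      (.push (d + 2) fun _ => u))) (w := w) (k := d + 1) (c := c)
    (T := 3 * T' (X + T X) + 2) (List.replicate (f a) u) A (fun i => by simp [A]) (by
      intro i hi
      rw [List.length_replicate] at hi
      refine Runs.of_eq ((H i hi _).2.seq fun c => (Runs.move (by omega) _ w c _).seq fun c =>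
        Runs.push _ c) rfl ?_ ?_
      · funext j
        rcases eq_or_ne j d with rfl | hj
        · simp [A, hs, Finset.sum_range_succ, add_comm]
        rcases eq_or_ne j (d + 1) with rfl | hj'
        · simp [A]
        rcases eq_or_ne j (d + 2) with rfl | hj''
        · simp [A, List.replicate_succ]
        rcases eq_or_ne j (d + 3) with rfl | hj'''
        · simp [A, hd]
        · simp [A, Function.update_of_ne hj, Function.update_of_ne hj', Function.update_of_ne hj'',
            Function.update_of_ne hj''']
      · have := hle i hi
        simp
        omega)
  refine ⟨?_, Runs.of_eq (h2.seq fun c => ((h4 c).of_eq ?_ rfl le_rfl).seq fun c =>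
    Runs.clear _ w c _) rfl ?_ ?_⟩
  · have h5 : s (f a) ≤ f a * T' (X + T X) := by
      have := Finset.sum_le_card_nsmul (Finset.range (f a)) (g a) (T' (X + T X))
        (fun i hi => hle i (Finset.mem_range.1 hi))
      simpa using this
    have h6 : f a * T' (X + T X) ≤ T X * (3 * T' (X + T X) + 3) := Nat.mul_le_mul h1 (by omega)
    refine h5.trans ?_
    dsimp only
    omega
  · funext j
    rcases eq_or_ne j d with rfl | hj
    · simp [A, hs, hd]
    rcases eq_or_ne j (d + 1) with rfl | hj'
    · simp [A]
    rcases eq_or_ne j (d + 2) with rfl | hj''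
    · simp [A, hd]
    · simp [A, Function.update_of_ne hj, Function.update_of_ne hj', Function.update_of_ne hj'']
  · funext j
    rcases eq_or_ne j d with rfl | hj
    · simp [A, hs]
    rcases eq_or_ne j (d + 1) with rfl | hj'
    · simp [A, hd]
    rcases eq_or_ne j (d + 2) with rfl | hj''
    · simp [A, hd]
    · simp [A, Function.update_of_ne hj, Function.update_of_ne hj', Function.update_of_ne hj'']
  · have : f a * (3 * T' (X + T X) + 2 + 1) ≤ T X * (3 * T' (X + T X) + 3) :=
      Nat.mul_le_mul h1 (by omega)
    simp [A]
    omega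

open Classical in
theorem Compiles.sym (i : ι) (b : B) (hf : Compiles τ u x f loc (d + 1))
    (hloc : ∀ i, loc i < d) :
    Compiles τ u x (fun a => if (x i a)[f a]? = some b then 1 else 0) loc d := by
  obtain ⟨p, T, hT, hp⟩ := hf
  let r : Option B → B := fun c => c.getD u
  let body : Prog B τ := .seq (.pop (loc i)) (.ite Option.isSome (.push (d + 2) r) .skip)
  let peek : Prog B τ := .seq (.pop (loc i)) (.ite Option.isSome (.seq (.push (loc i) r)
    (.ite (fun c => decide (c = some b)) (.push d fun _ => u) .skip)) .skip)
  refine ⟨.seq p (.seq (.loop (d + 1) body) (.seq peek (.move (d + 2) (loc i) r))),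
    fun X => T X + ((T X * 4 + 1) + (5 + (2 * T X + 1))),
    hT.add (((hT.mul (.const 4)).add (.const 1)).add ((PolyBdd.const 5).add
      (.add (.mul (.const 2) hT) (.const 1)))),
    fun a X w c S hS hd hX => ?_⟩
  obtain ⟨h1, h2⟩ := hp a X w c S hS (fun j hj => hd j (by omega)) hX
  have hi := hloc i
  let l := x i a
  let A : ℕ → ℕ → List B := fun n => Function.update (Function.update (Function.update S (loc i)
    (l.drop n)) (d + 1) ((List.replicate (f a) u).drop n)) (d + 2) (l.take n).reverse
  have h3 := fun c => Runs.loop (p := body) (w := w) (k := d + 1) (c := c)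
    (T := 3) (List.replicate (f a) u) A (fun i => by simp [A]) (by
      intro n hn
      set S' := Function.update (A n) (d + 1) ((List.replicate (f a) u).drop (n + 1)) with hS'
      have e1 : S' (loc i) = l.drop n := by
        rw [hS', Function.update_of_ne (by omega)]
        simp only [A]
        rw [Function.update_of_ne (by omega), Function.update_of_ne (by omega),
          Function.update_self]
      have e2 := Exec.pop (loc i) (w, some (List.replicate (f a) u)[n]) S'
      have e4 : l[n]? = (l.drop n).head? := by simp
      have e5 : l.drop (n + 1) = (l.drop n).tail := by simp
      by_cases hl : n < l.length
      · have e6 : l.take (n + 1) = l.take n ++ [l[n]] := List.take_succ_eq_append_getElem hl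
        have e7 : (l.drop n).head? = some l[n] := by simp [hl]
        rw [e1, e7] at e2
        refine ⟨some l[n], 3, le_rfl, Exec.seq e2 (.ite_true (t := 1) _ ?_ ?_)⟩
        · rfl
        · convert Exec.push (d + 2) r _ _ using 1
          · funext j
            rcases eq_or_ne j (d + 2) with rfl | hj
            · simp [A, e6, r, -List.take_append_getElem,
                Function.update_of_ne (show d + 2 ≠ loc i by omega), hS']
            rcases eq_or_ne j (d + 1) with rfl | hj'
            · simp [A, hS', Function.update_of_ne (show d + 1 ≠ loc i by omega)]
            rcases eq_or_ne j (loc i) with rfl | hj''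
            · simp [A, Function.update_of_ne hj, Function.update_of_ne hj']
            · simp [A, hS', Function.update_of_ne hj, Function.update_of_ne hj',
                Function.update_of_ne hj'']
      · have e6 : l.drop n = [] := by simp; omega
        refine ⟨none, 3, le_rfl, Exec.seq e2 (.ite_false (t := 1) _ ?_ ?_)⟩
        · simp [e1, e6]
        · convert Exec.skip _ _ using 1
          · simp [e1, e6]
          · funext j
            rcases eq_or_ne j (d + 2) with rfl | hj
            · simp [A, hS', Function.update_of_ne (show d + 2 ≠ loc i by omega),
                List.take_of_length_le (show l.length ≤ n by omega),
                List.take_of_length_le (show l.length ≤ n + 1 by omega)]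
            rcases eq_or_ne j (d + 1) with rfl | hj'
            · simp [A, hS', Function.update_of_ne (show d + 1 ≠ loc i by omega)]
            rcases eq_or_ne j (loc i) with rfl | hj''
            · simp [A, Function.update_of_ne hj, Function.update_of_ne hj', e1]
            · simp [A, hS', Function.update_of_ne hj, Function.update_of_ne hj',
                Function.update_of_ne hj''])
  rw [List.length_replicate] at h3
  set v := if l[f a]? = some b then 1 else 0 with hv
  have e1 : A (f a) (loc i) = l.drop (f a) := by
    simp only [A]
    rw [Function.update_of_ne (by omega), Function.update_of_ne (by omega),
      Function.update_self]
  have hAd : A (f a) d = [] := by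
    simp only [A]
    rw [Function.update_of_ne (by omega), Function.update_of_ne (by omega),
      Function.update_of_ne (by omega), hd d le_rfl]
  have h4 : ∀ c, Runs peek (w, c) (A (f a)) 5 w
      (Function.update (A (f a)) d (List.replicate v u)) := by
    intro c
    have e2 := Exec.pop (loc i) (w, c) (A (f a))
    rw [e1] at e2
    by_cases hl : f a < l.length
    · have e7 : (l.drop (f a)).head? = some l[f a] := by simp [hl]
      rw [e7] at e2
      have e8 : l[f a] :: (l.drop (f a)).tail = l.drop (f a) := by
        rw [List.tail_drop]; exact List.getElem_cons_drop hl
      have e9 := Exec.push (loc i) r (w, some l[f a])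
        (Function.update (A (f a)) (loc i) (l.drop (f a)).tail)
      have e10 : Function.update (A (f a)) (loc i) (l.drop (f a)) = A (f a) := by
        rw [← e1]; exact Function.update_eq_self _ _
      simp only [r, Option.getD_some, Function.update_self, e8, Function.update_idem, e10] at e9
      by_cases hb : l[f a] = b
      · have hv1 : v = 1 := by rw [hv, if_pos (by rw [List.getElem?_eq_getElem hl, hb])]
        refine ⟨some l[f a], 1 + (1 + (1 + (1 + 1))), by omega, .seq e2 (.ite_true _ rfl (.seq e9
          (.ite_true _ (by simp [hb]) ?_)))⟩
        · convert Exec.push d (fun _ => u) _ _ using 1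
          rw [hAd, hv1]
          rfl
      · have hv1 : v = 0 := by
          rw [hv, if_neg (by rw [List.getElem?_eq_getElem hl]; simpa using hb)]
        refine ⟨some l[f a], 1 + (1 + (1 + (1 + 1))), by omega, .seq e2 (.ite_true _ rfl (.seq e9
          (.ite_false _ (by simp [hb]) ?_)))⟩
        · convert Exec.skip _ _ using 1
          rw [hv1, List.replicate_zero, ← hAd]
          exact Function.update_eq_self _ _
    · have e6 : l.drop (f a) = [] := by simp; omega
      have hv1 : v = 0 := by
        rw [hv, if_neg]
        rw [List.getElem?_eq_none (by omega)]
        simp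
      rw [e6] at e2
      refine ⟨none, 1 + (1 + 1), by omega, .seq e2 (.ite_false _ rfl ?_)⟩
      · convert Exec.skip _ _ using 1
        · rfl
        rw [hv1, List.replicate_zero, ← hAd, Function.update_eq_self]
        rw [e6] at e1
        rw [hAd, List.tail_nil, ← e1, Function.update_eq_self]
  have hvle : v ≤ 1 := by rw [hv]; split_ifs <;> omega
  refine ⟨hvle.trans (by dsimp only; omega), Runs.of_eq (h2.seq fun c => ((h3 c).of_eq ?_ rfl le_rfl).seq fun c =>
    (h4 c).seq fun c => Runs.move (by omega) r w c _) rfl ?_ ?_⟩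
  · funext j
    rcases eq_or_ne j (d + 2) with rfl | hj
    · simp [A, hd]
    rcases eq_or_ne j (d + 1) with rfl | hj'
    · simp [A]
    rcases eq_or_ne j (loc i) with rfl | hj''
    · simp [A, Function.update_of_ne hj, Function.update_of_ne hj', hS i, l]
    · simp [A, Function.update_of_ne hj, Function.update_of_ne hj', Function.update_of_ne hj'']
  · funext j
    rcases eq_or_ne j (loc i) with rfl | hj''
    · rw [Function.update_self, Function.update_of_ne (by omega), Function.update_of_ne (by omega),
        Function.update_of_ne (by omega), e1, hS i]
      simp [A, r, l]
    rcases eq_or_ne j d with rfl | hj'''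
    · simp [Function.update_of_ne hj'', v, l]
    rcases eq_or_ne j (d + 2) with rfl | hj
    · simp [Function.update_of_ne hj'', hd]
    rcases eq_or_ne j (d + 1) with rfl | hj'
    · simp [A, Function.update_of_ne hj'', hd]
    · simp [A, Function.update_of_ne hj, Function.update_of_ne hj', Function.update_of_ne hj'',
        Function.update_of_ne hj''']
  · simp [A]
    omega

theorem Expr.compile (h : Expr u x f) (loc : ι → ℕ) (d : ℕ) (hloc : ∀ i, loc i < d) :
    Compiles τ u x f loc d := by
  induction h generalizing d with
  | one => exact .one
  | len i => exact .len i hloc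
  | sym i b _ ih => exact .sym i b (ih loc (d + 1) fun i => (hloc i).trans (by omega)) hloc
  | add _ _ ih ih' => exact .add (ih loc d hloc) (ih' loc _ fun i => (hloc i).trans (by omega)) hloc
  | sub _ _ ih ih' => exact .sub (ih loc d hloc) (ih' loc _ fun i => (hloc i).trans (by omega)) hloc
  | shr _ _ ih ih' => exact .shr (ih loc d hloc) (ih' loc _ fun i => (hloc i).trans (by omega)) hloc
  | sum _ _ ih ih' =>
    refine .sum (ih loc _ fun i => (hloc i).trans (by omega)) (ih' _ _ ?_) hloc
    rintro (_ | i)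
    · simp
    · exact (hloc i).trans (by omega)

end Compile

end

/-! ### Exponential time bounds -/

section

open Turing

variable {B τ : Type}

/-- `T n` is bounded by `2 ^ p n` for a polynomial `p`. -/
def ExpBdd (T : ℕ → ℕ) : Prop := ∃ p : Polynomial ℕ, ∀ n, T n ≤ 2 ^ p.eval n

namespace ExpBdd

theorem of_le {T T' : ℕ → ℕ} (h : ExpBdd T') (hT : ∀ n, T n ≤ T' n) : ExpBdd T :=
  let ⟨p, hp⟩ := h
  ⟨p, fun n => (hT n).trans (hp n)⟩

theorem two_pow (p : Polynomial ℕ) : ExpBdd fun n => 2 ^ p.eval n := ⟨p, fun _ => le_rfl⟩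

theorem eval (p : Polynomial ℕ) : ExpBdd fun n => p.eval n :=
  ⟨p, fun _ => Nat.lt_two_pow_self.le⟩

theorem const (c : ℕ) : ExpBdd fun _ => c := (eval (Polynomial.C c)).of_le fun n => by simp

theorem mul {T T' : ℕ → ℕ} (h : ExpBdd T) (h' : ExpBdd T') : ExpBdd fun n => T n * T' n := by
  obtain ⟨p, hp⟩ := h
  obtain ⟨q, hq⟩ := h'
  exact ⟨p + q, fun n => by
    rw [Polynomial.eval_add, pow_add]; exact Nat.mul_le_mul (hp n) (hq n)⟩

theorem add {T T' : ℕ → ℕ} (h : ExpBdd T) (h' : ExpBdd T') : ExpBdd fun n => T n + T' n := by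
  obtain ⟨p, hp⟩ := h
  obtain ⟨q, hq⟩ := h'
  refine ((two_pow p).mul (two_pow q)).mul (const 2) |>.of_le fun n => ?_
  have h1 : 1 ≤ 2 ^ p.eval n := Nat.one_le_two_pow
  have h2 : 1 ≤ 2 ^ q.eval n := Nat.one_le_two_pow
  have := hp n
  have := hq n
  nlinarith

theorem pow {T : ℕ → ℕ} (h : ExpBdd T) (e : ℕ) : ExpBdd fun n => T n ^ e := by
  obtain ⟨p, hp⟩ := h
  exact ⟨p * Polynomial.C e, fun n => by
    rw [Polynomial.eval_mul, Polynomial.eval_C, pow_mul]; exact Nat.pow_le_pow_left (hp n) e⟩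

theorem comp {T T' : ℕ → ℕ} (h : PolyBdd T) (h' : ExpBdd T') : ExpBdd fun n => T (T' n) := by
  obtain ⟨e, he⟩ := h
  exact ((h'.add (const 2)).pow e).of_le fun n => he _

end ExpBdd

/-! ### Output lengths -/

section OutputLength

variable {K Λ σ : Type} {Γ : K → Type} [DecidableEq K]

/-- The maximal number of symbols that a statement pushes. -/
def pushes : TM2.Stmt Γ Λ σ → ℕ
  | .push _ _ q => pushes q + 1
  | .peek _ _ q => pushes q
  | .pop _ _ q => pushes q
  | .load _ q => pushes q
  | .branch _ q q' => max (pushes q) (pushes q')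
  | .goto _ => 0
  | .halt => 0

theorem length_stepAux_le (q : TM2.Stmt Γ Λ σ) (v : σ) (S : ∀ k, List (Γ k)) (k : K) :
    ((TM2.stepAux q v S).stk k).length ≤ (S k).length + pushes q := by
  induction q generalizing v S with
  | push k' f q ih =>
    refine (ih _ _).trans ?_
    rw [pushes]
    by_cases hk : k = k'
    · subst hk; simp; omega
    · rw [Function.update_of_ne hk]; omega
  | peek k' f q ih => exact ih _ _
  | pop k' f q ih =>
    refine (ih _ _).trans ?_
    rw [pushes]
    by_cases hk : k = k'
    · subst hk; simp
    · rw [Function.update_of_ne hk]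
  | load f q ih => exact ih _ _
  | branch f q q' ih ih' =>
    simp only [TM2.stepAux.eq_5, pushes]
    cases f v
    · exact (ih' _ _).trans (by omega)
    · exact (ih _ _).trans (by omega)
  | goto f => simp [pushes]
  | halt => simp [pushes]

theorem length_iterate_le (m : Λ → TM2.Stmt Γ Λ σ) (c : ℕ) (hc : ∀ l, pushes (m l) ≤ c) (t : ℕ)
    (C C' : TM2.Cfg Γ Λ σ) (h : (flip Bind.bind (TM2.step m))^[t] (some C) = some C') (k : K) :
    (C'.stk k).length ≤ (C.stk k).length + c * t := by
  induction t generalizing C' with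
  | zero =>
    obtain rfl : C = C' := Option.some.inj h
    simp
  | succ t ih =>
    rw [Function.iterate_succ_apply'] at h
    rcases h' : (flip Bind.bind (TM2.step m))^[t] (some C) with _ | D
    · rw [h'] at h
      simp [flip] at h
    · rw [h'] at h
      have h1 := ih D h'
      obtain ⟨l, v, S⟩ := D
      cases l with
      | none => simp [flip, TM2.step] at h
      | some l =>
        obtain rfl : TM2.stepAux (m l) v S = C' := Option.some.inj h
        have := length_stepAux_le (m l) v S k
        have := hc l
        rw [mul_add]
        simp only at h1
        omega

end OutputLength

theorem initList_stk_self (M : FinTM2) (l : List (M.Γ M.k₀)) : (initList M l).stk M.k₀ = l := by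
  simp [initList]

theorem initList_stk_of_ne (M : FinTM2) (l : List (M.Γ M.k₀)) {k : M.K} (hk : k ≠ M.k₀) :
    (initList M l).stk k = [] := by
  simp [initList, hk]

theorem haltList_stk_self (M : FinTM2) (l : List (M.Γ M.k₁)) : (haltList M l).stk M.k₁ = l := by
  simp [haltList]

/-- The length of the output of a function that is computable in polynomial time is polynomial. -/
theorem exists_length_le {α β αΓ βΓ : Type} {ea : α → List αΓ} {eb : β → List βΓ} {f : α → β}
    (M : TM2ComputableInPolyTime ea eb f) :
    ∃ p : Polynomial ℕ, ∀ a, (eb (f a)).length ≤ p.eval (ea a).length := by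
  have := M.tm.ΛFin
  let c := Finset.univ.sup fun l => pushes (M.tm.m l)
  refine ⟨Polynomial.X + Polynomial.C c * M.time, fun a => ?_⟩
  obtain ⟨⟨t, ht⟩, ht'⟩ := M.outputsFun a
  have h1 := length_iterate_le M.tm.m c (fun l => Finset.le_sup (f := fun l => pushes (M.tm.m l))
    (Finset.mem_univ l)) t _ _ ht M.tm.k₁
  have h2 : ((haltList M.tm ((eb (f a)).map M.outputAlphabet.invFun)).stk M.tm.k₁).length =
    (eb (f a)).length := by rw [haltList_stk_self, List.length_map]
  have h3 : ((initList M.tm ((ea a).map M.inputAlphabet.invFun)).stk M.tm.k₁).length ≤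
      (ea a).length := by
    by_cases hk : M.tm.k₁ = M.tm.k₀
    · rw [hk, initList_stk_self, List.length_map]
    · rw [initList_stk_of_ne _ _ hk]; simp
  have h4 : c * t ≤ c * M.time.eval (ea a).length := Nat.mul_le_mul_left _ ht'
  simp only [Polynomial.eval_add, Polynomial.eval_X, Polynomial.eval_mul, Polynomial.eval_C]
  exact h2.symm.le.trans (h1.trans (Nat.add_le_add h3 h4))

/-! ### More programs -/

/-- Calling a subroutine on its input. -/
theorem Runs.call (M : Subroutine B τ) {w : τ} (hw : M.get w = M.M.initialState)
    {l : List (M.M.Γ M.M.k₀)} {l' : List (M.M.Γ M.M.k₁)} {t : ℕ}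
    (h : TM2OutputsInTime M.M l (some l') t) {S : ℕ → List B}
    (hS₀ : S (M.e M.M.k₀) = l.map (M.enc _)) (hS : ∀ k, k ≠ M.M.k₀ → S (M.e k) = []) :
    ∃ S' : ℕ → List B, (∀ c, Runs (.call M) (w, c) S t w S') ∧
      S' (M.e M.M.k₁) = l'.map (M.enc _) ∧ ∀ i, (∀ k, i ≠ M.e k) → S' i = S i := by
  classical
  let S' : ℕ → List B := fun i =>
    if h : ∃ k, i = M.e k then ((haltList M.M l').stk h.choose).map (M.enc _) else S i
  have hS' : ∀ k, S' (M.e k) = ((haltList M.M l').stk k).map (M.enc k) := by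
    intro k
    have h : ∃ k', M.e k = M.e k' := ⟨k, rfl⟩
    have h' : h.choose = k := (M.e_inj h.choose_spec).symm
    simp only [S', dif_pos h]
    rw [h']
  obtain ⟨⟨t', ht⟩, ht'⟩ := h
  refine ⟨S', fun c => ⟨c, t', ht', ?_⟩, ?_, ?_⟩
  · convert Exec.call M (v := (w, c)) (S := S) (S' := S') (t := t') (C := initList M.M l)
      (C' := haltList M.M l') rfl hw.symm ?_ ht rfl hS' ?_ using 2
    · exact (M.put_get w).symm.trans (by rw [hw]; rfl)
    · intro k
      by_cases hk : k = M.M.k₀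
      · subst hk; rw [hS₀, initList_stk_self]
      · rw [hS k hk, initList_stk_of_ne _ _ hk]; rfl
    · intro i hi
      simp only [S']
      rw [dif_neg]
      push Not
      exact hi
  · rw [hS', haltList_stk_self]
  · intro i hi
    simp only [S']
    rw [dif_neg]
    push Not
    exact hi

/-- Copy stack `k` on top of stack `d`, translating symbols by `g`, using the empty stack `e` as
intermediate storage. -/
def Prog.copy (u : B) (k d e : ℕ) (g : Option B → B) : Prog B τ :=
  .seq (.move k e fun c => c.getD u) (.loop e (.seq (.push k fun c => c.getD u) (.push d g)))

theorem Runs.copy (u : B) {k d e : ℕ} (hkd : k ≠ d) (hke : k ≠ e) (hde : d ≠ e)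
    (g : Option B → B) (w : τ) (c : Option B) (S : ℕ → List B) (he : S e = []) :
    Runs (Prog.copy u k d e g) (w, c) S (5 * (S k).length + 2) w
      (Function.update S d (((S k).map fun b => g (some b)) ++ S d)) := by
  have h1 := Runs.move hke (fun c => c.getD u) w c S
  have h2 := fun c => Runs.loop (p := .seq (.push k fun c => c.getD u) (.push d g)) (w := w)
    (T := 2) (k := e) (c := c) (S k).reverse
    (fun i => Function.update (Function.update (Function.update S k ((S k).reverse.take i).reverse)
      e ((S k).reverse.drop i)) d
        ((((S k).reverse.take i).map fun b => g (some b)).reverse ++ S d))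
    (fun i => by simp [Function.update_of_ne (Ne.symm hde)]) (by
      intro i hi
      refine ⟨some (S k).reverse[i], 1 + 1, le_rfl, ?_⟩
      convert Exec.seq (Exec.push k (fun c => c.getD u) (w, some (S k).reverse[i]) _)
        (Exec.push d g (w, some (S k).reverse[i]) _) using 1
      rw [List.take_succ_eq_append_getElem hi]
      funext j
      rcases eq_or_ne j d with rfl | hj
      · simp [Function.update_of_ne hkd.symm, Function.update_of_ne hde,
          -List.take_append_getElem, -List.map_take, -List.getElem_reverse]
      rcases eq_or_ne j k with rfl | hj'
      · simp [Function.update_of_ne hkd, Function.update_of_ne hke,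
          -List.take_append_getElem, -List.map_take, -List.getElem_reverse]
      rcases eq_or_ne j e with rfl | hj''
      · simp [Function.update_of_ne hj, Function.update_of_ne hj']
      · simp [Function.update_of_ne hj, Function.update_of_ne hj', Function.update_of_ne hj''])
  refine Runs.of_eq (h1.seq fun c => (h2 c).of_eq ?_ rfl le_rfl) rfl ?_ (by simp; omega)
  · funext j
    rcases eq_or_ne j d with rfl | hj
    · simp [Function.update_of_ne hkd.symm, Function.update_of_ne hde]
    rcases eq_or_ne j e with rfl | hj''
    · simp [Function.update_of_ne hj, he]
    rcases eq_or_ne j k with rfl | hj'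
    · simp [Function.update_of_ne hj, Function.update_of_ne hj'']
    · simp [Function.update_of_ne hj, Function.update_of_ne hj', Function.update_of_ne hj'']
  · funext j
    rcases eq_or_ne j d with rfl | hj
    · rw [Function.update_self, Function.update_self, List.take_length, List.map_reverse,
        List.reverse_reverse]
    rcases eq_or_ne j e with rfl | hj''
    · simp [Function.update_of_ne hj, he]
    rcases eq_or_ne j k with rfl | hj'
    · rw [Function.update_of_ne hj, Function.update_of_ne hj'', Function.update_self,
        Function.update_of_ne hj, List.take_length, List.reverse_reverse]
    · simp [Function.update_of_ne hj, Function.update_of_ne hj', Function.update_of_ne hj'']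

/-- Replace the number `n` in stack `r` by `0`, and the number `a` in stack `k` by `2 ^ n * a`,
using the empty stack `e` as intermediate storage. -/
def Prog.shiftLeft (u : B) (r k e : ℕ) : Prog B τ :=
  .loop r (.seq (.loop k (.seq (.push e fun _ => u) (.push e fun _ => u))) (.move e k fun _ => u))

theorem Runs.shiftLeft (u : B) {r k e : ℕ} (hrk : r ≠ k) (hre : r ≠ e) (hke : k ≠ e) (w : τ)
    (c : Option B) (S : ℕ → List B) (n a : ℕ) (hr : S r = List.replicate n u)
    (hk : S k = List.replicate a u) (he : S e = []) :
    Runs (Prog.shiftLeft u r k e) (w, c) S (n * (7 * (2 ^ n * a) + 3) + 1) w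
      (Function.update (Function.update S r []) k (List.replicate (2 ^ n * a) u)) := by
  have key : ∀ (b : ℕ) (S : ℕ → List B) c, S k = List.replicate b u → S e = [] →
      Runs (.seq (.loop k (.seq (.push e fun _ => u) (.push e fun _ => u)))
        (.move e k fun _ => u)) (w, c) S (7 * b + 2) w
        (Function.update S k (List.replicate (2 * b) u)) := by
    intro b S c hk he
    have h1 := Runs.loop (p := .seq (.push e fun _ => u) (.push e fun _ => u)) (w := w)
      (T := 2) (k := k) (c := c) (List.replicate b u)
      (fun i => Function.update (Function.update S k ((List.replicate b u).drop i)) e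
        (List.replicate (2 * i) u)) (fun i => by simp [Function.update_of_ne hke]) (by
        intro i hi
        refine ⟨some (List.replicate b u)[i], 1 + 1, le_rfl, ?_⟩
        convert Exec.seq (Exec.push e (fun _ => u) (w, some (List.replicate b u)[i]) _)
          (Exec.push e (fun _ => u) (w, some (List.replicate b u)[i]) _) using 1
        funext j
        rcases eq_or_ne j e with rfl | hj
        · simp [Function.update_of_ne hke.symm, mul_add, List.replicate_succ]
        rcases eq_or_ne j k with rfl | hj'
        · simp [Function.update_of_ne hj]
        · simp [Function.update_of_ne hj, Function.update_of_ne hj'])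
    refine Runs.of_eq (h1.seq fun c => Runs.move hke.symm _ w c _) ?_ ?_ (by simp; omega)
    · funext j
      rcases eq_or_ne j e with rfl | hj
      · simp [he]
      rcases eq_or_ne j k with rfl | hj'
      · simp [Function.update_of_ne hj, hk]
      · simp [Function.update_of_ne hj, Function.update_of_ne hj']
    · funext j
      rcases eq_or_ne j k with rfl | hj'
      · simp [Function.update_of_ne hke]
      rcases eq_or_ne j e with rfl | hj
      · simp [Function.update_of_ne hj', he]
      · simp [Function.update_of_ne hj, Function.update_of_ne hj']
  have h2 := Runs.loop (w := w) (k := r) (c := c)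
    (p := .seq (.loop k (.seq (.push e fun _ => u) (.push e fun _ => u))) (.move e k fun _ => u))
    (T := 7 * (2 ^ n * a) + 2) (List.replicate n u)
    (fun i => Function.update (Function.update S r ((List.replicate n u).drop i)) k
      (List.replicate (2 ^ i * a) u)) (fun i => by simp [Function.update_of_ne hrk]) (by
      intro i hi
      rw [List.length_replicate] at hi
      have : 2 ^ i * a ≤ 2 ^ n * a :=
        Nat.mul_le_mul_right _ (Nat.pow_le_pow_right (by omega) hi.le)
      refine (key (2 ^ i * a) _ _ ?_ ?_).of_eq rfl ?_ (by omega)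
      · simp [Function.update_of_ne hrk.symm]
      · simp [Function.update_of_ne hke.symm, Function.update_of_ne hre.symm, he]
      · funext j
        rcases eq_or_ne j k with rfl | hj
        · simp [pow_succ', mul_assoc]
        rcases eq_or_ne j r with rfl | hj'
        · simp [Function.update_of_ne hj]
        · simp [Function.update_of_ne hj, Function.update_of_ne hj'])
  refine Runs.of_eq h2 ?_ ?_ (by simp)
  · funext j
    rcases eq_or_ne j k with rfl | hj
    · simp [hk]
    rcases eq_or_ne j r with rfl | hj'
    · simp [Function.update_of_ne hj, hr]
    · simp [Function.update_of_ne hj, Function.update_of_ne hj']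
  · simp

end

/-! ### Predicates given by expressions -/

section

variable {B : Type} {u : B} {ι α : Type} {x : ι → α → List B}

open Classical in
/-- The predicates that are given by an arithmetic expression. -/
def PExpr (u : B) {ι α : Type} (x : ι → α → List B) (P : α → Prop) : Prop :=
  Expr u x fun a => if P a then 1 else 0

namespace Expr

variable {f g : α → ℕ}

theorem reindex {κ β : Type} {y : κ → β → List B} (hf : Expr u x f) (r : ι → κ) (h : β → α)
    (hy : ∀ i b, y (r i) b = x i (h b)) : Expr u y fun b => f (h b) := by
  induction hf generalizing κ β with
  | one => exact .one
  | len i => simpa only [← hy] using Expr.len (u := u) (x := y) (r i)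
  | sym i b _ ih =>
    convert Expr.sym (u := u) (x := y) (r i) b (ih r h hy) using 3
    rw [hy]
  | add _ _ ih ih' => exact .add (ih r h hy) (ih' r h hy)
  | sub _ _ ih ih' => exact .sub (ih r h hy) (ih' r h hy)
  | shr _ _ ih ih' => exact .shr (ih r h hy) (ih' r h hy)
  | sum _ _ ih ih' =>
    refine .sum (ih r h hy) (ih' (Option.map r) (fun p : _ × ℕ => (h p.1, p.2)) ?_)
    rintro (_ | i) b
    · rfl
    · exact hy i b.1

/-- An expression under a binder. -/
theorem up (hf : Expr u x f) : Expr u (lift u x) fun p => f p.1 :=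
  hf.reindex some Prod.fst fun _ _ => rfl

/-- The variable of the innermost binder. -/
theorem bound : Expr u (lift u x) fun p => p.2 := by
  simpa [lift] using Expr.len (u := u) (x := lift u x) none

theorem const (c : ℕ) : Expr u x fun _ => c := by
  induction c with
  | zero => exact .sub .one .one
  | succ c ih => exact .add ih .one

theorem mul (hf : Expr u x f) (hg : Expr u x g) : Expr u x fun a => f a * g a := by
  simpa using Expr.sum (g := fun a _ => g a) hf hg.up

theorem poly (p : Polynomial ℕ) (hf : Expr u x f) : Expr u x fun a => p.eval (f a) := by
  induction p using Polynomial.induction_on' with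
  | add p q hp hq => simpa using hp.add hq
  | monomial n c =>
    have : ∀ n : ℕ, Expr u x fun a => f a ^ n := by
      intro n
      induction n with
      | zero => simpa using Expr.one
      | succ n ih => simpa only [pow_succ] using ih.mul hf
    simpa using (const c).mul (this n)

end Expr

namespace PExpr

variable {f g : α → ℕ} {P Q : α → Prop}

open Classical in
theorem expr (h : PExpr u x P) : Expr u x fun a => if P a then 1 else 0 := h

theorem not (h : PExpr u x P) : PExpr u x fun a => ¬P a := by
  unfold PExpr
  convert Expr.one.sub h.expr using 2 with a
  by_cases hP : P a <;> simp [hP]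

theorem and (h : PExpr u x P) (h' : PExpr u x Q) : PExpr u x fun a => P a ∧ Q a := by
  unfold PExpr
  convert h.expr.mul h'.expr using 2 with a
  by_cases hP : P a <;> by_cases hQ : Q a <;> simp [hP, hQ]

theorem congr (h : PExpr u x P) (hPQ : ∀ a, P a ↔ Q a) : PExpr u x Q := by
  have : P = Q := funext fun a => propext (hPQ a)
  rwa [← this]

theorem or (h : PExpr u x P) (h' : PExpr u x Q) : PExpr u x fun a => P a ∨ Q a :=
  (h.not.and h'.not).not.congr fun a => by tauto

theorem lt (hf : Expr u x f) (hg : Expr u x g) : PExpr u x fun a => f a < g a := by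
  unfold PExpr
  convert Expr.one.sub (Expr.one.sub (hg.sub hf)) using 2 with a
  split_ifs <;> omega

theorem le (hf : Expr u x f) (hg : Expr u x g) : PExpr u x fun a => f a ≤ g a :=
  (lt hg hf).not.congr fun a => by omega

theorem eq (hf : Expr u x f) (hg : Expr u x g) : PExpr u x fun a => f a = g a :=
  ((le hf hg).and (le hg hf)).congr fun a => by omega

theorem iff (h : PExpr u x P) (h' : PExpr u x Q) : PExpr u x fun a => P a ↔ Q a :=
  ((h.and h').or (h.not.and h'.not)).congr fun a => by tauto

theorem const (p : Prop) : PExpr u x fun _ => p := by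
  unfold PExpr
  by_cases h : p
  · simpa [h] using Expr.one
  · simpa [h] using Expr.const 0

open Classical in
theorem sum_range_ite {p : ℕ → Prop} (n : ℕ) :
    (0 < ∑ i ∈ Finset.range n, if p i then 1 else 0) ↔ ∃ i < n, p i := by
  rw [Nat.pos_iff_ne_zero, Ne, Finset.sum_eq_zero_iff]
  simp

/-- Bounded quantification. -/
theorem bex {P : α → ℕ → Prop} (hf : Expr u x f) (h : PExpr u (lift u x) fun p => P p.1 p.2) :
    PExpr u x fun a => ∃ i < f a, P a i :=
  (lt (.const 0) (hf.sum (g := fun a i => open Classical in if P a i then 1 else 0) h.expr)).congr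
    fun _ => sum_range_ite _

/-- Bounded quantification. -/
theorem ball {P : α → ℕ → Prop} (hf : Expr u x f) (h : PExpr u (lift u x) fun p => P p.1 p.2) :
    PExpr u x fun a => ∀ i < f a, P a i :=
  (bex hf (P := fun a i => ¬P a i) h.not).not.congr fun _ => by push Not; rfl

theorem testBit (hf : Expr u x f) (hg : Expr u x g) :
    PExpr u x fun a => (f a).testBit (g a) = true := by
  have h : Expr u x fun a => f a / 2 ^ g a := hf.shr hg
  refine (eq (h.sub ((h.shr .one).mul (.const 2))) .one).congr fun a => ?_
  rw [Nat.testBit_eq_decide_div_mod_eq, decide_eq_true_eq]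
  omega

end PExpr

namespace Expr

variable {f g : α → ℕ} {P : α → Prop}

theorem mod_four (hf : Expr u x f) : Expr u x fun a => f a % 4 := by
  convert hf.sub ((hf.shr (.const 2)).mul (.const 4)) using 2 with a
  omega

end Expr

/-- The list `l` over the alphabet `A` can be used in expressions. -/
def LExpr (x : ι → α → List B) {A : Type} (l : α → List A) : Prop :=
  ∃ (i : ι) (e : A → B), Function.Injective e ∧ ∀ a, x i a = (l a).map e

namespace LExpr

variable {A : Type} {l : α → List A}

theorem up (h : LExpr x l) : LExpr (lift u x) fun p => l p.1 :=
  let ⟨i, e, he, h⟩ := h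
  ⟨some i, e, he, fun p => h p.1⟩

theorem length (h : LExpr x l) : Expr u x fun a => (l a).length := by
  obtain ⟨i, e, he, h⟩ := h
  simpa [h] using Expr.len (u := u) (x := x) i

theorem get {f : α → ℕ} (h : LExpr x l) (hf : Expr u x f) (s : A) :
    PExpr u x fun a => (l a)[f a]? = some s := by
  obtain ⟨i, e, he, h⟩ := h
  refine PExpr.congr (P := fun a => (x i a)[f a]? = some (e s))
    (by unfold PExpr; convert Expr.sym (u := u) (x := x) i (e s) hf) fun a => ?_
  rw [h, List.getElem?_map]
  cases (l a)[f a]? with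
  | none => simp
  | some b => simp [he.eq_iff]

/-- Membership in a finite set of strings. -/
theorem mem_finite (h : LExpr x l) {s : Set (List A)} (hs : s.Finite) :
    PExpr u x fun a => l a ∈ s := by
  induction s, hs using Set.Finite.induction_on with
  | empty => simpa using PExpr.const False
  | @insert y s _ _ ih =>
    have key : ∀ k ≤ y.length, PExpr u x fun a => ∀ i < k, (l a)[i]? = y[i]? := by
      intro k hk
      induction k with
      | zero => simpa using PExpr.const True
      | succ k ihk =>
        refine ((ihk (by omega)).and (h.get (.const k) y[k])).congr fun a => ?_
        constructor
        · rintro ⟨h1, h2⟩ i hi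
          rcases Nat.lt_succ_iff_lt_or_eq.1 hi with hi | rfl
          · exact h1 i hi
          · rw [h2, List.getElem?_eq_getElem (by omega)]
        · intro h1
          exact ⟨fun i hi => h1 i (by omega), by
            rw [h1 k (by omega), List.getElem?_eq_getElem (by omega)]⟩
    refine (((PExpr.eq h.length (.const y.length)).and (key _ le_rfl)).or ih).congr fun a => ?_
    rw [Set.mem_insert_iff]
    refine or_congr_left ⟨fun ⟨h1, h2⟩ => List.ext_getElem? fun i => ?_, fun h1 => by simp [h1]⟩
    by_cases hi : i < y.length
    · exact h2 i hi
    · rw [List.getElem?_eq_none (by omega), List.getElem?_eq_none (by omega)]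

end LExpr

end

/-! ### The deterministic parts of the computation -/

section

open Turing Computability

/-- What the final, deterministic part of the computation has access to. -/
structure Data (A : Type) where
  /-- the input -/
  word : List Bool
  /-- the output of the first subroutine -/
  circ : List A
  /-- the output of the second subroutine -/
  bits : List Bool
  /-- the guessed string -/
  wit : List Bool

/-- Two subroutines over a common stack alphabet. On input `x` the first one computes `circ x`; on
input `(n, k)` in unary the second one computes `bits n k`. The first one uses
stacks in `[1, c₁)`, the second one stacks in `[c₁, c₂)`. -/
structure Setup {A : Type} (circ : List Bool → List A) (bits : ℕ → ℕ → List Bool) where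
  /-- the common stack alphabet -/
  B : Type
  /-- the auxiliary states -/
  τ : Type
  finB : Fintype B
  finτ : Fintype τ
  /-- the symbols for the input bits -/
  sym : Bool ↪ B
  /-- the initial auxiliary state -/
  w : τ
  /-- the end of the stacks of the first subroutine -/
  c₁ : ℕ
  /-- the end of the stacks of the second subroutine -/
  c₂ : ℕ
  /-- the first subroutine -/
  s₁ : Subroutine B τ
  he₁ : ∀ k, 1 ≤ s₁.e k ∧ s₁.e k < c₁
  hw₁ : s₁.get w = s₁.M.initialState
  in₁ : Bool → s₁.M.Γ s₁.M.k₀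
  out₁ : A ↪ s₁.M.Γ s₁.M.k₁
  time₁ : Polynomial ℕ
  outputs₁ : ∀ x : List Bool, Nonempty (TM2OutputsInTime s₁.M (x.map in₁)
    (some ((circ x).map out₁)) (time₁.eval x.length))
  /-- a bound for the output length of the first subroutine -/
  len₁ : Polynomial ℕ
  length₁ : ∀ x, (circ x).length ≤ len₁.eval x.length
  /-- the second subroutine -/
  s₂ : Subroutine B τ
  he₂ : ∀ k, c₁ ≤ s₂.e k ∧ s₂.e k < c₂
  hw₂ : s₂.get w = s₂.M.initialState
  in₂ : Bool ⊕ Bool → s₂.M.Γ s₂.M.k₀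
  out₂ : Bool ↪ s₂.M.Γ s₂.M.k₁
  time₂ : Polynomial ℕ
  outputs₂ : ∀ n k : ℕ, Nonempty (TM2OutputsInTime s₂.M
    ((List.replicate n (Sum.inl true) ++ List.replicate k (Sum.inr true)).map in₂)
    (some ((bits n k).map out₂)) (time₂.eval (n + k)))
  /-- a bound for the output length of the second subroutine -/
  len₂ : Polynomial ℕ
  length₂ : ∀ n k, (bits n k).length ≤ len₂.eval (n + k)

namespace Setup

variable {A : Type} {circ : List Bool → List A} {bits : ℕ → ℕ → List Bool} (M : Setup circ bits)

/-- The symbol for unary numbers. -/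
def u : M.B := M.sym true

/-- The data, as strings over the stack alphabet. -/
def vars : Fin 4 → Data A → List M.B :=
  ![fun a => a.word.map M.sym, fun a => a.circ.map fun s => M.s₁.enc _ (M.out₁ s),
    fun a => a.bits.map fun s => M.s₂.enc _ (M.out₂ s), fun a => a.wit.map M.sym]

/-- The stacks that hold the data. -/
def loc : Fin 4 → ℕ := ![0, M.s₁.e M.s₁.M.k₁, M.s₂.e M.s₂.M.k₁, M.c₂]

theorem loc_lt (i : Fin 4) : M.loc i < M.c₂ + 2 := by
  have := M.he₁ M.s₁.M.k₁
  have := M.he₂ M.s₂.M.k₁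
  fin_cases i <;> simp [loc] <;> omega

theorem lexpr_word : LExpr M.vars Data.word := ⟨0, M.sym, M.sym.injective, fun _ => rfl⟩

theorem lexpr_circ : LExpr M.vars Data.circ :=
  ⟨1, fun s => M.s₁.enc _ (M.out₁ s), (M.s₁.enc_inj _).comp M.out₁.injective, fun _ => rfl⟩

theorem lexpr_bits : LExpr M.vars Data.bits :=
  ⟨2, fun s => M.s₂.enc _ (M.out₂ s), (M.s₂.enc_inj _).comp M.out₂.injective, fun _ => rfl⟩

theorem lexpr_wit : LExpr M.vars Data.wit := ⟨3, M.sym, M.sym.injective, fun _ => rfl⟩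

/-- The initial stacks. -/
def start (x : List Bool) : ℕ → List M.B := Function.update (fun _ => []) 0 (x.map M.sym)

/-- The stacks hold the data `a`, stack `c₂ + 1` contains the number `N`, and the stacks from
`c₂ + 2` on are free. Nothing is said about the other stacks of the two subroutines. -/
structure Holds (a : Data A) (N : ℕ) (S : ℕ → List M.B) : Prop where
  loc : ∀ i, S (M.loc i) = M.vars i a
  fuel : S (M.c₂ + 1) = List.replicate N M.u
  rest : ∀ j, M.c₂ + 2 ≤ j → S j = []

/-- The translation of input symbols for the first subroutine. -/
noncomputable def toIn₁ (c : Option M.B) : M.B :=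
  M.s₁.enc _ (M.in₁ ((c.bind (Function.partialInv M.sym)).getD true))

theorem toIn₁_sym (b : Bool) : M.toIn₁ (some (M.sym b)) = M.s₁.enc _ (M.in₁ b) := by
  simp [toIn₁, Function.partialInv_left M.sym.injective]

/-- The first subroutine is run on the input. -/
theorem exists_prog_first : ∃ (p : Prog M.B M.τ) (T : ℕ → ℕ), ExpBdd T ∧ ∀ x : List Bool,
    ∃ S', (∀ c, Runs p (M.w, c) (M.start x) (T x.length) M.w S') ∧
      M.Holds ⟨x, circ x, [], []⟩ 0 S' ∧ ∀ j, M.c₁ ≤ j → S' j = [] := by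
  refine ⟨.seq (.copy M.u 0 (M.s₁.e M.s₁.M.k₀) (M.c₂ + 2) M.toIn₁) (.call M.s₁),
    fun n => 5 * n + 2 + M.time₁.eval n,
    (((ExpBdd.const 5).mul (.of_le (.eval Polynomial.X) fun n => by simp)).add (.const 2)).add
      (.eval _), fun x => ?_⟩
  have h0 := M.he₁ M.s₁.M.k₀
  have h1 := M.he₁ M.s₁.M.k₁
  have h2 := M.he₂ M.s₂.M.k₁
  have e0 : ∀ j, j ≠ 0 → M.start x j = [] := fun j hj => Function.update_of_ne hj _ _
  have e1 : M.start x 0 = x.map M.sym := Function.update_self _ _ _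
  have H := fun c => Runs.copy M.u (k := 0) (d := M.s₁.e M.s₁.M.k₀) (e := M.c₂ + 2) (by omega)
    (by omega) (by omega) M.toIn₁ M.w c (M.start x) (e0 _ (by omega))
  obtain ⟨out⟩ := M.outputs₁ x
  set S₁ := Function.update (M.start x) (M.s₁.e M.s₁.M.k₀)
    (((M.start x 0).map fun b => M.toIn₁ (some b)) ++ M.start x (M.s₁.e M.s₁.M.k₀)) with hS₁
  obtain ⟨S', hS', h3, h4⟩ := Runs.call M.s₁ M.hw₁ out (S := S₁) (by
      rw [hS₁, Function.update_self, e1, e0 _ (by omega), List.append_nil, List.map_map,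
        List.map_map]
      exact List.map_congr_left fun b _ => M.toIn₁_sym b) (fun k hk => by
      rw [hS₁, Function.update_of_ne fun h => hk (M.s₁.e_inj h)]
      have := M.he₁ k
      exact e0 _ (by omega))
  have h5 : ∀ j, M.c₁ ≤ j → S' j = [] := by
    intro j hj
    rw [h4 j fun k => by have := M.he₁ k; omega, hS₁, Function.update_of_ne (by omega),
      e0 j (by omega)]
  refine ⟨S', fun c => ((H c).seq hS').mono ?_, ⟨fun i => ?_, ?_, fun j hj => ?_⟩, h5⟩
  · rw [e1, List.length_map]
  · fin_cases i
    · show S' 0 = x.map M.sym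
      rw [h4 0 fun k => by have := M.he₁ k; omega, hS₁, Function.update_of_ne (by omega), e1]
    · show S' (M.s₁.e M.s₁.M.k₁) = _
      rw [h3, List.map_map]
      rfl
    · exact h5 _ h2.1
    · exact h5 M.c₂ (by omega)
  · exact h5 _ (by omega)
  · exact h5 _ (by omega)

/-- Evaluation of an expression in the length of the input. -/
theorem exists_prog_eval (q : Polynomial ℕ) : ∃ (p : Prog M.B M.τ) (T : ℕ → ℕ), PolyBdd T ∧
    ∀ (a : Data A) (N X : ℕ) S, M.Holds a N S → (∀ i, (M.vars i a).length ≤ X) →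
      ∀ c, Runs p (M.w, c) S (T X) M.w
        (Function.update S (M.c₂ + 2) (List.replicate (q.eval a.word.length) M.u)) := by
  obtain ⟨p, T, hT, h⟩ := (Expr.poly (u := M.u) q M.lexpr_word.length).compile (τ := M.τ) M.loc
    (M.c₂ + 2) M.loc_lt
  exact ⟨p, T, hT, fun a N X S hS hX c => (h a X M.w c S hS.loc hS.rest hX).2⟩

/-- The second subroutine is run on `(n, kp(n))`, where `n` is the length of the input. -/
theorem exists_prog_second (kp : Polynomial ℕ) :
    ∃ (p : Prog M.B M.τ) (T : ℕ → ℕ), ExpBdd T ∧ ∀ (x : List Bool) S,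
      M.Holds ⟨x, circ x, [], []⟩ 0 S → (∀ j, M.c₁ ≤ j → S j = []) →
      ∃ S', (∀ c, Runs p (M.w, c) S (T x.length) M.w S') ∧
        M.Holds ⟨x, circ x, bits x.length (kp.eval x.length), []⟩ 0 S' := by
  obtain ⟨pk, Tk, hTk, hk⟩ := M.exists_prog_eval kp
  let b₁ : M.B := M.s₂.enc _ (M.in₂ (Sum.inl true))
  let b₂ : M.B := M.s₂.enc _ (M.in₂ (Sum.inr true))
  refine ⟨.seq pk (.seq (.move (M.c₂ + 2) (M.s₂.e M.s₂.M.k₀) fun _ => b₂)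
    (.seq (.count b₁ 0 (M.s₂.e M.s₂.M.k₀) (M.c₂ + 2)) (.call M.s₂))),
    fun n => Tk (n + M.len₁.eval n) + ((2 * kp.eval n + 1) + ((5 * n + 2) +
      (M.time₂.comp (Polynomial.X + kp)).eval n)), ?_, fun x S hS hS' => ?_⟩
  · have hX : ExpBdd fun n => n := .of_le (.eval Polynomial.X) fun n => by simp
    exact (ExpBdd.comp hTk (hX.add (.eval _))).add
      ((((ExpBdd.const 2).mul (.eval _)).add (.const 1)).add
        ((((ExpBdd.const 5).mul hX).add (.const 2)).add (.eval _)))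
  have h0 := M.he₂ M.s₂.M.k₀
  have h1 := M.he₁ M.s₁.M.k₁
  have h1' := M.he₁ M.s₁.M.k₀
  have h2 := M.he₂ M.s₂.M.k₁
  have hloc0 : S 0 = x.map M.sym := hS.loc 0
  set n := x.length with hn
  set k := kp.eval n with hkk
  have H := hk _ 0 (n + M.len₁.eval n) S hS (fun i => by
    have := M.length₁ x
    rw [← hn] at this
    fin_cases i <;> simp [vars] <;> omega)
  have H2 := fun c => Runs.move (k := M.c₂ + 2) (d := M.s₂.e M.s₂.M.k₀) (by omega)
    (fun _ => b₂) M.w c (Function.update S (M.c₂ + 2) (List.replicate k M.u))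
  have H3 := fun c => Runs.count b₁ (k := 0) (d := M.s₂.e M.s₂.M.k₀) (e := M.c₂ + 2) (by omega)
    (by omega) (by omega) M.w c (Function.update S (M.s₂.e M.s₂.M.k₀) (List.replicate k b₂))
    (by rw [Function.update_of_ne (by omega), hS.rest _ le_rfl])
  set S₁ := Function.update S (M.s₂.e M.s₂.M.k₀) (List.replicate n b₁ ++ List.replicate k b₂)
    with hS₁
  obtain ⟨out⟩ := M.outputs₂ n k
  obtain ⟨S', hrun, h3, h4⟩ := Runs.call M.s₂ M.hw₂ out (S := S₁) (by
      rw [hS₁, Function.update_self]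
      simp [b₁, b₂]) (fun k hk => by
      rw [hS₁, Function.update_of_ne fun h => hk (M.s₂.e_inj h)]
      exact hS' _ (M.he₂ k).1)
  have h5 : ∀ j, (∀ k, j ≠ M.s₂.e k) → S' j = S j := by
    intro j hj
    rw [h4 j hj, hS₁, Function.update_of_ne (hj _)]
  refine ⟨S', fun c => Runs.of_eq ((H c).seq fun c => ((H2 c).of_eq (T' := 2 * k + 1) rfl ?_ ?_).seq fun c =>
      ((H3 c).of_eq (T' := 5 * n + 2) rfl ?_ ?_).seq hrun) rfl rfl ?_, ⟨fun i => ?_, ?_, fun j hj => ?_⟩⟩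
  · funext j
    rcases eq_or_ne j (M.s₂.e M.s₂.M.k₀) with rfl | hj
    · rw [Function.update_self, Function.update_self, Function.update_self,
        Function.update_of_ne (by omega), hS' _ h0.1]
      simp
    rcases eq_or_ne j (M.c₂ + 2) with rfl | hj'
    · rw [Function.update_of_ne hj, Function.update_self, Function.update_of_ne hj,
        hS.rest _ le_rfl]
    · simp [Function.update_of_ne hj, Function.update_of_ne hj']
  · simp
  · rw [Function.update_of_ne (by omega), hloc0, List.length_map, Function.update_self,
      Function.update_idem]
  · rw [Function.update_of_ne (by omega), hloc0, List.length_map]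
  · simp only [Polynomial.eval_comp, Polynomial.eval_add, Polynomial.eval_X]
    exact le_rfl
  · fin_cases i
    · exact (h5 0 fun k => by have := M.he₂ k; omega).trans (hS.loc 0)
    · exact (h5 _ fun k => by have := M.he₂ k; dsimp [Setup.loc]; omega).trans (hS.loc 1)
    · show S' (M.s₂.e M.s₂.M.k₁) = _
      rw [h3, List.map_map]
      rfl
    · exact (h5 _ fun k => by have := M.he₂ k; dsimp [Setup.loc]; omega).trans (hS.loc 3)
  · exact (h5 _ fun k => by have := M.he₂ k; omega).trans hS.fuel
  · exact (h5 _ fun k => by have := M.he₂ k; omega).trans (hS.rest j hj)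

/-- The deterministic computation before the guessing: it prepares the data and the number
`2 ^ P(n)`, the length of the string to guess. -/
theorem exists_prog_prepare (kp P : Polynomial ℕ) :
    ∃ (p : Prog M.B M.τ) (T : ℕ → ℕ), ExpBdd T ∧ ∀ x : List Bool,
      ∃ S', (∀ c, Runs p (M.w, c) (M.start x) (T x.length) M.w S') ∧
        M.Holds ⟨x, circ x, bits x.length (kp.eval x.length), []⟩ (2 ^ P.eval x.length) S' := by
  obtain ⟨p₁, T₁, hT₁, h₁⟩ := M.exists_prog_first
  obtain ⟨p₂, T₂, hT₂, h₂⟩ := M.exists_prog_second kp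
  obtain ⟨p₃, T₃, hT₃, h₃⟩ := M.exists_prog_eval P
  refine ⟨.seq p₁ (.seq p₂ (.seq p₃ (.seq (.push (M.c₂ + 1) fun _ => M.u)
    (.shiftLeft M.u (M.c₂ + 2) (M.c₂ + 1) (M.c₂ + 3))))),
    fun n => T₁ n + (T₂ n + (T₃ (n + M.len₁.eval n + (M.len₂.comp (Polynomial.X + kp)).eval n) +
      (1 + (P.eval n * (7 * (2 ^ P.eval n * 1) + 3) + 1)))), ?_, fun x => ?_⟩
  · have hX : ExpBdd fun n => n := .of_le (.eval Polynomial.X) fun n => by simp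
    exact hT₁.add (hT₂.add ((ExpBdd.comp hT₃ ((hX.add (.eval _)).add (.eval _))).add
      ((ExpBdd.const 1).add (((ExpBdd.eval P).mul (((ExpBdd.const 7).mul
        ((ExpBdd.two_pow P).mul (.const 1))).add (.const 3))).add (.const 1)))))
  obtain ⟨S₁, hS₁, hS₁', hS₁''⟩ := h₁ x
  obtain ⟨S₂, hS₂, hS₂'⟩ := h₂ x S₁ hS₁' hS₁''
  set n := x.length with hn
  have H := h₃ _ 0 (n + M.len₁.eval n + (M.len₂.comp (Polynomial.X + kp)).eval n) S₂ hS₂' (by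
    intro i
    have h1 := M.length₁ x
    rw [← hn] at h1
    have h2 := M.length₂ n (kp.eval n)
    simp only [Polynomial.eval_comp, Polynomial.eval_add, Polynomial.eval_X]
    fin_cases i <;> simp [vars] <;> omega)
  set S₃ := Function.update S₂ (M.c₂ + 2) (List.replicate (P.eval n) M.u) with hS₃
  have hfuel : S₃ (M.c₂ + 1) = [] := by
    rw [hS₃, Function.update_of_ne (by omega), hS₂'.fuel]; rfl
  set S₄ := Function.update S₃ (M.c₂ + 1) [M.u] with hS₄
  have H' := fun c => Runs.shiftLeft M.u (r := M.c₂ + 2) (k := M.c₂ + 1) (e := M.c₂ + 3) (by omega)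
    (by omega) (by omega) M.w c S₄ (P.eval n) 1
    (by rw [hS₄, Function.update_of_ne (by omega), hS₃, Function.update_self])
    (by rw [hS₄, Function.update_self]; rfl)
    (by rw [hS₄, Function.update_of_ne (by omega), hS₃, Function.update_of_ne (by omega),
      hS₂'.rest _ (by omega)])
  refine ⟨Function.update (Function.update S₄ (M.c₂ + 2) []) (M.c₂ + 1)
    (List.replicate (2 ^ P.eval n * 1) M.u), fun c => ((hS₁ c).seq fun c => (hS₂ c).seq
    fun c => (H c).seq fun c =>
      ((Runs.push (fun _ => M.u) c).of_eq rfl (by rw [hfuel]) le_rfl).seq H'), ?_, ?_, ?_⟩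
  · intro i
    have h1 := M.loc_lt i
    have h2 : M.loc i ≠ M.c₂ + 1 := by
      have := M.he₁ M.s₁.M.k₁
      have := M.he₂ M.s₂.M.k₁
      fin_cases i <;> simp [Setup.loc] <;> omega
    rw [Function.update_of_ne h2, Function.update_of_ne (by omega), hS₄, Function.update_of_ne h2,
      hS₃, Function.update_of_ne (by omega), hS₂'.loc]
  · rw [Function.update_self, mul_one]
  · intro j hj
    rw [Function.update_of_ne (by omega)]
    rcases eq_or_ne j (M.c₂ + 2) with rfl | hj'
    · rw [Function.update_self]
    · rw [Function.update_of_ne hj', hS₄, Function.update_of_ne (by omega), hS₃,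
        Function.update_of_ne hj', hS₂'.rest _ hj]

open Classical in
/-- The deterministic computation after the guessing: it decides the predicate `Q`. In the end the
current symbol is a proper symbol if and only if the predicate holds. -/
theorem exists_prog_decide {Q : Data A → Prop} (hQ : PExpr M.u M.vars Q) :
    ∃ (p : Prog M.B M.τ) (T : ℕ → ℕ), PolyBdd T ∧ ∀ (a : Data A) (N X : ℕ) S,
      M.Holds a N S → (∀ i, (M.vars i a).length ≤ X) → ∀ c, ∃ t ≤ T X, ∃ c' S',
        Exec p (M.w, c) S t (M.w, c') S' ∧ (c'.isSome ↔ Q a) := by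
  obtain ⟨p, T, hT, h⟩ := hQ.expr.compile (τ := M.τ) M.loc (M.c₂ + 2) M.loc_lt
  refine ⟨.seq p (.pop (M.c₂ + 2)), fun X => T X + 1, hT.add (.const 1),
    fun a N X S hS hX c => ?_⟩
  obtain ⟨c', t, ht, h'⟩ := (h a X M.w c S hS.loc hS.rest hX).2
  refine ⟨t + 1, by dsimp only; omega, _, _, .seq h' (.pop _ _ _), ?_⟩
  rw [Function.update_self]
  by_cases hQa : Q a <;> simp [hQa]

end Setup

end

/-! ### The nondeterministic machine -/

section

open Turing Computability

namespace Setup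

variable {A : Type} {circ : List Bool → List A} {bits : ℕ → ℕ → List Bool} (M : Setup circ bits)

section Machine

variable (p q : Prog M.B M.τ)

/-- The number of stacks of the machine, minus one. -/
noncomputable def size : ℕ := max (max p.bound q.bound) (M.c₂ + 2)

/-- The labels of the machine: those of the two deterministic programs `p` and `q`, one for
guessing (`true`) and one for halting (`false`). -/
abbrev Label : Type := (p.Lab ⊕ q.Lab) ⊕ Bool

/-- The program of the machine that runs `p`, guesses a string, runs `q`, and halts. The bit `b` is
the one that is guessed. The length of the guessed string is given by stack `c₂ + 1`. -/
noncomputable def machineCode (b : Bool) : Label M p q →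
    TM2.Stmt (fun _ : Fin (M.size p q + 1) => M.B) (Label M p q) (M.τ × Option M.B)
  | .inl (.inl l) => p.code (Fin.ofNat _) (fun l => .inl (.inl l)) (.inr true) l
  | .inl (.inr l) => q.code (Fin.ofNat _) (fun l => .inl (.inr l)) (.inr false) l
  | .inr true => .pop (Fin.ofNat _ (M.c₂ + 1)) (fun v o => (v.1, o)) (.branch (fun v => v.2.isSome)
      (.push (Fin.ofNat _ M.c₂) (fun _ => M.sym b) (.goto fun _ => .inr true))
      (.goto fun _ => .inl (.inr q.entry)))
  | .inr false => .halt

/-- The nondeterministic machine that runs `p`, guesses a string, runs `q`, and accepts if there is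
a current symbol in the end. -/
noncomputable def machine : QuantumComplexity.NTM :=
  let := M.finB
  let := M.finτ
  { K := Fin (M.size p q + 1)
    k₀ := Fin.ofNat _ 0
    k₁ := Fin.ofNat _ 0
    Γ := fun _ => M.B
    Λ := Label M p q
    main := .inl (.inl p.entry)
    σ := M.τ × Option M.B
    initialState := (M.w, none)
    m := M.machineCode p q false
    finiteAlphabet := fun _ => Finite.of_fintype M.B
    input := M.sym
    m₁ := M.machineCode p q true
    accept := fun v => v.2.isSome }

variable {p q}

/-- The configuration of the machine with label `l`, state `v` and stacks `S`. -/
noncomputable def cfg (l : Option (Label M p q)) (v : M.τ × Option M.B) (S : ℕ → List M.B) :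
    (M.machine p q).Cfg :=
  ⟨l, v, firstStacks (M.size p q + 1) S⟩

theorem run_zero (x : List Bool) (r : ℕ → Bool) :
    (M.machine p q).run x r 0 = M.cfg (some (.inl (.inl p.entry))) (M.w, none) (M.start x) := by
  have h : ∀ k, (initList (M.machine p q).toFinTM2 (x.map M.sym)).stk k =
      firstStacks (M.size p q + 1) (M.start x) k := by
    intro k
    by_cases hk : k = (M.machine p q).k₀
    · subst hk
      rw [initList_stk_self]
      show _ = M.start x (Fin.ofNat (M.size p q + 1) 0 : ℕ)
      simp only [start, Fin.ofNat_zero, Fin.val_zero, Function.update_self]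
      rfl
    · rw [initList_stk_of_ne _ _ hk]
      have : (k : Fin (M.size p q + 1)).val ≠ 0 := fun h => hk (Fin.ext h)
      exact (Function.update_of_ne this (x.map M.sym) fun _ : ℕ => ([] : List M.B)).symm
  show initList (M.machine p q).toFinTM2 (x.map M.sym) = _
  have h' := funext h
  unfold cfg
  rw [← h']
  rfl

theorem run_succ {x : List Bool} {r : ℕ → Bool} {i : ℕ} {l : Label M p q} {v : M.τ × Option M.B}
    {T : Fin (M.size p q + 1) → List M.B} (h : (M.machine p q).run x r i = ⟨some l, v, T⟩) :
    (M.machine p q).run x r (i + 1) = TM2.stepAux (M.machineCode p q (r i) l) v T := by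
  show (M.machine p q).next (r i) ((M.machine p q).run x r i) = _
  rw [h]
  cases r i <;> rfl

theorem run_halted {x : List Bool} {r : ℕ → Bool} {i : ℕ} {v : M.τ × Option M.B}
    {S : ℕ → List M.B} (h : (M.machine p q).run x r i = M.cfg none v S) (j : ℕ) (hj : i ≤ j) :
    (M.machine p q).run x r j = M.cfg none v S := by
  induction j, hj using Nat.le_induction with
  | base => exact h
  | succ j _ ih =>
    show (M.machine p q).next (r j) ((M.machine p q).run x r j) = _
    rw [ih]
    cases r j <;> rfl

/-- The guessed string after `i` steps of guessing that start at time `t`; the last bit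
comes first. -/
def guessed (r : ℕ → Bool) (t : ℕ) : ℕ → List Bool
  | 0 => []
  | i + 1 => r (t + i) :: guessed r t i

theorem length_guessed (r : ℕ → Bool) (t i : ℕ) : (guessed r t i).length = i := by
  induction i with
  | zero => rfl
  | succ i ih => simp [guessed, ih]

theorem exists_guessed (t : ℕ) (W : List Bool) : ∃ r, guessed r t W.length = W := by
  induction W with
  | nil => exact ⟨fun _ => true, rfl⟩
  | cons b W ih =>
    obtain ⟨r, hr⟩ := ih
    refine ⟨Function.update r (t + W.length) b, ?_⟩
    have : ∀ i ≤ W.length, guessed (Function.update r (t + W.length) b) t i = guessed r t i := by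
      intro i
      induction i with
      | zero => intro _; rfl
      | succ i ih =>
        intro hi
        rw [guessed, guessed, ih (by omega), Function.update_of_ne (by omega)]
    rw [List.length_cons, guessed, this _ le_rfl, hr, Function.update_self]

theorem holds_guess {a : Data A} {N N' : ℕ} {W : List Bool} {S : ℕ → List M.B} (h : M.Holds a N S) :
    M.Holds { a with wit := W } N' (Function.update (Function.update S (M.c₂ + 1)
      (List.replicate N' M.u)) M.c₂ (W.map M.sym)) := by
  have h1 := M.he₁ M.s₁.M.k₁
  have h2 := M.he₂ M.s₂.M.k₁
  refine ⟨fun i => ?_, ?_, fun j hj => ?_⟩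
  · fin_cases i
    · show Function.update _ _ _ 0 = _
      rw [Function.update_of_ne (by omega), Function.update_of_ne (by omega)]
      exact h.loc 0
    · show Function.update _ _ _ (M.s₁.e M.s₁.M.k₁) = _
      rw [Function.update_of_ne (by omega), Function.update_of_ne (by omega)]
      exact h.loc 1
    · show Function.update _ _ _ (M.s₂.e M.s₂.M.k₁) = _
      rw [Function.update_of_ne (by omega), Function.update_of_ne (by omega)]
      exact h.loc 2
    · exact Function.update_self _ _ _
  · rw [Function.update_of_ne (by omega), Function.update_self]
  · rw [Function.update_of_ne (by omega), Function.update_of_ne (by omega), h.rest j hj]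

theorem run_guess {x : List Bool} {r : ℕ → Bool} {t N : ℕ} {c : Option M.B} {a : Data A}
    {S : ℕ → List M.B} (hS : M.Holds a N S) (ha : a.wit = [])
    (h : (M.machine p q).run x r t = M.cfg (some (.inr true)) (M.w, c) S) :
    (M.machine p q).run x r (t + N + 1) =
      M.cfg (some (.inl (.inr q.entry))) (M.w, none) (Function.update (Function.update S (M.c₂ + 1)
      (List.replicate 0 M.u)) M.c₂ ((guessed r t N).map M.sym)) := by
  have hlt : M.c₂ + 1 < M.size p q + 1 := by
    have := le_max_right (max p.bound q.bound) (M.c₂ + 2)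
    unfold size
    omega
  have hlt' : M.c₂ < M.size p q + 1 := by omega
  have key : ∀ i ≤ N, ∃ c, (M.machine p q).run x r (t + i) =
      M.cfg (some (.inr true)) (M.w, c) (Function.update (Function.update S (M.c₂ + 1)
      (List.replicate (N - i) M.u)) M.c₂ ((guessed r t i).map M.sym)) := by
    intro i
    induction i with
    | zero =>
      intro _
      refine ⟨c, h.trans ?_⟩
      have e1 : Function.update S (M.c₂ + 1) (List.replicate (N - 0) M.u) = S := by
        rw [Nat.sub_zero, ← hS.fuel]; exact Function.update_eq_self _ _
      have e2 : S M.c₂ = [] := by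
        have := hS.loc 3
        simpa [Setup.loc, vars, ha] using this
      rw [e1]
      congr 1
      exact (by rw [guessed, List.map_nil, ← e2, Function.update_eq_self])
    | succ i ih =>
      intro hi
      obtain ⟨c, hc⟩ := ih (by omega)
      have h1 := M.run_succ hc
      simp only [machineCode, TM2.stepAux.eq_1, TM2.stepAux.eq_3, TM2.stepAux.eq_5,
        TM2.stepAux.eq_6] at h1
      rw [firstStacks_ofNat hlt, firstStacks_update hlt, firstStacks_update hlt',
        firstStacks_ofNat hlt', Function.update_of_ne (show M.c₂ + 1 ≠ M.c₂ by omega),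
        Function.update_self, show N - i = N - (i + 1) + 1 by omega, List.replicate_succ] at h1
      simp only [List.head?_cons, Option.isSome_some, cond_true, List.tail_cons] at h1
      refine ⟨some M.u, h1.trans ?_⟩
      unfold cfg
      congr 2
      funext j
      rcases eq_or_ne j M.c₂ with rfl | hj
      · rw [Function.update_self, Function.update_self,
          Function.update_of_ne (show M.c₂ ≠ M.c₂ + 1 by omega), Function.update_self, guessed,
          List.map_cons]
      · rw [Function.update_of_ne hj, Function.update_of_ne hj]
        rcases eq_or_ne j (M.c₂ + 1) with rfl | hj'
        · rw [Function.update_self, Function.update_self]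
        · rw [Function.update_of_ne hj', Function.update_of_ne hj, Function.update_of_ne hj',
            Function.update_of_ne hj']
  obtain ⟨c, hc⟩ := key N le_rfl
  have h1 := M.run_succ hc
  simp only [machineCode, TM2.stepAux.eq_3, TM2.stepAux.eq_5, TM2.stepAux.eq_6] at h1
  rw [firstStacks_ofNat hlt, firstStacks_update hlt,
    Function.update_of_ne (show M.c₂ + 1 ≠ M.c₂ by omega), Function.update_self, Nat.sub_self,
    List.replicate_zero] at h1
  simp only [List.head?_nil, Option.isSome_none, cond_false, List.tail_nil] at h1
  refine h1.trans ?_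
  unfold cfg
  congr 2
  funext j
  rcases eq_or_ne j (M.c₂ + 1) with rfl | hj'
  · rw [Function.update_self, Function.update_of_ne (by omega), Function.update_self]; rfl
  · rw [Function.update_of_ne hj']
    rfl

end Machine

/-- If a predicate `Q` of the data can be decided by evaluating an expression, then the language of
all `x` for which some guess of a certain exponential length satisfies it is in `NEXP`. -/
theorem mem_NEXP (kp P : Polynomial ℕ) {L : Language Bool} {Q : Data A → Prop}
    (hQ : PExpr M.u M.vars Q)
    (hL : ∀ x, x ∈ L ↔ ∃ W : List Bool, W.length = 2 ^ P.eval x.length ∧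
      Q ⟨x, circ x, bits x.length (kp.eval x.length), W⟩) :
    L ∈ QuantumComplexity.NEXP := by
  obtain ⟨p, Tp, hTp, hp⟩ := M.exists_prog_prepare kp P
  obtain ⟨q, Tq, hTq, hq⟩ := M.exists_prog_decide hQ
  let X : ℕ → ℕ := fun n => n + M.len₁.eval n + (M.len₂.comp (Polynomial.X + kp)).eval n +
    2 ^ P.eval n
  have hT : ExpBdd fun n => Tp n + 2 ^ P.eval n + 1 + Tq (X n) + 1 := by
    have hX : ExpBdd X := (((ExpBdd.eval Polynomial.X |>.of_le fun n => by simp).add (.eval _)).add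
      (.eval _)).add (.two_pow P)
    exact (((hTp.add (.two_pow P)).add (.const 1)).add (.comp hTq hX)).add (.const 1)
  obtain ⟨T, hT⟩ := hT
  refine ⟨M.machine p q, T, fun x => ?_⟩
  set n := x.length with hn
  obtain ⟨S, hrun, hS⟩ := hp x
  rw [← hn] at hrun hS
  obtain ⟨c₁, t₁, ht₁, h₁⟩ := hrun none
  have hpb : p.bound ≤ M.size p q + 1 := by
    have := le_max_left (max p.bound q.bound) (M.c₂ + 2)
    have := le_max_left p.bound q.bound
    unfold size
    omega
  have hqb : q.bound ≤ M.size p q + 1 := by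
    have := le_max_left (max p.bound q.bound) (M.c₂ + 2)
    have := le_max_right p.bound q.bound
    unfold size
    omega
  -- The outcome of a run is determined by the guessed string.
  have key : ∀ r, ∃ v S', (M.machine p q).run x r (2 ^ T.eval n) = M.cfg none v S' ∧
      (v.2.isSome ↔ Q ⟨x, circ x, bits n (kp.eval n), guessed r t₁ (2 ^ P.eval n)⟩) := by
    intro r
    have e1 := h₁.simulate hpb (fun l => Sum.inl (Sum.inl l)) (Sum.inr true)
      ((M.machine p q).run x r) (fun i l v T h => M.run_succ h) 0 (M.run_zero x r)
    rw [Nat.zero_add] at e1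
    have e2 := M.run_guess hS rfl e1
    have e3 := M.holds_guess (N' := 0) (W := guessed r t₁ (2 ^ P.eval n)) hS
    have hle := hT n
    dsimp only at hle
    obtain ⟨t₂, ht₂, c₂, S₂, h₂, hc₂⟩ := hq _ 0 (X n) _ e3 (by
      intro i
      have h1 := M.length₁ x
      rw [← hn] at h1
      have h2 := M.length₂ n (kp.eval n)
      have h3 := length_guessed r t₁ (2 ^ P.eval n)
      simp only [X, Polynomial.eval_comp, Polynomial.eval_add, Polynomial.eval_X]
      fin_cases i <;> simp [vars] <;> omega) none
    have e4 := h₂.simulate hqb (fun l => Sum.inl (Sum.inr l)) (Sum.inr false)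
      ((M.machine p q).run x r) (fun i l v T h => M.run_succ h) _ e2
    have e5 := M.run_succ e4
    have e6 : (M.machine p q).run x r (t₁ + 2 ^ P.eval n + 1 + t₂ + 1) = M.cfg none (M.w, c₂) S₂ :=
      e5
    exact ⟨(M.w, c₂), S₂, M.run_halted e6 _ (le_trans (by omega) hle), hc₂⟩
  constructor
  · intro r
    obtain ⟨v, S', h, _⟩ := key r
    rw [h]
    rfl
  · rw [hL]
    constructor
    · rintro ⟨W, hW, hQW⟩
      obtain ⟨r, hr⟩ := exists_guessed t₁ W
      obtain ⟨v, S', h, h'⟩ := key r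
      refine ⟨r, ?_⟩
      rw [h]
      exact h'.2 (by rw [← hW, hr]; exact hQW)
    · rintro ⟨r, hr⟩
      obtain ⟨v, S', h, h'⟩ := key r
      rw [h] at hr
      exact ⟨_, length_guessed _ _ _, h'.1 hr⟩

end Setup

/-- The subroutine that uses the stacks from `c` on. -/
noncomputable def subroutine {B τ : Type} (M : FinTM2) (c : ℕ) (enc : ∀ k, M.Γ k → B)
    (enc_inj : ∀ k, Function.Injective (enc k)) (get : τ → M.σ) (put : M.σ → τ → τ)
    (get_put : ∀ s v, get (put s v) = s) (put_put : ∀ s s' v, put s (put s' v) = put s v)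
    (put_get : ∀ v, put (get v) v = v) : Subroutine B τ where
  M := M
  e k := c + @Fintype.equivFin M.K M.kFin k
  e_inj k k' h := by
    exact (@Fintype.equivFin M.K M.kFin).injective (Fin.ext (Nat.add_left_cancel h))
  enc := enc
  enc_inj := enc_inj
  get := get
  put := put
  get_put := get_put
  put_put := put_put
  put_get := put_get

theorem unaryEncodeNat_eq (n : ℕ) : unaryEncodeNat n = List.replicate n true := by
  induction n with
  | zero => rfl
  | succ n ih => rw [unaryEncodeNat, ih, List.replicate_succ]

/-- Two functions that are computable in polynomial time can be computed by subroutines of a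
common program. -/
theorem exists_setup {β A : Type} {eb : β → List A} {g : List Bool → β}
    (hg : QuantumComplexity.PolyTimeComputable (fun x : List Bool => x) eb g) {f : ℕ × ℕ → ℕ}
    (hf : QuantumComplexity.PolyTimeComputable
      (encodingProd unaryEncodingNat unaryEncodingNat).encode encodingNatBool.encode f) :
    Nonempty (Setup (fun x => eb (g x)) fun n k => encodeNat (f (n, k))) := by
  obtain ⟨M₁, hM₁⟩ := hg
  obtain ⟨M₂, hM₂⟩ := hf
  obtain ⟨len₁, hlen₁⟩ := exists_length_le M₁
  obtain ⟨len₂, hlen₂⟩ := exists_length_le M₂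
  have e : ∀ n k : ℕ, (encodingProd unaryEncodingNat unaryEncodingNat).encode (n, k) =
      List.replicate n (Sum.inl true) ++ List.replicate k (Sum.inr true) := by
    intro n k
    simp [encodingProd, unaryEncodingNat, unaryEncodeNat_eq]
  let := M₁.tm.kFin
  let := M₂.tm.kFin
  let := M₁.tm.σFin
  let := M₂.tm.σFin
  let B := Bool ⊕ ((Σ k, M₁.tm.Γ k) ⊕ (Σ k, M₂.tm.Γ k))
  have : Finite B := inferInstance
  exact ⟨{
    B := B
    τ := M₁.tm.σ × M₂.tm.σ
    finB := Fintype.ofFinite B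
    finτ := inferInstance
    sym := ⟨Sum.inl, Sum.inl_injective⟩
    w := (M₁.tm.initialState, M₂.tm.initialState)
    c₁ := 1 + Fintype.card M₁.tm.K
    c₂ := 1 + Fintype.card M₁.tm.K + Fintype.card M₂.tm.K
    s₁ := subroutine M₁.tm 1 (fun k s => Sum.inr (Sum.inl ⟨k, s⟩))
      (fun k _ _ h => sigma_mk_injective (Sum.inl.inj (Sum.inr.inj h))) Prod.fst (fun s v => (s, v.2)) (fun _ _ => rfl)
      (fun _ _ _ => rfl) (fun _ => rfl)
    he₁ := fun k => ⟨Nat.le_add_right _ _,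
      Nat.add_lt_add_left (@Fintype.equivFin M₁.tm.K M₁.tm.kFin k).is_lt _⟩
    hw₁ := rfl
    in₁ := M₁.inputAlphabet.symm
    out₁ := M₁.outputAlphabet.symm.toEmbedding
    time₁ := M₁.time
    outputs₁ := fun x => ⟨M₁.outputsFun x⟩
    len₁ := len₁
    length₁ := hlen₁
    s₂ := subroutine M₂.tm (1 + Fintype.card M₁.tm.K) (fun k s => Sum.inr (Sum.inr ⟨k, s⟩))
      (fun k _ _ h => sigma_mk_injective (Sum.inr.inj (Sum.inr.inj h))) Prod.snd (fun s v => (v.1, s)) (fun _ _ => rfl)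
      (fun _ _ _ => rfl) (fun _ => rfl)
    he₂ := fun k => ⟨Nat.le_add_right _ _,
      Nat.add_lt_add_left (@Fintype.equivFin M₂.tm.K M₂.tm.kFin k).is_lt _⟩
    hw₂ := rfl
    in₂ := M₂.inputAlphabet.symm
    out₂ := M₂.outputAlphabet.symm.toEmbedding
    time₂ := M₂.time
    outputs₂ := fun n k => ⟨by
      have h := M₂.outputsFun (n, k)
      rw [e] at h
      rw [List.length_append, List.length_replicate, List.length_replicate] at h
      exact h⟩
    len₂ := len₂
    length₂ := fun n k => by
      have h : (encodeNat (f (n, k))).length ≤ _ := hlen₂ (n, k)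
      rw [e] at h
      simpa using h }⟩

end

/-! ### The final test -/

section

open QuantumComplexity

open Classical in
/-- The indicator of a proposition. -/
noncomputable def ind (p : Prop) : ℕ := if p then 1 else 0

theorem PExpr.ind {B : Type} {u : B} {ι α : Type} {x : ι → α → List B} {P : α → Prop}
    (h : PExpr u x P) : Expr u x fun a => ind (P a) := h

namespace PathSum

section Definitions

variable (L : List CircuitSymbol)

/-- The number of separators before position `p`. -/
noncomputable def seps (p : ℕ) : ℕ := ∑ i ∈ Finset.range p, ind (L[i]? = some .sep)

/-- The unary number that follows the first `r` separators. -/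
noncomputable def arg (r : ℕ) : ℕ :=
  ∑ i ∈ Finset.range L.length, ind (L[i]? = some .tick ∧ seps L i = r)

/-- The basis states `β` and `β'` of `n` qubits can follow each other in a path, where the symbol
`s` is the name of a gate that acts on the qubits `a`, `b`, `c` (as many as it needs). Symbols that
are not names of gates act as the identity. -/
def Step (n : ℕ) (s : Option CircuitSymbol) (a b c : ℕ) (β β' : ℕ → Bool) : Prop :=
  ∀ j < n, (s = some .H ∧ j = a) ∨ (β' j = true ↔ ¬(β j = true ↔
    (s = some .CNOT ∧ j = b ∧ β a = true) ∨
    (s = some .Toffoli ∧ j = c ∧ β a = true ∧ β b = true)))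

/-- The exponent of `i` in the amplitude of a step. -/
noncomputable def stepPhase (s : Option CircuitSymbol) (a : ℕ) (β β' : ℕ → Bool) : ℕ :=
  2 * ind (s = some .H ∧ β a = true ∧ β' a = true) + ind (s = some .K ∧ β a = true) +
    3 * ind (s = some .Kinv ∧ β a = true)

/-- The basis states of a path are the digits of a number `Y`, to base `2 ^ n`. -/
def row (n Y p : ℕ) : ℕ → Bool := fun j => decide (j < n) && Y.testBit (p * n + j)

/-- The number `Y` stands for a path of the circuit. -/
def IsPath (n Y : ℕ) : Prop :=
  ∀ p < L.length, Step n L[p]? (arg L (seps L p)) (arg L (seps L p + 1)) (arg L (seps L p + 2))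
    (row n Y p) (row n Y (p + 1))

/-- The exponent of `i` in the amplitude of a path. -/
noncomputable def pathPhase (n Y : ℕ) : ℕ :=
  ∑ p ∈ Finset.range L.length,
    stepPhase L[p]? (arg L (seps L p)) (row n Y p) (row n Y (p + 1))

/-- The path `Y` starts in a basis state in which the ancillas are zero. The amplitudes of the two
witnesses are sums of powers of `i`, and the string `W`, which consists of blocks of length
`A = 2 ^ w`, says which powers occur; here the powers `q` and `q'` are considered. The two
differences are the remainders of `Y` and of `Y / 2 ^ w` modulo `2 ^ w`. -/
def IsStart (W : List Bool) (w n A Y q q' : ℕ) : Prop :=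
  (∀ j < n, 2 * w ≤ j → ¬Y.testBit j = true) ∧
  W[2 * q * A + (Y - Y / 2 ^ w * A)]? = some true ∧
  W[(2 * q' + 1) * A + (Y / 2 ^ w - Y / 2 ^ (2 * w) * A)]? = some true

/-- The number of paths below `C` that end in the basis state `z` and contribute `i ^ e`, where
each path is counted with the multiplicity given by the witnesses. -/
noncomputable def count (W : List Bool) (w n A C z e : ℕ) : ℕ :=
  ∑ Y ∈ Finset.range C, ∑ q ∈ Finset.range W.length, ∑ q' ∈ Finset.range W.length,
    ind (IsStart W w n A Y q q' ∧ IsPath L n Y ∧ Y / 2 ^ (L.length * n) = z ∧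
      (pathPhase L n Y + q + q') % 4 = e)

/-- The squared absolute value of the amplitude of the basis state `z` in the output. With the
numbers `cₑ` of paths that contribute `i ^ e` it is `(c₀ - c₂)² + (c₁ - c₃)²`; written as below, the
subtraction does not truncate. -/
noncomputable def sqNorm (W : List Bool) (w n A C z : ℕ) : ℕ :=
  (count L W w n A C z 0 * count L W w n A C z 0 + count L W w n A C z 1 * count L W w n A C z 1 +
    count L W w n A C z 2 * count L W w n A C z 2 + count L W w n A C z 3 * count L W w n A C z 3) -
  2 * (count L W w n A C z 0 * count L W w n A C z 2 +
    count L W w n A C z 1 * count L W w n A C z 3)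

end Definitions

section Expressions

variable {B : Type} {u : B} {ι α : Type} {x : ι → α → List B} {l : α → List CircuitSymbol}

theorem expr_seps (hl : LExpr x l) {p : α → ℕ} (hp : Expr u x p) :
    Expr u x fun a => seps (l a) (p a) :=
  hp.sum (g := fun a i => ind ((l a)[i]? = some .sep)) (hl.up.get .bound _).ind

theorem expr_arg (hl : LExpr x l) {r : α → ℕ} (hr : Expr u x r) :
    Expr u x fun a => arg (l a) (r a) :=
  hl.length.sum (g := fun a i => ind ((l a)[i]? = some .tick ∧ seps (l a) i = r a))
    ((hl.up.get .bound _).and (.eq (expr_seps hl.up .bound) hr.up)).ind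

theorem expr_row {n Y p j : α → ℕ} (hn : Expr u x n) (hY : Expr u x Y) (hp : Expr u x p)
    (hj : Expr u x j) : PExpr u x fun a => row (n a) (Y a) (p a) (j a) = true :=
  ((PExpr.lt hj hn).and (PExpr.testBit hY ((hp.mul hn).add hj))).congr fun a => by simp [row]

theorem expr_step {n Y p : α → ℕ} (hl : LExpr x l) (hn : Expr u x n) (hY : Expr u x Y)
    (hp : Expr u x p) : PExpr u x fun a => Step (n a) (l a)[p a]? (arg (l a) (seps (l a) (p a)))
      (arg (l a) (seps (l a) (p a) + 1)) (arg (l a) (seps (l a) (p a) + 2))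
      (row (n a) (Y a) (p a)) (row (n a) (Y a) (p a + 1)) := by
  have hs := expr_seps hl hp
  have h0 := expr_arg hl hs
  have h1 := expr_arg hl (hs.add .one)
  have h2 := expr_arg hl (hs.add (.const 2))
  refine PExpr.ball hn (((hl.up.get hp.up _).and (.eq .bound h0.up)).or
    (.iff (expr_row hn.up hY.up (hp.up.add .one) .bound) (.not (.iff
      (expr_row hn.up hY.up hp.up .bound) (.or ((hl.up.get hp.up _).and
        (.and (.eq .bound h1.up) (expr_row hn.up hY.up hp.up h0.up)))
        ((hl.up.get hp.up _).and (.and (.eq .bound h2.up) (.and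
          (expr_row hn.up hY.up hp.up h0.up) (expr_row hn.up hY.up hp.up h1.up)))))))))

theorem expr_isPath {n Y : α → ℕ} (hl : LExpr x l) (hn : Expr u x n) (hY : Expr u x Y) :
    PExpr u x fun a => IsPath (l a) (n a) (Y a) :=
  PExpr.ball hl.length (expr_step hl.up hn.up hY.up .bound)

theorem expr_pathPhase {n Y : α → ℕ} (hl : LExpr x l) (hn : Expr u x n) (hY : Expr u x Y) :
    Expr u x fun a => pathPhase (l a) (n a) (Y a) := by
  have h0 := expr_arg hl.up (expr_seps hl.up (u := u) .bound)
  refine hl.length.sum (g := fun a p => stepPhase (l a)[p]? (arg (l a) (seps (l a) p))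
    (row (n a) (Y a) p) (row (n a) (Y a) (p + 1))) ?_
  have h1 := expr_row hn.up hY.up .bound h0
  have h2 := expr_row hn.up hY.up (Expr.bound.add .one) h0
  exact (((Expr.const 2).mul ((hl.up.get .bound _).and (h1.and h2)).ind).add
    ((hl.up.get .bound _).and h1).ind).add ((Expr.const 3).mul ((hl.up.get .bound _).and h1).ind)

theorem expr_isStart {W : α → List Bool} {w n A Y q q' : α → ℕ} (hW : LExpr x W) (hw : Expr u x w)
    (hn : Expr u x n) (hA : Expr u x A) (hY : Expr u x Y) (hq : Expr u x q) (hq' : Expr u x q') :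
    PExpr u x fun a => IsStart (W a) (w a) (n a) (A a) (Y a) (q a) (q' a) := by
  have hw2 := (Expr.const 2).mul hw
  refine .and (PExpr.ball hn (((PExpr.le hw2.up .bound).not.or (PExpr.testBit hY.up .bound).not).congr
    fun a => imp_iff_not_or.symm)) (.and ?_ ?_)
  · exact hW.get (((Expr.const 2).mul hq |>.mul hA).add (hY.sub ((hY.shr hw).mul hA))) _
  · exact hW.get (((((Expr.const 2).mul hq').add .one).mul hA).add
      ((hY.shr hw).sub ((hY.shr hw2).mul hA))) _

theorem expr_count {W : α → List Bool} {w n A C z : α → ℕ} (hl : LExpr x l) (hW : LExpr x W)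
    (hw : Expr u x w) (hn : Expr u x n) (hA : Expr u x A) (hC : Expr u x C) (hz : Expr u x z)
    (e : ℕ) : Expr u x fun a => count (l a) (W a) (w a) (n a) (A a) (C a) (z a) e := by
  have hY : Expr u (lift u (lift u (lift u x))) fun p => p.1.1.2 := Expr.bound.up.up
  have hq : Expr u (lift u (lift u (lift u x))) fun p => p.1.2 := Expr.bound.up
  have hq' : Expr u (lift u (lift u (lift u x))) fun p => p.2 := Expr.bound
  have hl' := hl.up (u := u) |>.up (u := u) |>.up (u := u)
  refine hC.sum (g := fun a Y => ∑ q ∈ Finset.range (W a).length, ∑ q' ∈ Finset.range (W a).length,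
    ind (IsStart (W a) (w a) (n a) (A a) Y q q' ∧ IsPath (l a) (n a) Y ∧
      Y / 2 ^ ((l a).length * n a) = z a ∧ (pathPhase (l a) (n a) Y + q + q') % 4 = e)) ?_
  refine hW.up.length.sum (g := fun p q => ∑ q' ∈ Finset.range (W p.1).length,
    ind (IsStart (W p.1) (w p.1) (n p.1) (A p.1) p.2 q q' ∧ IsPath (l p.1) (n p.1) p.2 ∧
      p.2 / 2 ^ ((l p.1).length * n p.1) = z p.1 ∧
      (pathPhase (l p.1) (n p.1) p.2 + q + q') % 4 = e)) ?_
  refine hW.up.up.length.sum (g := fun p q' => ind (IsStart (W p.1.1) (w p.1.1) (n p.1.1) (A p.1.1)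
      p.1.2 p.2 q' ∧ IsPath (l p.1.1) (n p.1.1) p.1.2 ∧
      p.1.2 / 2 ^ ((l p.1.1).length * n p.1.1) = z p.1.1 ∧
      (pathPhase (l p.1.1) (n p.1.1) p.1.2 + p.2 + q') % 4 = e)) ?_
  refine (PExpr.and (expr_isStart hW.up.up.up hw.up.up.up hn.up.up.up hA.up.up.up hY hq hq')
    (.and (expr_isPath hl' hn.up.up.up hY) (.and (.eq (hY.shr (hl'.length.mul hn.up.up.up))
      hz.up.up.up) (.eq (((expr_pathPhase hl' hn.up.up.up hY).add hq).add hq').mod_four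
      (.const e))))).ind

theorem expr_sqNorm {W : α → List Bool} {w n A C z : α → ℕ} (hl : LExpr x l) (hW : LExpr x W)
    (hw : Expr u x w) (hn : Expr u x n) (hA : Expr u x A) (hC : Expr u x C) (hz : Expr u x z) :
    Expr u x fun a => sqNorm (l a) (W a) (w a) (n a) (A a) (C a) (z a) := by
  have h := expr_count hl hW hw hn hA hC hz
  exact (((((h 0).mul (h 0)).add ((h 1).mul (h 1))).add ((h 2).mul (h 2))).add
    ((h 3).mul (h 3))).sub ((Expr.const 2).mul (((h 0).mul (h 2)).add ((h 1).mul (h 3))))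

end Expressions

/-- The power `2 ^ e` for `e ≤ P(n)`, where `n` is the length of the input, if the guessed string
has length `2 ^ P(n)`. -/
def pow {A : Type} (P : Polynomial ℕ) (d : Data A) (e : ℕ) : ℕ :=
  d.wit.length / 2 ^ (P.eval d.word.length - e)

/-- The final test: the acceptance probability, conditional on the postselection, exceeds the
threshold `(T + 1) / 2 ^ k`, where `T` is the number with the bits `d.bits`. -/
noncomputable def Accepts (kp P : Polynomial ℕ) (d : Data CircuitSymbol) : Prop :=
  let w := arg d.circ 0
  let n := 2 * w + arg d.circ 1
  let f := sqNorm d.circ d.wit w n (pow P d w) (pow P d ((d.circ.length + 1) * n))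
  (1 + ∑ i ∈ Finset.range d.bits.length, ind (d.bits[i]? = some true) * pow P d i) *
      ∑ z ∈ Finset.range (pow P d n), ind (z.testBit 1 = true) * f z <
    pow P d (kp.eval d.word.length) *
      ∑ z ∈ Finset.range (pow P d n), ind (z.testBit 0 = true ∧ z.testBit 1 = true) * f z

theorem pexpr_accepts {B : Type} {u : B} {ι : Type} {x : ι → Data CircuitSymbol → List B}
    (hword : LExpr x Data.word) (hcirc : LExpr x Data.circ) (hbits : LExpr x Data.bits)
    (hwit : LExpr x Data.wit) (kp P : Polynomial ℕ) : PExpr u x (Accepts kp P) := by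
  have hpow : ∀ {e : Data CircuitSymbol → ℕ}, Expr u x e → Expr u x fun d => pow P d (e d) :=
    fun he => hwit.length.shr ((hword.length.poly P).sub he)
  have hw := expr_arg hcirc (Expr.const (u := u) 0)
  have hn := ((Expr.const 2).mul hw).add (expr_arg hcirc (Expr.const (u := u) 1))
  have hf := expr_sqNorm hcirc.up hwit.up hw.up hn.up (hpow hw).up
    (hpow ((hcirc.length.add .one).mul hn)).up .bound
  refine PExpr.lt (.mul (.add .one (hbits.length.sum
    (g := fun d i => ind (d.bits[i]? = some true) * pow P d i) ?_))
    ((hpow hn).sum (g := fun d z => _) ?_)) (.mul (hpow (hword.length.poly kp))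
    ((hpow hn).sum (g := fun d z => _) ?_))
  · exact (hbits.up.get .bound _).ind.mul
      (hwit.up.length.shr ((hword.up.length.poly P).sub .bound))
  · exact (PExpr.testBit Expr.bound (.const 1)).ind.mul hf
  · exact ((PExpr.testBit Expr.bound (.const 0)).and (PExpr.testBit Expr.bound (.const 1))).ind.mul hf

end PathSum

end

/-! ### Indicators -/

section

namespace PathSum

open QuantumComplexity

theorem ind_true {p : Prop} (h : p) : ind p = 1 := if_pos h

theorem ind_false {p : Prop} (h : ¬p) : ind p = 0 := if_neg h

theorem ind_and (p q : Prop) : ind (p ∧ q) = ind p * ind q := by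
  by_cases hp : p <;> by_cases hq : q <;> simp [ind, hp, hq]

/-! ### Reading the description of a circuit -/

theorem seps_zero (L : List CircuitSymbol) : seps L 0 = 0 := rfl

theorem seps_cons (s : CircuitSymbol) (L : List CircuitSymbol) (p : ℕ) :
    seps (s :: L) (p + 1) = ind (s = .sep) + seps L p := by
  rw [seps, Finset.sum_range_succ']
  simp [seps, add_comm]

theorem arg_cons (s : CircuitSymbol) (L : List CircuitSymbol) (r : ℕ) :
    arg (s :: L) r = ind (s = .tick ∧ 0 = r) +
      ∑ i ∈ Finset.range L.length, ind (L[i]? = some .tick ∧ ind (s = .sep) + seps L i = r) := by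
  rw [arg, List.length_cons, Finset.sum_range_succ']
  simp [seps_cons, seps_zero, add_comm]

theorem arg_tick_zero (L : List CircuitSymbol) : arg (.tick :: L) 0 = arg L 0 + 1 := by
  rw [arg_cons]
  simp [ind_true trivial, ind_false not_false, arg, add_comm]

theorem arg_tick_succ (L : List CircuitSymbol) (r : ℕ) :
    arg (.tick :: L) (r + 1) = arg L (r + 1) := by
  rw [arg_cons]
  simp [ind_false not_false, arg]

theorem arg_sep_zero (L : List CircuitSymbol) : arg (.sep :: L) 0 = 0 := by
  rw [arg_cons]
  simp [ind]

theorem arg_sep_succ (L : List CircuitSymbol) (r : ℕ) : arg (.sep :: L) (r + 1) = arg L r := by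
  rw [arg_cons]
  simp [ind_true trivial, ind_false not_false, arg, add_comm 1]

theorem arg_encodeIndex_zero (j : ℕ) (L : List CircuitSymbol) : arg (encodeIndex j ++ L) 0 = j := by
  induction j with
  | zero => exact arg_sep_zero L
  | succ j ih =>
    rw [encodeIndex, List.replicate_succ]
    exact (arg_tick_zero (encodeIndex j ++ L)).trans (congrArg (· + 1) ih)

theorem arg_encodeIndex_succ (j : ℕ) (L : List CircuitSymbol) (r : ℕ) :
    arg (encodeIndex j ++ L) (r + 1) = arg L r := by
  induction j with
  | zero => exact arg_sep_succ L r
  | succ j ih =>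
    rw [encodeIndex, List.replicate_succ]
    exact (arg_tick_succ _ _).trans ih

/-- The string `l` does not influence the meaning of the symbols that follow it. -/
def Closed (l : List CircuitSymbol) : Prop :=
  ∀ L p i, arg (l ++ L) (seps (l ++ L) (l.length + p) + i) = arg L (seps L p + i)

theorem Closed.append {l l' : List CircuitSymbol} (h : Closed l) (h' : Closed l') :
    Closed (l ++ l') := by
  intro L p i
  rw [List.append_assoc, List.length_append, add_assoc, h, h']

theorem seps_encodeIndex (j : ℕ) (L : List CircuitSymbol) (p : ℕ) :
    seps (encodeIndex j ++ L) ((encodeIndex j).length + p) = seps L p + 1 := by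
  induction j with
  | zero =>
    show seps (.sep :: L) (1 + p) = _
    rw [add_comm 1 p, seps_cons, ind_true rfl, add_comm]
  | succ j ih =>
    rw [← ih]
    show seps (.tick :: (encodeIndex j ++ L)) ((encodeIndex j).length + 1 + p) = _
    rw [add_right_comm, seps_cons, ind_false (by simp), zero_add]

theorem closed_encodeIndex (j : ℕ) : Closed (encodeIndex j) := fun L p i => by
  rw [seps_encodeIndex, add_right_comm, arg_encodeIndex_succ]

theorem arg_gate {s : CircuitSymbol} (hs : s ≠ .tick) (hs' : s ≠ .sep) (L : List CircuitSymbol)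
    (r : ℕ) : arg (s :: L) r = arg L r := by
  rw [arg_cons]
  simp [ind_false not_false, arg, hs, hs']

theorem closed_gate {s : CircuitSymbol} (hs : s ≠ .tick) (hs' : s ≠ .sep) : Closed [s] := by
  intro L p i
  show arg (s :: L) (seps (s :: L) (1 + p) + i) = _
  rw [add_comm 1 p, seps_cons, ind_false hs', zero_add, arg_gate hs hs']

/-! ### The operator of a symbol -/

variable {n : ℕ}

/-- The basis state `z` of `n` qubits, extended by zeros. -/
def ext (z : Fin n → Bool) (j : ℕ) : Bool := if h : j < n then z ⟨j, h⟩ else false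

theorem ext_val (z : Fin n → Bool) (j : Fin n) : ext z j = z j := by simp [ext]

open Complex in
/-- The operator of the symbol at position `p` of `L`. For Hadamard gates the factor `1 / √2` is
left out, so that all entries are zero or powers of `i`. -/
noncomputable def stepMatrix (n : ℕ) (L : List CircuitSymbol) (p : ℕ) :
    Matrix (Fin n → Bool) (Fin n → Bool) ℂ :=
  Matrix.of fun z' z => ind (Step n L[p]? (arg L (seps L p)) (arg L (seps L p + 1))
    (arg L (seps L p + 2)) (ext z) (ext z')) *
    I ^ stepPhase L[p]? (arg L (seps L p)) (ext z) (ext z')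

theorem stepMatrix_append {l : List CircuitSymbol} (h : Closed l) (L : List CircuitSymbol) (p : ℕ) :
    stepMatrix n (l ++ L) (l.length + p) = stepMatrix n L p := by
  have h0 := h L p 0
  rw [add_zero, add_zero] at h0
  unfold stepMatrix
  rw [h0, h, h, List.getElem?_append_right (by omega), Nat.add_sub_cancel_left]

theorem stepMatrix_eq_one {L : List CircuitSymbol} {p : ℕ}
    (h : L[p]? = some .tick ∨ L[p]? = some .sep) : stepMatrix n L p = 1 := by
  ext z' z
  have hs : ∀ a b c, Step n L[p]? a b c (ext z) (ext z') ↔ z' = z := by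
    intro a b c
    constructor
    · intro hs
      funext j
      have := hs j j.2
      rw [ext_val, ext_val] at this
      rcases h with h | h <;> simpa [h] using this
    · rintro rfl j hj
      rcases h with h | h <;> simp [h]
  have hp : stepPhase L[p]? (arg L (seps L p)) (ext z) (ext z') = 0 := by
    rcases h with h | h <;> simp [h, stepPhase, ind]
  rw [stepMatrix, Matrix.of_apply, hs, hp, Matrix.one_apply]
  by_cases hz : z' = z <;> simp [hz, ind]

theorem stepMatrix_H (j : Fin n) (L : List CircuitSymbol) :
    stepMatrix n ((Gate.H j).encode ++ L) 0 = (Real.sqrt 2 : ℂ) • (Gate.H j).toMatrix := by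
  ext z' z
  have h0 : arg ((Gate.H j).encode ++ L) (seps ((Gate.H j).encode ++ L) 0) = j := by
    rw [seps_zero, Gate.encode, List.cons_append, arg_gate (by simp) (by simp),
      arg_encodeIndex_zero]
  have e : ((Gate.H j).encode ++ L)[0]? = some .H := rfl
  have hs : ∀ b c, Step n (some .H) j b c (ext z) (ext z') ↔ ∀ k, k ≠ j → z' k = z k := by
    intro b c
    constructor
    · intro hs k hk
      have := hs k k.2
      rw [ext_val, ext_val] at this
      simpa [Fin.val_inj, hk] using this
    · intro hs k hk
      by_cases hkj : k = j
      · exact Or.inl ⟨rfl, hkj⟩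
      · have := hs ⟨k, hk⟩ (fun h => hkj (by rw [← h]))
        right
        simp [ext, hk, this]
  have h2 : (Real.sqrt 2 : ℂ) ≠ 0 := by simp
  rw [stepMatrix, Matrix.of_apply, h0, e, hs, stepPhase, ext_val, ext_val, Matrix.smul_apply,
    Gate.toMatrix, onQubit, Matrix.of_apply, hadamard, Matrix.of_apply]
  by_cases hz : ∀ k, k ≠ j → z' k = z k
  · rw [ind_true hz, if_pos hz]
    cases z j <;> cases z' j <;> simp [ind, div_eq_mul_inv, h2]
  · rw [ind_false hz, if_neg hz]
    simp

theorem step_diagonal {s : CircuitSymbol} (hs : s = .K ∨ s = .Kinv) (a b c : ℕ)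
    (z z' : Fin n → Bool) : Step n (some s) a b c (ext z) (ext z') ↔ z' = z := by
  constructor
  · intro h
    funext k
    have := h k k.2
    rw [ext_val, ext_val] at this
    rcases hs with rfl | rfl <;> simpa using this
  · rintro rfl k hk
    rcases hs with rfl | rfl <;> simp

theorem onQubit_phase (t : ℂ) (j : Fin n) (z' z : Fin n → Bool) :
    onQubit (phase t) j z' z = if z' = z then (if z j then t else 1) else 0 := by
  rw [onQubit, Matrix.of_apply, phase, Matrix.diagonal_apply]
  by_cases hz : z' = z
  · subst hz
    simp
  · rw [if_neg hz]
    by_cases h : ∀ k, k ≠ j → z' k = z k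
    · rw [if_pos h, if_neg]
      intro hj
      refine hz (funext fun k => ?_)
      by_cases hk : k = j
      · rw [hk, hj]
      · exact h k hk
    · rw [if_neg h]

theorem stepMatrix_K (j : Fin n) (L : List CircuitSymbol) :
    stepMatrix n ((Gate.K j).encode ++ L) 0 = (Gate.K j).toMatrix := by
  ext z' z
  have h0 : arg ((Gate.K j).encode ++ L) (seps ((Gate.K j).encode ++ L) 0) = j := by
    rw [seps_zero, Gate.encode, List.cons_append, arg_gate (by simp) (by simp),
      arg_encodeIndex_zero]
  have e : ((Gate.K j).encode ++ L)[0]? = some .K := rfl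
  rw [stepMatrix, Matrix.of_apply, h0, e, step_diagonal (.inl rfl), stepPhase, ext_val, ext_val,
    Gate.toMatrix, onQubit_phase]
  by_cases hz : z' = z <;> cases z j <;> simp [ind, hz]

theorem stepMatrix_Kinv (j : Fin n) (L : List CircuitSymbol) :
    stepMatrix n ((Gate.Kinv j).encode ++ L) 0 = (Gate.Kinv j).toMatrix := by
  ext z' z
  have h0 : arg ((Gate.Kinv j).encode ++ L) (seps ((Gate.Kinv j).encode ++ L) 0) = j := by
    rw [seps_zero, Gate.encode, List.cons_append, arg_gate (by simp) (by simp),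
      arg_encodeIndex_zero]
  have e : ((Gate.Kinv j).encode ++ L)[0]? = some .Kinv := rfl
  rw [stepMatrix, Matrix.of_apply, h0, e, step_diagonal (.inr rfl), stepPhase, ext_val, ext_val,
    Gate.toMatrix, onQubit_phase]
  by_cases hz : z' = z <;> cases z j <;> simp [ind, hz, Complex.I_pow_three]

theorem stepMatrix_CNOT (i j : Fin n) (hij : i ≠ j) (L : List CircuitSymbol) :
    stepMatrix n ((Gate.CNOT i j hij).encode ++ L) 0 = (Gate.CNOT i j hij).toMatrix := by
  ext z' z
  set M := (Gate.CNOT i j hij).encode ++ L with hM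
  have hM' : M = .CNOT :: (encodeIndex i ++ (encodeIndex j ++ L)) := by
    simp [hM, Gate.encode]
  have h0 : arg M 0 = i := by
    rw [hM', arg_gate (by simp) (by simp), arg_encodeIndex_zero]
  have h1 : arg M (0 + 1) = j := by
    rw [hM', arg_gate (by simp) (by simp), arg_encodeIndex_succ, arg_encodeIndex_zero]
  have e : M[0]? = some .CNOT := rfl
  have hs : ∀ c, Step n (some .CNOT) i j c (ext z) (ext z') ↔
      z' = Function.update z j (xor (z j) (z i)) := by
    intro c
    have key : ∀ k : Fin n, (z' k = true ↔ ¬(z k = true ↔ (k : ℕ) = j ∧ z i = true)) ↔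
        z' k = Function.update z j (xor (z j) (z i)) k := by
      intro k
      by_cases hk : k = j
      · subst hk
        simp only [Function.update_self]
        cases z' k <;> cases z k <;> cases z i <;> simp
      · rw [Function.update_of_ne hk]
        have : (k : ℕ) ≠ j := fun h => hk (Fin.ext h)
        cases z' k <;> cases z k <;> simp [this]
    constructor
    · intro hs
      funext k
      have := hs k k.2
      rw [ext_val, ext_val, ext_val] at this
      exact (key k).1 (by simpa using this)
    · intro hs k hk
      have := (key ⟨k, hk⟩).2 (congrFun hs _)
      right
      have e1 := ext_val z ⟨k, hk⟩
      have e2 := ext_val z' ⟨k, hk⟩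
      dsimp only at e1 e2
      rw [ext_val, e1, e2]
      simpa using this
  rw [stepMatrix, Matrix.of_apply, seps_zero, h0, h1, e, hs, stepPhase, Gate.toMatrix, basisMap,
    Matrix.of_apply]
  by_cases hz : z' = Function.update z j (xor (z j) (z i))
  · rw [ind_true hz, if_pos hz]
    simp [ind]
  · rw [ind_false hz, if_neg hz]
    simp

theorem stepMatrix_Toffoli (i j k : Fin n) (hij : i ≠ j) (hik : i ≠ k) (hjk : j ≠ k)
    (L : List CircuitSymbol) : stepMatrix n ((Gate.Toffoli i j k hij hik hjk).encode ++ L) 0 =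
      (Gate.Toffoli i j k hij hik hjk).toMatrix := by
  ext z' z
  set M := (Gate.Toffoli i j k hij hik hjk).encode ++ L with hM
  have hM' : M = .Toffoli :: (encodeIndex i ++ (encodeIndex j ++ (encodeIndex k ++ L))) := by
    simp [hM, Gate.encode]
  have h0 : arg M 0 = i := by
    rw [hM', arg_gate (by simp) (by simp), arg_encodeIndex_zero]
  have h1 : arg M (0 + 1) = j := by
    rw [hM', arg_gate (by simp) (by simp), arg_encodeIndex_succ, arg_encodeIndex_zero]
  have h2 : arg M (0 + 2) = k := by
    rw [hM', arg_gate (by simp) (by simp), arg_encodeIndex_succ, arg_encodeIndex_succ,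
      arg_encodeIndex_zero]
  have e : M[0]? = some .Toffoli := rfl
  have hs : Step n (some .Toffoli) i j k (ext z) (ext z') ↔
      z' = Function.update z k (xor (z k) (z i && z j)) := by
    have key : ∀ r : Fin n,
        (z' r = true ↔ ¬(z r = true ↔ (r : ℕ) = k ∧ z i = true ∧ z j = true)) ↔
        z' r = Function.update z k (xor (z k) (z i && z j)) r := by
      intro r
      by_cases hr : r = k
      · subst hr
        simp only [Function.update_self]
        cases z' r <;> cases z r <;> cases z i <;> cases z j <;> simp
      · rw [Function.update_of_ne hr]
        have : (r : ℕ) ≠ k := fun h => hr (Fin.ext h)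
        cases z' r <;> cases z r <;> simp [this]
    constructor
    · intro hs
      funext r
      have := hs r r.2
      rw [ext_val, ext_val, ext_val, ext_val] at this
      exact (key r).1 (by simpa using this)
    · intro hs r hr
      have := (key ⟨r, hr⟩).2 (congrFun hs _)
      right
      have e1 := ext_val z ⟨r, hr⟩
      have e2 := ext_val z' ⟨r, hr⟩
      dsimp only at e1 e2
      rw [ext_val, ext_val, e1, e2]
      simpa using this
  rw [stepMatrix, Matrix.of_apply, seps_zero, h0, h1, h2, e, hs, stepPhase, Gate.toMatrix, basisMap,
    Matrix.of_apply]
  by_cases hz : z' = Function.update z k (xor (z k) (z i && z j))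
  · rw [ind_true hz, if_pos hz]
    simp [ind]
  · rw [ind_false hz, if_neg hz]
    simp

/-! ### The operator of a circuit -/

/-- The product of the operators of the first `t` symbols of `L`. -/
noncomputable def evolution (n : ℕ) (L : List CircuitSymbol) :
    ℕ → Matrix (Fin n → Bool) (Fin n → Bool) ℂ
  | 0 => 1
  | t + 1 => stepMatrix n L t * evolution n L t

theorem evolution_append {l : List CircuitSymbol} (h : Closed l) (L : List CircuitSymbol) (t : ℕ) :
    evolution n (l ++ L) (l.length + t) = evolution n L t * evolution n (l ++ L) l.length := by
  induction t with
  | zero => simp [evolution]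
  | succ t ih =>
    rw [← add_assoc, evolution, evolution, ih, stepMatrix_append h, mul_assoc]

theorem evolution_add_of_index {L : List CircuitSymbol} {t s : ℕ}
    (h : ∀ p, t ≤ p → p < t + s → L[p]? = some .tick ∨ L[p]? = some .sep) :
    evolution n L (t + s) = evolution n L t := by
  induction s with
  | zero => rfl
  | succ s ih =>
    rw [← add_assoc, evolution, stepMatrix_eq_one (h _ (by omega) (by omega)), one_mul,
      ih fun p h1 h2 => h p h1 (by omega)]

theorem mem_encodeIndex {j : ℕ} {s : CircuitSymbol} (h : s ∈ encodeIndex j) :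
    s = .tick ∨ s = .sep := by
  rcases List.mem_append.1 h with h | h
  · exact .inl (List.eq_of_mem_replicate h)
  · exact .inr (List.mem_singleton.1 h)

theorem evolution_gate (s : CircuitSymbol) (l L : List CircuitSymbol)
    (h : ∀ s ∈ l, s = .tick ∨ s = .sep) :
    evolution n ((s :: l) ++ L) (s :: l).length = stepMatrix n ((s :: l) ++ L) 0 := by
  rw [List.length_cons, add_comm, evolution_add_of_index]
  · simp [evolution]
  · intro p h1 h2
    obtain ⟨p, rfl⟩ : ∃ q, p = q + 1 := ⟨p - 1, by omega⟩
    rw [List.cons_append, List.getElem?_cons_succ, List.getElem?_append_left (by omega),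
      List.getElem?_eq_getElem (by omega)]
    simpa using h _ (List.getElem_mem (by omega))

/-- The description of a gate acts as the gate, up to a factor, which is `√2` for Hadamard gates. -/
theorem evolution_encode_gate (g : Gate n) : Closed g.encode ∧ ∃ r : ℝ, 0 < r ∧ ∀ L,
    evolution n (g.encode ++ L) g.encode.length = (r : ℂ) • g.toMatrix := by
  cases g with
  | H j =>
    refine ⟨(closed_gate (s := .H) (by simp) (by simp)).append (closed_encodeIndex j), Real.sqrt 2,
      by positivity, fun L => ?_⟩
    rw [← stepMatrix_H j L]
    exact evolution_gate _ _ _ fun s => mem_encodeIndex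
  | K j =>
    refine ⟨(closed_gate (s := .K) (by simp) (by simp)).append (closed_encodeIndex j), 1,
      one_pos, fun L => ?_⟩
    rw [Complex.ofReal_one, one_smul, ← stepMatrix_K j L]
    exact evolution_gate _ _ _ fun s => mem_encodeIndex
  | Kinv j =>
    refine ⟨(closed_gate (s := .Kinv) (by simp) (by simp)).append (closed_encodeIndex j), 1,
      one_pos, fun L => ?_⟩
    rw [Complex.ofReal_one, one_smul, ← stepMatrix_Kinv j L]
    exact evolution_gate _ _ _ fun s => mem_encodeIndex
  | CNOT i j hij =>
    refine ⟨(closed_gate (s := .CNOT) (by simp) (by simp)).append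
      ((closed_encodeIndex i).append (closed_encodeIndex j)), 1, one_pos, fun L => ?_⟩
    rw [Complex.ofReal_one, one_smul, ← stepMatrix_CNOT i j hij L]
    refine evolution_gate _ _ _ fun s hs => ?_
    rcases List.mem_append.1 hs with hs | hs <;> exact mem_encodeIndex hs
  | Toffoli i j k hij hik hjk =>
    refine ⟨(closed_gate (s := .Toffoli) (by simp) (by simp)).append
      (((closed_encodeIndex i).append (closed_encodeIndex j)).append (closed_encodeIndex k)), 1,
      one_pos, fun L => ?_⟩
    rw [Complex.ofReal_one, one_smul, ← stepMatrix_Toffoli i j k hij hik hjk L]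
    refine evolution_gate _ _ _ fun s hs => ?_
    rcases List.mem_append.1 hs with hs | hs
    · rcases List.mem_append.1 hs with hs | hs <;> exact mem_encodeIndex hs
    · exact mem_encodeIndex hs

theorem foldl_toMatrix (gs : List (Gate n)) (U : Matrix (Fin n → Bool) (Fin n → Bool) ℂ) :
    gs.foldl (fun U g => g.toMatrix * U) U = gs.foldl (fun U g => g.toMatrix * U) 1 * U := by
  induction gs generalizing U with
  | nil => simp
  | cons g gs ih =>
    rw [List.foldl_cons, List.foldl_cons, ih, ih (g.toMatrix * 1), mul_one, mul_assoc]

theorem evolution_gates (gs : List (Gate n)) : ∃ r : ℝ, 0 < r ∧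
    evolution n (gs.flatMap Gate.encode) (gs.flatMap Gate.encode).length =
      (r : ℂ) • gs.foldl (fun U g => g.toMatrix * U) 1 := by
  induction gs with
  | nil => exact ⟨1, one_pos, by simp [evolution]⟩
  | cons g gs ih =>
    obtain ⟨r, hr, ih⟩ := ih
    obtain ⟨hg, r', hr', h⟩ := evolution_encode_gate g
    refine ⟨r * r', mul_pos hr hr', ?_⟩
    rw [List.flatMap_cons, List.length_append, evolution_append hg, ih, h, List.foldl_cons, mul_one,
      foldl_toMatrix gs g.toMatrix, Complex.ofReal_mul, smul_mul_smul_comm]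

/-- Up to a positive factor, the operators of the symbols of the description of a circuit multiply
to the operator of the circuit. -/
theorem evolution_encode (V : Verifier) : ∃ r : ℝ, 0 < r ∧
    evolution (2 * V.w + V.m) V.encode V.encode.length = (r : ℂ) • V.toMatrix := by
  obtain ⟨r, hr, h⟩ := evolution_gates V.gates
  refine ⟨r, hr, ?_⟩
  have hc := (closed_encodeIndex V.w).append (closed_encodeIndex V.m)
  rw [Verifier.encode, List.length_append, evolution_append hc, h, Verifier.toMatrix]
  have e := evolution_add_of_index (n := 2 * V.w + V.m) (t := 0)
    (s := (encodeIndex V.w ++ encodeIndex V.m).length)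
    (L := encodeIndex V.w ++ encodeIndex V.m ++ V.gates.flatMap Gate.encode) (by
      intro p _ hp
      rw [zero_add] at hp
      rw [List.getElem?_append_left hp, List.getElem?_eq_getElem hp]
      rcases List.mem_append.1 (List.getElem_mem hp) with hs | hs <;> simpa using mem_encodeIndex hs)
  rw [zero_add] at e
  rw [e, evolution, mul_one]

theorem arg_encode (V : Verifier) : arg V.encode 0 = V.w ∧ arg V.encode 1 = V.m := by
  rw [Verifier.encode, List.append_assoc, arg_encodeIndex_zero, arg_encodeIndex_succ,
    arg_encodeIndex_zero]
  exact ⟨rfl, rfl⟩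

end PathSum

end

section

namespace PathSum

open QuantumComplexity Complex

/-! ### Numbers as sequences of basis states -/

/-- The basis state of `n` qubits that is given by the binary digits of a number. -/
def digits (n Y : ℕ) : Fin n → Bool := fun j => Y.testBit j

theorem row_eq (n Y p : ℕ) : row n Y p = ext (digits n (Y / 2 ^ (p * n))) := by
  funext j
  by_cases hj : j < n <;> simp [row, ext, digits, hj, Nat.testBit_div_two_pow, add_comm]

theorem digits_ofBits {n : ℕ} (z : Fin n → Bool) : digits n (Nat.ofBits z) = z := by
  funext j
  simp [digits]

theorem sum_digits {M : Type*} [AddCommMonoid M] (n : ℕ) (f : (Fin n → Bool) → M) :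
    ∑ z ∈ Finset.range (2 ^ n), f (digits n z) = ∑ z, f z := by
  refine Finset.sum_bij' (fun z _ => digits n z) (fun z _ => Nat.ofBits z)
    (fun _ _ => Finset.mem_univ _) (fun z _ => Finset.mem_range.2 (Nat.ofBits_lt_two_pow z))
    (fun z hz => ?_) (fun z _ => digits_ofBits z) (fun _ _ => rfl)
  exact (Nat.ofBits_testBit z n).trans (Nat.mod_eq_of_lt (Finset.mem_range.1 hz))

theorem sum_range_mul {M : Type*} [AddCommMonoid M] (a b : ℕ) (f : ℕ → M) :
    ∑ Y ∈ Finset.range (a * b), f Y =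
      ∑ z ∈ Finset.range b, ∑ Y ∈ Finset.range a, f (a * z + Y) := by
  induction b with
  | zero => simp
  | succ b ih => rw [mul_add, mul_one, Finset.sum_range_add, ih, Finset.sum_range_succ]

theorem digits_div_low {n e Y z d : ℕ} (hd : d + n ≤ e) (hY : Y < 2 ^ e) :
    digits n ((2 ^ e * z + Y) / 2 ^ d) = digits n (Y / 2 ^ d) := by
  funext j
  have := j.2
  rw [digits, digits, Nat.testBit_div_two_pow, Nat.testBit_div_two_pow,
    Nat.testBit_two_pow_mul_add _ hY, if_pos (by omega)]

/-- A sum over paths is a product of matrices. -/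
theorem sum_paths {n : ℕ} (L : List CircuitSymbol) (φ : (Fin n → Bool) → ℂ) (t : ℕ)
    (β : Fin n → Bool) :
    ∑ Y ∈ Finset.range (2 ^ ((t + 1) * n)), (if digits n (Y / 2 ^ (t * n)) = β then 1 else 0) *
      ((∏ p ∈ Finset.range t, stepMatrix n L p (digits n (Y / 2 ^ ((p + 1) * n)))
        (digits n (Y / 2 ^ (p * n)))) * φ (digits n Y)) = (evolution n L t).mulVec φ β := by
  induction t generalizing β with
  | zero =>
    have := sum_digits n fun z => (if z = β then 1 else 0) * φ z
    simpa [evolution] using this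
  | succ t ih =>
    rw [add_mul (t + 1), one_mul, pow_add, sum_range_mul, evolution, ← Matrix.mulVec_mulVec,
      Matrix.mulVec, dotProduct]
    set e := (t + 1) * n with he
    have hle : ∀ p ≤ t, p * n + n ≤ e := fun p hp => by
      rw [he, ← add_one_mul]; exact Nat.mul_le_mul_right n (by omega)
    -- The leading digit `z` is the last basis state of the path; it affects only the last step.
    have h1 : ∀ z, ∀ Y ∈ Finset.range (2 ^ e),
        ((if digits n ((2 ^ e * z + Y) / 2 ^ e) = β then 1 else 0) *
        ((∏ p ∈ Finset.range (t + 1), stepMatrix n L p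
          (digits n ((2 ^ e * z + Y) / 2 ^ ((p + 1) * n)))
          (digits n ((2 ^ e * z + Y) / 2 ^ (p * n)))) * φ (digits n (2 ^ e * z + Y))) : ℂ) =
        (if digits n z = β then 1 else 0) * (stepMatrix n L t (digits n z)
          (digits n (Y / 2 ^ (t * n))) * ((∏ p ∈ Finset.range t, stepMatrix n L p
          (digits n (Y / 2 ^ ((p + 1) * n))) (digits n (Y / 2 ^ (p * n)))) * φ (digits n Y))) := by
      intro z Y hY
      have hY := Finset.mem_range.1 hY
      have h2 : (2 ^ e * z + Y) / 2 ^ e = z := by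
        rw [Nat.mul_add_div (by positivity), Nat.div_eq_of_lt hY, add_zero]
      have h3 : digits n (2 ^ e * z + Y) = digits n Y := by
        have := digits_div_low (n := n) (d := 0) (z := z) (by have := hle 0 (by omega); omega) hY
        simpa using this
      rw [h2, h3, Finset.prod_range_succ, ← he, h2, digits_div_low (hle t le_rfl) hY]
      rw [Finset.prod_congr rfl fun p hp => by
        rw [digits_div_low (hle (p + 1) (by have := Finset.mem_range.1 hp; omega)) hY,
          digits_div_low (hle p (by have := Finset.mem_range.1 hp; omega)) hY]]
      ring
    rw [Finset.sum_congr rfl fun z _ => Finset.sum_congr rfl (h1 z)]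
    simp only [← Finset.mul_sum]
    rw [sum_digits n fun z => (if z = β then (1 : ℂ) else 0) * ∑ Y ∈ Finset.range (2 ^ e),
      stepMatrix n L t z (digits n (Y / 2 ^ (t * n))) * ((∏ p ∈ Finset.range t, stepMatrix n L p
          (digits n (Y / 2 ^ ((p + 1) * n))) (digits n (Y / 2 ^ (p * n)))) * φ (digits n Y))]
    simp only [ite_mul, one_mul, zero_mul, Finset.sum_ite_eq', Finset.mem_univ, if_true]
    simp only [← ih, Finset.mul_sum]
    rw [Finset.sum_comm]
    refine Finset.sum_congr rfl fun Y _ => ?_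
    rw [Finset.sum_eq_single (digits n (Y / 2 ^ (t * n)))]
    · simp
    · intro γ _ hγ
      simp [hγ.symm]
    · simp

/-! ### The amplitudes of the output -/

/-- The witness with the amplitudes `∑ i ^ q`, where `q` runs over the powers whose bit is set in
the string `W`. The blocks of `W` belong to the first witness (`ε = 0`) and to the second one
(`ε = 1`) in turn. -/
noncomputable def witness (W : List Bool) (w ε : ℕ) : EuclideanSpace ℂ (Fin w → Bool) :=
  WithLp.toLp 2 fun α => ∑ q ∈ Finset.range W.length,
    (ind (W[(2 * q + ε) * 2 ^ w + Nat.ofBits α]? = some true) : ℂ) * I ^ q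

theorem sum_start (W : List Bool) (V : Verifier) (Y : ℕ) :
    ∑ q ∈ Finset.range W.length, ∑ q' ∈ Finset.range W.length,
      (ind (IsStart W V.w (2 * V.w + V.m) (2 ^ V.w) Y q q') : ℂ) * I ^ (q + q') =
    V.inputVec (witness W V.w 0) (witness W V.w 1) (digits _ Y) := by
  have h0 : (∀ j < 2 * V.w + V.m, 2 * V.w ≤ j → ¬Y.testBit j = true) ↔
      ∀ i : Fin V.m, digits (2 * V.w + V.m) Y ⟨2 * V.w + i, by have := i.2; omega⟩ = false := by
    constructor
    · intro h i
      have := h (2 * V.w + i) (by have := i.2; omega) (by omega)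
      simpa [digits] using this
    · intro h j hj hj'
      have := h ⟨j - 2 * V.w, by omega⟩
      simp only [digits, Nat.add_sub_cancel' hj'] at this
      simp [this]
  have h1 : (Nat.ofBits fun i : Fin V.w => digits (2 * V.w + V.m) Y ⟨i, by have := i.2; omega⟩) =
      Y - Y / 2 ^ V.w * 2 ^ V.w := by
    refine (Nat.ofBits_testBit Y V.w).trans ?_
    have := Nat.div_add_mod' Y (2 ^ V.w)
    omega
  have h2 : (Nat.ofBits fun i : Fin V.w =>
      digits (2 * V.w + V.m) Y ⟨V.w + i, by have := i.2; omega⟩) =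
      Y / 2 ^ V.w - Y / 2 ^ (2 * V.w) * 2 ^ V.w := by
    have e : (fun i : Fin V.w => digits (2 * V.w + V.m) Y ⟨V.w + i, by have := i.2; omega⟩) =
        fun i : Fin V.w => (Y / 2 ^ V.w).testBit i := by
      funext i
      rw [Nat.testBit_div_two_pow]
      exact congrArg _ (add_comm _ _)
    rw [e, Nat.ofBits_testBit]
    have := Nat.div_add_mod' (Y / 2 ^ V.w) (2 ^ V.w)
    rw [Nat.div_div_eq_div_mul, ← pow_add, ← two_mul] at this
    omega
  simp only [Verifier.inputVec, witness, ← h0, h1, h2, add_zero]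
  by_cases ha : ∀ j < 2 * V.w + V.m, 2 * V.w ≤ j → ¬Y.testBit j = true
  · rw [if_pos ha, mul_one, Finset.sum_mul_sum]
    refine Finset.sum_congr rfl fun q _ => Finset.sum_congr rfl fun q' _ => ?_
    rw [IsStart, ind_and, ind_and, ind_true ha, one_mul, pow_add, Nat.cast_mul]
    ring
  · rw [if_neg ha, mul_zero]
    refine Finset.sum_eq_zero fun q _ => Finset.sum_eq_zero fun q' _ => ?_
    rw [IsStart, ind_and, ind_false ha]
    simp

theorem ind_isPath (L : List CircuitSymbol) (n Y : ℕ) :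
    (ind (IsPath L n Y) : ℂ) * I ^ pathPhase L n Y =
      ∏ p ∈ Finset.range L.length, stepMatrix n L p (digits n (Y / 2 ^ ((p + 1) * n)))
        (digits n (Y / 2 ^ (p * n))) := by
  have h : ∀ (m : ℕ) (Q : ℕ → Prop), ind (∀ p < m, Q p) = ∏ p ∈ Finset.range m, ind (Q p) := by
    intro m Q
    by_cases hQ : ∀ p < m, Q p
    · rw [ind_true hQ, Finset.prod_eq_one]
      exact fun p hp => ind_true (hQ p (Finset.mem_range.1 hp))
    · rw [ind_false hQ]
      push Not at hQ
      obtain ⟨p, hp, hpQ⟩ := hQ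
      exact (Finset.prod_eq_zero (Finset.mem_range.2 hp) (ind_false hpQ)).symm
  rw [IsPath, h, pathPhase, ← Finset.prod_pow_eq_pow_sum, Nat.cast_prod, ← Finset.prod_mul_distrib]
  refine Finset.prod_congr rfl fun p _ => ?_
  rw [stepMatrix, Matrix.of_apply, ← row_eq, ← row_eq]

theorem sum_range_four_ind (m : ℕ) : ∑ e ∈ Finset.range 4, (ind (m % 4 = e) : ℂ) * I ^ e = I ^ m := by
  rw [Finset.sum_eq_single_of_mem (m % 4) (Finset.mem_range.2 (Nat.mod_lt _ (by omega)))]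
  · rw [ind_true rfl, Nat.cast_one, one_mul, ← I_pow_eq_pow_mod]
  · intro e _ he
    rw [ind_false he.symm, Nat.cast_zero, zero_mul]

/-- The counting of paths gives the amplitudes of the output. -/
theorem sum_count (L : List CircuitSymbol) (W : List Bool) (V : Verifier) {z : ℕ}
    (hz : z < 2 ^ (2 * V.w + V.m)) :
    ∑ e ∈ Finset.range 4, (count L W V.w (2 * V.w + V.m) (2 ^ V.w)
      (2 ^ ((L.length + 1) * (2 * V.w + V.m))) z e : ℂ) * I ^ e =
    (evolution (2 * V.w + V.m) L L.length).mulVec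
      (V.inputVec (witness W V.w 0) (witness W V.w 1)) (digits _ z) := by
  set n := 2 * V.w + V.m with hn
  rw [← sum_paths]
  simp only [count, Nat.cast_sum, Finset.sum_mul]
  rw [Finset.sum_comm]
  refine Finset.sum_congr rfl fun Y hY => ?_
  rw [← sum_start, ← ind_isPath, Finset.sum_comm, Finset.mul_sum, Finset.mul_sum]
  refine Finset.sum_congr rfl fun q _ => ?_
  rw [Finset.sum_comm, Finset.mul_sum, Finset.mul_sum]
  refine Finset.sum_congr rfl fun q' _ => ?_
  have hY' : Y / 2 ^ (L.length * n) < 2 ^ n := by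
    rw [Nat.div_lt_iff_lt_mul (by positivity), ← pow_add, add_comm, ← add_one_mul]
    exact Finset.mem_range.1 hY
  have hdig : digits n (Y / 2 ^ (L.length * n)) = digits n z ↔ Y / 2 ^ (L.length * n) = z := by
    refine ⟨fun h => ?_, fun h => by rw [h]⟩
    have := congrArg Nat.ofBits h
    unfold digits at this
    rwa [Nat.ofBits_testBit, Nat.ofBits_testBit, Nat.mod_eq_of_lt hY', Nat.mod_eq_of_lt hz] at this
  have hif : (if digits n (Y / 2 ^ (L.length * n)) = digits n z then (1 : ℂ) else 0) =
      (ind (Y / 2 ^ (L.length * n) = z) : ℂ) := by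
    by_cases h : Y / 2 ^ (L.length * n) = z
    · rw [if_pos (hdig.2 h), ind_true h, Nat.cast_one]
    · rw [if_neg (hdig.not.2 h), ind_false h, Nat.cast_zero]
  rw [hif]
  simp only [ind_and, Nat.cast_mul, mul_assoc]
  rw [← Finset.mul_sum, ← Finset.mul_sum, ← Finset.mul_sum, sum_range_four_ind]
  ring

theorem sqNorm_eq (L : List CircuitSymbol) (W : List Bool) (V : Verifier) {z : ℕ}
    (hz : z < 2 ^ (2 * V.w + V.m)) :
    (sqNorm L W V.w (2 * V.w + V.m) (2 ^ V.w) (2 ^ ((L.length + 1) * (2 * V.w + V.m))) z : ℝ) =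
    normSq ((evolution (2 * V.w + V.m) L L.length).mulVec
      (V.inputVec (witness W V.w 0) (witness W V.w 1)) (digits _ z)) := by
  rw [← sum_count L W V hz, sqNorm]
  generalize count L W V.w (2 * V.w + V.m) (2 ^ V.w)
    (2 ^ ((L.length + 1) * (2 * V.w + V.m))) z = c
  have h : 2 * (c 0 * c 2 + c 1 * c 3) ≤
      c 0 * c 0 + c 1 * c 1 + c 2 * c 2 + c 3 * c 3 := by
    zify
    nlinarith [sq_nonneg ((c 0 : ℤ) - c 2), sq_nonneg ((c 1 : ℤ) - c 3)]
  rw [Nat.cast_sub h]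
  simp only [Finset.sum_range_succ, Finset.sum_range_zero, normSq_apply]
  simp [pow_succ]
  ring

/-- The probability of an event is the sum of the squared amplitudes. -/
theorem prob_eq (V : Verifier) (ψ₁ ψ₂ : EuclideanSpace ℂ (Fin V.w → Bool)) (E : V.Basis → Bool) :
    V.prob ψ₁ ψ₂ E =
      ∑ z, if E z then normSq (V.toMatrix.mulVec (V.inputVec ψ₁ ψ₂) z) else 0 := by
  rw [Verifier.prob, Matrix.mul_vecMulVec, Matrix.vecMulVec_mul, Matrix.mul_vecMulVec,
    Matrix.trace, re_sum]
  refine Finset.sum_congr rfl fun z _ => ?_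
  have h : Matrix.vecMul (star (V.inputVec ψ₁ ψ₂)) V.toMatrix.conjTranspose =
      star (V.toMatrix.mulVec (V.inputVec ψ₁ ψ₂)) := (Matrix.star_mulVec _ _).symm
  rw [h, Matrix.diag_apply, Matrix.vecMulVec_apply, Matrix.mulVec_diagonal]
  by_cases hE : E z = true
  · simp [hE, normSq_apply]
  · simp [hE]

/-- The final test compares the acceptance probability with the threshold. -/
theorem accepts_iff (V : Verifier) {kp P : Polynomial ℕ} {d : Data CircuitSymbol}
    (hcirc : d.circ = V.encode) (hwit : d.wit.length = 2 ^ P.eval d.word.length)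
    (hlen : (V.encode.length + 1) * (2 * V.w + V.m) ≤ P.eval d.word.length)
    (hbits : d.bits.length ≤ P.eval d.word.length)
    (hkp : kp.eval d.word.length ≤ P.eval d.word.length) :
    Accepts kp P d ↔
      ((1 + ∑ i ∈ Finset.range d.bits.length, ind (d.bits[i]? = some true) * 2 ^ i : ℕ) : ℝ) *
        V.probPost (witness d.wit V.w 0) (witness d.wit V.w 1) <
      2 ^ kp.eval d.word.length *
        V.probOutPost (witness d.wit V.w 0) (witness d.wit V.w 1) := by
  have hpow : ∀ e ≤ P.eval d.word.length, pow P d e = 2 ^ e := fun e he => by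
    rw [pow, hwit, Nat.pow_div (by omega) (by omega), Nat.sub_sub_self he]
  obtain ⟨hw, hm⟩ := arg_encode V
  obtain ⟨r, hr, hev⟩ := evolution_encode V
  unfold Accepts
  rw [hcirc, hw, hm]
  dsimp only
  set n := 2 * V.w + V.m with hn
  have hn2 : 2 ≤ n := V.two_le
  have hnP : n ≤ P.eval d.word.length := le_trans (Nat.le_mul_of_pos_left _ (by omega)) hlen
  rw [hpow _ hnP, hpow _ hlen, hpow _ hkp, hpow V.w (by omega)]
  rw [Finset.sum_congr rfl fun i hi => by
    rw [hpow i (by have := Finset.mem_range.1 hi; omega)]]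
  have key : ∀ (F : ℕ → Prop) (E : V.Basis → Bool), (∀ z, F z ↔ E (digits n z) = true) →
      ((∑ z ∈ Finset.range (2 ^ n), ind (F z) * sqNorm V.encode d.wit V.w n (2 ^ V.w)
        (2 ^ ((V.encode.length + 1) * n)) z : ℕ) : ℝ) =
      r ^ 2 * V.prob (witness d.wit V.w 0) (witness d.wit V.w 1) E := by
    intro F E hFE
    rw [prob_eq, Finset.mul_sum, ← sum_digits n, Nat.cast_sum]
    refine Finset.sum_congr rfl fun z hz => ?_
    rw [Nat.cast_mul, sqNorm_eq _ _ _ (Finset.mem_range.1 hz), hev, Matrix.smul_mulVec,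
      Pi.smul_apply, smul_eq_mul, normSq_mul, normSq_ofReal]
    by_cases h : F z
    · rw [ind_true h, if_pos ((hFE z).1 h)]
      push_cast
      ring
    · rw [ind_false h, if_neg ((hFE z).not.1 h)]
      simp
  rw [← Nat.cast_lt (α := ℝ), Nat.cast_mul, Nat.cast_mul, key (fun z => z.testBit 1 = true) (fun z => z V.p) fun z => Iff.rfl,
    key (fun z => z.testBit 0 = true ∧ z.testBit 1 = true) (fun z => z V.o && z V.p)
      fun z => by rw [Bool.and_eq_true]; rfl, mul_left_comm,
    mul_left_comm _ (r ^ 2), mul_lt_mul_iff_right₀ (by positivity), Nat.cast_pow, Nat.cast_ofNat]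
  rfl

end PathSum

end

section

namespace PathSum

open QuantumComplexity Complex

/-! ### Witnesses with prescribed amplitudes -/

theorem sum_ind_lt {m N : ℕ} (h : m ≤ N) : ∑ s ∈ Finset.range N, ind (s < m) = m := by
  obtain ⟨k, rfl⟩ := Nat.exists_eq_add_of_le h
  rw [Finset.sum_range_add, Finset.sum_congr rfl fun s hs => ind_true (Finset.mem_range.1 hs),
    Finset.sum_eq_zero fun s _ => ind_false (by omega)]
  simp

/-- How often the power `i ^ e` is used to write the Gaussian integer `a + b i`. -/
def multiplicity (a b : ℤ) (e : ℕ) : ℕ :=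
  if e = 0 then a.toNat else if e = 1 then b.toNat else if e = 2 then (-a).toNat else (-b).toNat

theorem sum_multiplicity {a b : ℤ} {N : ℕ} (h : ∀ e, multiplicity a b e ≤ N) :
    ∑ q ∈ Finset.range (4 * N), (ind (q / 4 < multiplicity a b (q % 4)) : ℂ) * I ^ q =
      a + b * I := by
  rw [sum_range_mul]
  have h1 : ∀ s, ∀ e ∈ Finset.range 4,
      (ind ((4 * s + e) / 4 < multiplicity a b ((4 * s + e) % 4)) : ℂ) * I ^ (4 * s + e) =
      (ind (s < multiplicity a b e) : ℂ) * I ^ e := by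
    intro s e he
    have he := Finset.mem_range.1 he
    rw [show (4 * s + e) / 4 = s by omega, show (4 * s + e) % 4 = e by omega, pow_add, pow_mul,
      I_pow_four, one_pow, one_mul]
  rw [Finset.sum_congr rfl fun s _ => Finset.sum_congr rfl (h1 s), Finset.sum_comm]
  simp only [← Finset.sum_mul, ← Nat.cast_sum, sum_ind_lt (h _)]
  have ha : (a.toNat : ℂ) - (-a).toNat = a := by
    rw [← Int.cast_natCast a.toNat, ← Int.cast_natCast (-a).toNat, ← Int.cast_sub,
      Int.toNat_sub_toNat_neg]
  have hb : (b.toNat : ℂ) - (-b).toNat = b := by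
    rw [← Int.cast_natCast b.toNat, ← Int.cast_natCast (-b).toNat, ← Int.cast_sub,
      Int.toNat_sub_toNat_neg]
  rw [← ha, ← hb]
  simp [Finset.sum_range_succ, multiplicity, pow_succ]
  ring

theorem exists_witness {w t P : ℕ} (hP : t + w + 4 ≤ P) (a b : ℕ → (Fin w → Bool) → ℤ)
    (ha : ∀ ε α, |a ε α| ≤ 2 ^ t) (hb : ∀ ε α, |b ε α| ≤ 2 ^ t) :
    ∃ W : List Bool, W.length = 2 ^ P ∧
      ∀ ε < 2, ∀ α, witness W w ε α = a ε α + b ε α * I := by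
  have hmul : ∀ ε α e, multiplicity (a ε α) (b ε α) e ≤ 2 ^ t := by
    intro ε α e
    have h1 := abs_le.1 (ha ε α)
    have h2 := abs_le.1 (hb ε α)
    zify
    unfold multiplicity
    split_ifs <;> omega
  let β : ℕ → Bool := fun i => decide (i / 2 ^ w / 2 / 4 <
    multiplicity (a (i / 2 ^ w % 2) (digits w i)) (b (i / 2 ^ w % 2) (digits w i))
      (i / 2 ^ w / 2 % 4))
  refine ⟨List.ofFn fun i : Fin (2 ^ P) => β i, List.length_ofFn, fun ε hε α => ?_⟩
  have hle : 2 ^ t ≤ 2 ^ (P - 2) := Nat.pow_le_pow_right (by omega) (by omega)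
  rw [← sum_multiplicity fun e => (hmul ε α e).trans hle]
  have h4 : 4 * 2 ^ (P - 2) = 2 ^ P := by
    rw [show 4 = 2 ^ 2 from rfl, ← pow_add]
    congr 1
    omega
  rw [h4]
  show ∑ q ∈ Finset.range (List.ofFn fun i : Fin (2 ^ P) => β i).length, _ = _
  rw [List.length_ofFn]
  refine Finset.sum_congr rfl fun q _ => ?_
  have hα := Nat.ofBits_lt_two_pow α
  set i := (2 * q + ε) * 2 ^ w + Nat.ofBits α with hi
  have e1 : i / 2 ^ w = 2 * q + ε := by
    rw [hi, mul_comm, Nat.mul_add_div (by positivity), Nat.div_eq_of_lt hα, add_zero]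
  have e2 : digits w i = α := by
    have := digits_div_low (n := w) (e := w) (d := 0) (z := 2 * q + ε) (by omega) hα
    rw [pow_zero, Nat.div_one, Nat.div_one, digits_ofBits, mul_comm] at this
    exact this
  congr 2
  by_cases hlt : i < 2 ^ P
  · rw [List.getElem?_eq_getElem (by rwa [List.length_ofFn]), List.getElem_ofFn]
    simp only [β]
    rw [e1, e2, show (2 * q + ε) / 2 = q by omega, show (2 * q + ε) % 2 = ε by omega]
    simp
  · rw [List.getElem?_eq_none (by rw [List.length_ofFn]; omega), ind_false (by simp), ind_false]
    -- The bits that do not fit into `W` are not needed.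
    have h5 : 2 ^ (t + 4) * 2 ^ w ≤ 2 ^ P := by
      rw [← pow_add]
      exact Nat.pow_le_pow_right (by omega) (by omega)
    have h6 : i < (2 * q + ε + 1) * 2 ^ w := by rw [hi, add_one_mul]; omega
    have h7 : 2 ^ (t + 4) < 2 * q + ε + 1 :=
      Nat.lt_of_mul_lt_mul_right (a := 2 ^ w) (by omega)
    have h8 := hmul ε α (q % 4)
    rw [pow_add] at h7
    omega

/-! ### Continuity of the acceptance probabilities -/

theorem norm_gate_le {n : ℕ} (g : Gate n) (z z' : Fin n → Bool) : ‖g.toMatrix z z'‖ ≤ 1 := by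
  have hq : ∀ (U : Matrix Bool Bool ℂ) (j : Fin n), (∀ a b, ‖U a b‖ ≤ 1) →
      ‖onQubit U j z z'‖ ≤ 1 := by
    intro U j hU
    rw [onQubit, Matrix.of_apply]
    split_ifs
    · exact hU _ _
    · simp
  have hp : ∀ t : ℂ, ‖t‖ = 1 → ∀ a b, ‖phase t a b‖ ≤ 1 := by
    intro t ht a b
    rw [phase, Matrix.diagonal_apply]
    split_ifs <;> simp [ht]
  have hb : ∀ f : (Fin n → Bool) → (Fin n → Bool), ‖basisMap f z z'‖ ≤ 1 := by
    intro f
    rw [basisMap, Matrix.of_apply]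
    split_ifs <;> simp
  cases g with
  | H j =>
    refine hq _ _ fun a b => ?_
    have h2 : ‖(Real.sqrt 2 : ℂ)‖ = Real.sqrt 2 := by
      rw [norm_real, Real.norm_of_nonneg (Real.sqrt_nonneg 2)]
    rw [hadamard, Matrix.of_apply, norm_div, h2]
    refine div_le_one_of_le₀ ?_ (Real.sqrt_nonneg 2)
    split_ifs <;> simp
  | K j => exact hq _ _ (hp _ (by simp))
  | Kinv j => exact hq _ _ (hp _ (by simp))
  | CNOT i j hij => exact hb _
  | Toffoli i j k hij hik hjk => exact hb _

theorem norm_foldl_le {n : ℕ} (gs : List (Gate n)) (z z' : Fin n → Bool) :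
    ‖gs.foldl (fun U g => g.toMatrix * U) (1 : Matrix (Fin n → Bool) (Fin n → Bool) ℂ) z z'‖ ≤ (2 ^ n) ^ gs.length := by
  induction gs generalizing z z' with
  | nil =>
    rw [List.foldl_nil, Matrix.one_apply]
    split_ifs <;> simp
  | cons g gs ih =>
    rw [List.foldl_cons, mul_one, foldl_toMatrix, Matrix.mul_apply, List.length_cons, pow_succ,
      mul_comm]
    refine (norm_sum_le_of_le _ fun y _ => ?_).trans_eq (b := ∑ y : Fin n → Bool, (2 ^ n) ^ gs.length)
      (by simp)
    rw [norm_mul]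
    exact (mul_le_mul (ih _ _) (norm_gate_le g _ _) (norm_nonneg _) (by positivity)).trans_eq
      (mul_one _)

theorem norm_toMatrix_le (V : Verifier) (z z' : V.Basis) :
    ‖V.toMatrix z z'‖ ≤ (2 ^ (2 * V.w + V.m)) ^ V.gates.length := norm_foldl_le _ _ _

variable (V : Verifier)

theorem norm_mulVec_le {x : V.Basis → ℂ} {C : ℝ} (hx : ∀ z, ‖x z‖ ≤ C) (z : V.Basis) :
    ‖V.toMatrix.mulVec x z‖ ≤ (2 ^ (2 * V.w + V.m)) ^ (V.gates.length + 1) * C := by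
  rw [Matrix.mulVec, dotProduct]
  refine (norm_sum_le_of_le _ fun y _ => ?_).trans_eq
    (b := ∑ y : V.Basis, (2 ^ (2 * V.w + V.m)) ^ V.gates.length * C) (by simp [pow_succ]; ring)
  rw [norm_mul]
  exact mul_le_mul (norm_toMatrix_le V _ _) (hx _) (norm_nonneg _) (by positivity)

theorem abs_normSq_sub_le {x y : ℂ} {A B C : ℝ} (hx : ‖x‖ ≤ A) (hy : ‖y‖ ≤ B) (h : ‖x - y‖ ≤ C) :
    |normSq x - normSq y| ≤ C * (A + B) := by
  rw [normSq_eq_norm_sq, normSq_eq_norm_sq, sq_sub_sq, abs_mul, mul_comm,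
    abs_of_nonneg (add_nonneg (norm_nonneg x) (norm_nonneg y))]
  exact mul_le_mul ((abs_norm_sub_norm_le x y).trans h) (add_le_add hx hy) (by positivity)
    ((norm_nonneg _).trans h)

theorem norm_inputVec_le {φ₁ φ₂ : EuclideanSpace ℂ (Fin V.w → Bool)} {A : ℝ}
    (h₁ : ∀ α, ‖φ₁ α‖ ≤ A) (h₂ : ∀ α, ‖φ₂ α‖ ≤ A) (z : V.Basis) :
    ‖V.inputVec φ₁ φ₂ z‖ ≤ A * A := by
  have hA : 0 ≤ A := (norm_nonneg _).trans (h₁ fun _ => false)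
  rw [Verifier.inputVec, norm_mul]
  refine (mul_le_of_le_one_right (norm_nonneg _) (by split_ifs <;> simp)).trans ?_
  rw [norm_mul]
  exact mul_le_mul (h₁ _) (h₂ _) (norm_nonneg _) hA

theorem norm_inputVec_sub_le {φ₁ φ₂ ψ₁ ψ₂ : EuclideanSpace ℂ (Fin V.w → Bool)} {η : ℝ}
    (h₁ : ∀ α, ‖φ₁ α - ψ₁ α‖ ≤ η) (h₂ : ∀ α, ‖φ₂ α - ψ₂ α‖ ≤ η) (h₁' : ∀ α, ‖φ₁ α‖ ≤ 2)
    (h₂' : ∀ α, ‖ψ₂ α‖ ≤ 1) (z : V.Basis) :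
    ‖V.inputVec φ₁ φ₂ z - V.inputVec ψ₁ ψ₂ z‖ ≤ 3 * η := by
  have hη : 0 ≤ η := (norm_nonneg _).trans (h₁ fun _ => false)
  simp only [Verifier.inputVec]
  rw [← sub_mul, norm_mul]
  have h : ∀ a b c d : ℂ, ‖a - c‖ ≤ η → ‖b - d‖ ≤ η → ‖a‖ ≤ 2 → ‖d‖ ≤ 1 →
      ‖a * b - c * d‖ ≤ 3 * η := by
    intro a b c d h1 h2 h3 h4
    rw [show a * b - c * d = a * (b - d) + (a - c) * d by ring]
    refine (norm_add_le _ _).trans ?_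
    rw [norm_mul, norm_mul]
    have h5 := mul_le_mul h3 h2 (norm_nonneg _) (by norm_num)
    have h6 := mul_le_mul h1 h4 (norm_nonneg _) hη
    linarith
  exact (mul_le_of_le_one_right (norm_nonneg _) (by split_ifs <;> simp)).trans
    (h _ _ _ _ (h₁ _) (h₂ _) (h₁' _) (h₂' _))

/-- A quantitative form of the continuity of acceptance probabilities. -/
theorem abs_prob_sub_le {φ₁ φ₂ ψ₁ ψ₂ : EuclideanSpace ℂ (Fin V.w → Bool)} {η : ℝ} (hη : η ≤ 1)
    (h₁ : ∀ α, ‖φ₁ α - ψ₁ α‖ ≤ η) (h₂ : ∀ α, ‖φ₂ α - ψ₂ α‖ ≤ η) (h₁' : ∀ α, ‖ψ₁ α‖ ≤ 1)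
    (h₂' : ∀ α, ‖ψ₂ α‖ ≤ 1) (E : V.Basis → Bool) :
    |V.prob φ₁ φ₂ E - V.prob ψ₁ ψ₂ E| ≤
      15 * η * 2 ^ ((2 * V.w + V.m) * (2 * V.gates.length + 3)) := by
  have hη0 : 0 ≤ η := (norm_nonneg _).trans (h₁ fun _ => false)
  have hφ : ∀ (φ ψ : EuclideanSpace ℂ (Fin V.w → Bool)), (∀ α, ‖φ α - ψ α‖ ≤ η) →
      (∀ α, ‖ψ α‖ ≤ 1) → ∀ α, ‖φ α‖ ≤ 2 := by
    intro φ ψ h h' α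
    have := norm_sub_norm_le (φ α) (ψ α)
    linarith [h α, h' α]
  set n := 2 * V.w + V.m with hn
  set K : ℝ := (2 ^ n) ^ (V.gates.length + 1) with hK
  have key : ∀ z, |normSq (V.toMatrix.mulVec (V.inputVec φ₁ φ₂) z) -
      normSq (V.toMatrix.mulVec (V.inputVec ψ₁ ψ₂) z)| ≤ 15 * η * K ^ 2 := by
    intro z
    refine (abs_normSq_sub_le (norm_mulVec_le V (norm_inputVec_le V (hφ _ _ h₁ h₁')
      (hφ _ _ h₂ h₂')) z) (norm_mulVec_le V (norm_inputVec_le V h₁' h₂') z) ?_).trans_eq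
      (b := K * (3 * η) * (K * (2 * 2) + K * (1 * 1))) (by ring)
    have := norm_mulVec_le V (norm_inputVec_sub_le V h₁ h₂ (hφ _ _ h₁ h₁') h₂') z
    rwa [← Pi.sub_def, Matrix.mulVec_sub] at this
  rw [prob_eq, prob_eq, ← Finset.sum_sub_distrib]
  refine (Finset.abs_sum_le_sum_abs _ _).trans ((Finset.sum_le_sum fun z _ => ?_).trans_eq
    (b := ∑ z : V.Basis, 15 * η * K ^ 2) ?_)
  · split_ifs
    · exact key z
    · rw [sub_zero, abs_zero]; positivity
  · rw [Finset.sum_const, Finset.card_univ, nsmul_eq_mul, hK, mul_add, pow_add]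
    simp
    ring

theorem prob_smul (a b : ℂ) (φ₁ φ₂ : EuclideanSpace ℂ (Fin V.w → Bool)) (E : V.Basis → Bool) :
    V.prob (a • φ₁) (b • φ₂) E = normSq (a * b) * V.prob φ₁ φ₂ E := by
  have h : V.inputVec (a • φ₁) (b • φ₂) = (a * b) • V.inputVec φ₁ φ₂ := by
    funext z
    simp only [Verifier.inputVec, PiLp.smul_apply, Pi.smul_apply, smul_eq_mul]
    ring
  rw [prob_eq, prob_eq, h, Matrix.mulVec_smul, Finset.mul_sum]
  refine Finset.sum_congr rfl fun z _ => ?_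
  rw [Pi.smul_apply, smul_eq_mul, normSq_mul]
  split_ifs <;> simp

end PathSum

end

/-! ### Numbers in binary -/

section

namespace PathSum

open QuantumComplexity Complex Computability

theorem sum_bits_cons (b : Bool) (l : List Bool) :
    ∑ i ∈ Finset.range (b :: l).length, ind ((b :: l)[i]? = some true) * 2 ^ i =
      ind (b = true) + 2 * ∑ i ∈ Finset.range l.length, ind (l[i]? = some true) * 2 ^ i := by
  rw [List.length_cons, Finset.sum_range_succ', Finset.mul_sum, add_comm]
  congr 1
  · simp
  · exact Finset.sum_congr rfl fun i _ => by rw [List.getElem?_cons_succ]; ring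

theorem sum_encodePosNum (p : PosNum) :
    ∑ i ∈ Finset.range (encodePosNum p).length, ind ((encodePosNum p)[i]? = some true) * 2 ^ i =
      (p : ℕ) := by
  induction p with
  | one => simp [encodePosNum, ind]
  | bit0 p ih =>
    rw [encodePosNum, sum_bits_cons, ih, ind_false (by simp), PosNum.cast_bit0]
    ring
  | bit1 p ih =>
    rw [encodePosNum, sum_bits_cons, ih, ind_true rfl, PosNum.cast_bit1]
    ring

theorem sum_encodeNat (n : ℕ) :
    ∑ i ∈ Finset.range (encodeNat n).length, ind ((encodeNat n)[i]? = some true) * 2 ^ i = n := by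
  have h : ∀ m : Num, ∑ i ∈ Finset.range (encodeNum m).length,
      ind ((encodeNum m)[i]? = some true) * 2 ^ i = (m : ℕ) := by
    intro m
    cases m with
    | zero => rfl
    | pos p => exact sum_encodePosNum p
  exact (h n).trans (Num.to_of_nat n)

/-! ### Soundness and completeness of the final test -/

variable (V : Verifier)

/-- If the threshold `a / 2 ^ k` is an upper bound for the acceptance probabilities of unit vectors,
then the final test fails for all pairs of vectors, by homogeneity. -/
theorem not_accepts {a k : ℕ} {σ : ℝ} (hσ : 2 ^ k * σ ≤ a)
    (hpost : ∀ ψ₁ ψ₂ : EuclideanSpace ℂ (Fin V.w → Bool), ‖ψ₁‖ = 1 → ‖ψ₂‖ = 1 →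
      0 < V.probPost ψ₁ ψ₂)
    (hcond : ∀ ψ₁ ψ₂ : EuclideanSpace ℂ (Fin V.w → Bool), ‖ψ₁‖ = 1 → ‖ψ₂‖ = 1 →
      V.probCond ψ₁ ψ₂ ≤ σ) (φ₁ φ₂ : EuclideanSpace ℂ (Fin V.w → Bool)) :
    ¬(a : ℝ) * V.probPost φ₁ φ₂ < 2 ^ k * V.probOutPost φ₁ φ₂ := by
  have hnorm : ∀ φ : EuclideanSpace ℂ (Fin V.w → Bool), ∃ (r : ℝ) (ψ : EuclideanSpace ℂ _),
      ‖ψ‖ = 1 ∧ φ = (r : ℂ) • ψ := by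
    intro φ
    by_cases h : φ = 0
    · exact ⟨0, EuclideanSpace.single (fun _ => false) 1, by simp, by simp [h]⟩
    · refine ⟨‖φ‖, (‖φ‖ : ℂ)⁻¹ • φ, ?_, ?_⟩
      · simp [norm_smul, h]
      · rw [smul_smul, mul_inv_cancel₀ (by simpa using h), one_smul]
  obtain ⟨r₁, ψ₁, h₁, rfl⟩ := hnorm φ₁
  obtain ⟨r₂, ψ₂, h₂, rfl⟩ := hnorm φ₂
  have hp := hpost ψ₁ ψ₂ h₁ h₂
  have hc := hcond ψ₁ ψ₂ h₁ h₂
  rw [Verifier.probCond, div_le_iff₀ hp] at hc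
  rw [Verifier.probPost, Verifier.probOutPost, prob_smul, prob_smul, not_lt, mul_left_comm,
    mul_left_comm (a : ℝ)]
  refine mul_le_mul_of_nonneg_left ?_ (normSq_nonneg _)
  calc (2 : ℝ) ^ k * V.probOutPost ψ₁ ψ₂ ≤ 2 ^ k * (σ * V.probPost ψ₁ ψ₂) := by gcongr
    _ = 2 ^ k * σ * V.probPost ψ₁ ψ₂ := by ring
    _ ≤ a * V.probPost ψ₁ ψ₂ := by gcongr

theorem abs_floor_le {y : ℝ} {N : ℕ} (h : |y| ≤ N) : |⌊y⌋| ≤ (N : ℤ) := by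
  obtain ⟨h1, h2⟩ := abs_le.1 h
  refine abs_le.2 ⟨Int.le_floor.2 (by push_cast; exact h1), ?_⟩
  exact_mod_cast (Int.floor_le y).trans h2

theorem norm_rounded_sub_le (x : ℂ) (t : ℕ) :
    ‖((2 : ℂ) ^ t)⁻¹ * ((⌊2 ^ t * x.re⌋ : ℂ) + (⌊2 ^ t * x.im⌋ : ℂ) * I) - x‖ ≤ 2 / 2 ^ t := by
  have h2 : (2 : ℂ) ^ t ≠ 0 := pow_ne_zero t two_ne_zero
  have h : ((2 : ℂ) ^ t)⁻¹ * ((⌊2 ^ t * x.re⌋ : ℂ) + (⌊2 ^ t * x.im⌋ : ℂ) * I) - x =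
      ((2 : ℂ) ^ t)⁻¹ * (⟨⌊2 ^ t * x.re⌋ - 2 ^ t * x.re, ⌊2 ^ t * x.im⌋ - 2 ^ t * x.im⟩ : ℂ) := by
    have e : (⟨⌊2 ^ t * x.re⌋ - 2 ^ t * x.re, ⌊2 ^ t * x.im⌋ - 2 ^ t * x.im⟩ : ℂ) =
        (⌊2 ^ t * x.re⌋ : ℂ) + (⌊2 ^ t * x.im⌋ : ℂ) * I - 2 ^ t * x := by
      rw [mk_eq_add_mul_I]
      push_cast
      linear_combination -(2 : ℂ) ^ t * re_add_im x
    rw [e, mul_sub, inv_mul_cancel_left₀ h2]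
  have hf : ∀ y : ℝ, |(⌊y⌋ : ℝ) - y| ≤ 1 := fun y => by
    rw [abs_le]
    constructor <;> linarith [Int.floor_le y, Int.lt_floor_add_one y]
  rw [h, norm_mul, norm_inv, norm_pow, norm_ofNat, div_eq_inv_mul]
  refine mul_le_mul_of_nonneg_left ((norm_le_abs_re_add_abs_im _).trans ?_) (by positivity)
  have := hf (2 ^ t * x.re)
  have := hf (2 ^ t * x.im)
  dsimp only
  linarith

/-- If a pair of witnesses is accepted with a margin, then rounding gives a string for which the
final test succeeds. -/
theorem exists_accepts {a k l t P : ℕ} (ha : a ≤ 2 ^ (k + 1))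
    {ψ₁ ψ₂ : EuclideanSpace ℂ (Fin V.w → Bool)} (h₁ : ‖ψ₁‖ = 1) (h₂ : ‖ψ₂‖ = 1)
    (hψ : 2 / 2 ^ l ≤ 2 ^ k * V.probOutPost ψ₁ ψ₂ - a * V.probPost ψ₁ ψ₂)
    (ht : l + k + 7 + (2 * V.w + V.m) * (2 * V.gates.length + 3) ≤ t) (hP : t + V.w + 4 ≤ P) :
    ∃ W : List Bool, W.length = 2 ^ P ∧
      (a : ℝ) * V.probPost (witness W V.w 0) (witness W V.w 1) <
        2 ^ k * V.probOutPost (witness W V.w 0) (witness W V.w 1) := by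
  have hle : ∀ ψ : EuclideanSpace ℂ (Fin V.w → Bool), ‖ψ‖ = 1 → ∀ α, ‖ψ α‖ ≤ 1 :=
    fun ψ h α => h ▸ PiLp.norm_apply_le ψ α
  let ψ : ℕ → EuclideanSpace ℂ (Fin V.w → Bool) := fun ε => if ε = 0 then ψ₁ else ψ₂
  have hψ1 : ∀ ε α, ‖ψ ε α‖ ≤ 1 := by
    intro ε
    simp only [ψ]
    split_ifs
    · exact hle ψ₁ h₁
    · exact hle ψ₂ h₂
  have hint : ∀ y : ℝ, |y| ≤ 1 → |⌊2 ^ t * y⌋| ≤ 2 ^ t := by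
    intro y hy
    have : |2 ^ t * y| ≤ ((2 ^ t : ℕ) : ℝ) := by
      rw [abs_mul, abs_of_pos (by positivity)]
      push_cast
      exact mul_le_of_le_one_right (by positivity) hy
    exact_mod_cast abs_floor_le this
  obtain ⟨W, hW, hwit⟩ := exists_witness hP (fun ε α => ⌊2 ^ t * (ψ ε α).re⌋)
    (fun ε α => ⌊2 ^ t * (ψ ε α).im⌋)
    (fun ε α => hint _ ((abs_re_le_norm _).trans (hψ1 ε α)))
    (fun ε α => hint _ ((abs_im_le_norm _).trans (hψ1 ε α)))
  refine ⟨W, hW, ?_⟩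
  set r : ℂ := ((2 : ℂ) ^ t)⁻¹ with hr
  have hr0 : 0 < normSq (r * r) := by
    have h2 : r ≠ 0 := inv_ne_zero (pow_ne_zero t two_ne_zero)
    exact normSq_pos.2 (mul_ne_zero h2 h2)
  have hclose : ∀ ε < 2, ∀ α, ‖(r • witness W V.w ε) α - ψ ε α‖ ≤ 2 / 2 ^ t := by
    intro ε hε α
    rw [PiLp.smul_apply, smul_eq_mul, hwit ε hε α]
    exact norm_rounded_sub_le _ _
  have hη : (2 : ℝ) / 2 ^ t ≤ 1 := by
    rw [div_le_one (by positivity)]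
    exact le_self_pow₀ (by norm_num) (by omega)
  have hE := fun E => abs_prob_sub_le V hη (hclose 0 (by omega)) (hclose 1 (by omega))
    (hψ1 0) (hψ1 1) E
  set e := (2 * V.w + V.m) * (2 * V.gates.length + 3) with he
  have herr : 15 * (2 / 2 ^ t) * 2 ^ e * (2 ^ k + 2 ^ (k + 1)) ≤ 1 / (2 : ℝ) ^ l := by
    have h3 : (2 : ℝ) ^ l * 2 ^ k * 2 ^ 7 * 2 ^ e ≤ 2 ^ t := by
      rw [← pow_add, ← pow_add, ← pow_add]
      exact pow_le_pow_right₀ (by norm_num) ht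
    rw [le_div_iff₀ (by positivity), show 15 * (2 / 2 ^ t) * 2 ^ e * (2 ^ k + 2 ^ (k + 1)) * 2 ^ l =
      90 * (2 ^ l * 2 ^ k * 2 ^ e) / (2 : ℝ) ^ t by ring, div_le_one (by positivity)]
    refine le_trans ?_ h3
    have : (0 : ℝ) ≤ 2 ^ l * 2 ^ k * 2 ^ e := by positivity
    linarith
  have hout := abs_le.1 (hE fun z => z V.o && z V.p)
  have hpost := abs_le.1 (hE fun z => z V.p)
  rw [prob_smul, show ψ 0 = ψ₁ from rfl, show ψ 1 = ψ₂ from rfl] at hout hpost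
  have ha' : (a : ℝ) ≤ 2 ^ (k + 1) := by exact_mod_cast ha
  have hl : (0 : ℝ) < 1 / 2 ^ l := by positivity
  set δ : ℝ := 15 * (2 / 2 ^ t) * 2 ^ e with hδ
  have hδ0 : 0 ≤ δ := by positivity
  have e1 : (2 : ℝ) ^ k * (V.probOutPost ψ₁ ψ₂ - δ) ≤
      2 ^ k * (normSq (r * r) * V.probOutPost (witness W V.w 0) (witness W V.w 1)) := by
    refine mul_le_mul_of_nonneg_left ?_ (by positivity)
    have := hout.1
    unfold Verifier.probOutPost
    linarith
  have e2 : (a : ℝ) * (normSq (r * r) * V.probPost (witness W V.w 0) (witness W V.w 1)) ≤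
      a * (V.probPost ψ₁ ψ₂ + δ) := by
    refine mul_le_mul_of_nonneg_left ?_ (by positivity)
    have := hpost.2
    unfold Verifier.probPost
    linarith
  have e3 : (a : ℝ) * δ ≤ 2 ^ (k + 1) * δ := mul_le_mul_of_nonneg_right ha' hδ0
  refine lt_of_mul_lt_mul_left (a := normSq (r * r)) ?_ hr0.le
  have e4 : (2 : ℝ) / 2 ^ l = 1 / 2 ^ l + 1 / 2 ^ l := by ring
  linarith

/-! ### The class `postQMA(2)` -/

theorem length_encode (V : Verifier) : V.w + V.m + V.gates.length ≤ V.encode.length := by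
  have h : ∀ gs : List (Gate (2 * V.w + V.m)), gs.length ≤ (gs.flatMap Gate.encode).length := by
    intro gs
    induction gs with
    | nil => simp
    | cons g gs ih =>
      have : 1 ≤ g.encode.length := by cases g <;> simp [Gate.encode]
      rw [List.flatMap_cons, List.length_append, List.length_cons]
      omega
  have := h V.gates
  simp only [Verifier.encode, encodeIndex, List.length_append, List.length_replicate,
    List.length_singleton]
  omega

theorem exists_polynomial_le (l : Polynomial ℤ) :
    ∃ p : Polynomial ℕ, ∀ n : ℕ, l.eval (n : ℤ) ≤ p.eval n := by
  induction l using Polynomial.induction_on' with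
  | add l l' h h' =>
    obtain ⟨p, hp⟩ := h
    obtain ⟨p', hp'⟩ := h'
    refine ⟨p + p', fun n => ?_⟩
    rw [Polynomial.eval_add, Polynomial.eval_add, Nat.cast_add]
    exact add_le_add (hp n) (hp' n)
  | monomial k a =>
    refine ⟨Polynomial.monomial k a.natAbs, fun n => ?_⟩
    rw [Polynomial.eval_monomial, Polynomial.eval_monomial]
    push_cast
    exact mul_le_mul_of_nonneg_right (le_abs_self a) (by positivity)

theorem postQMA2_subset_NEXP {c s : ℕ → ℝ} (h : Thresholds c s) : PostQMA2 c s ⊆ NEXP := by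
  rintro L ⟨w, m, l, V, hV, hL⟩
  obtain ⟨q, hq⟩ := h.gap
  obtain ⟨n₀, hn₀⟩ := eventually_atTop.1 hq
  obtain ⟨f, hf, hfs⟩ := h.s_poly
  obtain ⟨M⟩ := exists_setup hV hf
  obtain ⟨lp, hlp⟩ := exists_polynomial_le l
  -- The threshold is computed to precision `2 ^ (-kp(n))`.
  let kp : Polynomial ℕ := q + 2
  let P : Polynomial ℕ := lp + kp + 11 + 2 * M.len₁ * (2 * M.len₁ + 3) + M.len₁ +
    (M.len₁ + 1) * (2 * M.len₁) + M.len₂.comp (Polynomial.X + kp)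
  -- The gap is only guaranteed from `n₀` on; the finitely many shorter inputs are tabulated.
  have hfin : {x : List Bool | x.length < n₀ ∧ x ∈ L}.Finite :=
    (List.finite_length_lt Bool n₀).subset fun x hx => hx.1
  have hQ : PExpr M.u M.vars fun d => d.word ∈ {x : List Bool | x.length < n₀ ∧ x ∈ L} ∨
      (n₀ ≤ d.word.length ∧ Accepts kp P d) :=
    (M.lexpr_word.mem_finite hfin).or ((PExpr.le (.const n₀) M.lexpr_word.length).and
      (pexpr_accepts M.lexpr_word M.lexpr_circ M.lexpr_bits M.lexpr_wit kp P))
  refine M.mem_NEXP kp P hQ fun x => ?_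
  obtain ⟨-, -, hpost, hyes, hno⟩ := hL x
  dsimp only
  by_cases hx : x.length < n₀
  · constructor
    · exact fun hxL => ⟨List.replicate _ false, List.length_replicate, .inl ⟨hx, hxL⟩⟩
    · rintro ⟨W, -, h | h⟩
      · exact h.2
      · omega
  set n := x.length with hn
  obtain ⟨hq0, hgap⟩ := hn₀ n (by omega)
  set k := kp.eval n with hk
  have hk2 : k = q.eval n + 2 := by simp [hk, kp]
  have hPeval : P.eval n = lp.eval n + k + 11 + 2 * M.len₁.eval n * (2 * M.len₁.eval n + 3) +
      M.len₁.eval n + (M.len₁.eval n + 1) * (2 * M.len₁.eval n) + M.len₂.eval (n + k) := by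
    simp [P, hk]
  have hlen₁ : (V x).encode.length ≤ M.len₁.eval n := M.length₁ x
  have hlen₂ := M.length₂ n k
  have hlenV := length_encode (V x)
  have hb1 : ((V x).encode.length + 1) * (2 * (V x).w + (V x).m) ≤
      (M.len₁.eval n + 1) * (2 * M.len₁.eval n) := Nat.mul_le_mul (by omega) (by omega)
  have hb2 : (2 * (V x).w + (V x).m) * (2 * (V x).gates.length + 3) ≤
      2 * M.len₁.eval n * (2 * M.len₁.eval n + 3) := Nat.mul_le_mul (by omega) (by omega)
  -- An upper bound for the soundness, with denominator `2 ^ k`.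
  set a := 1 + f (n, k) with ha
  have h2k : (0 : ℝ) < 2 ^ k := by positivity
  obtain ⟨hf1, hf2⟩ := abs_le.1 (hfs n k)
  have hfk : (f (n, k) : ℝ) / 2 ^ k * 2 ^ k = f (n, k) := div_mul_cancel₀ _ h2k.ne'
  have h1k : (1 : ℝ) / 2 ^ k * 2 ^ k = 1 := div_mul_cancel₀ _ h2k.ne'
  have hsa : 2 ^ k * s n ≤ a := by
    rw [ha]
    push_cast
    nlinarith
  have hfs' : (f (n, k) : ℝ) ≤ 2 ^ k * s n + 1 := by nlinarith
  have hacc : ∀ W : List Bool, W.length = 2 ^ P.eval n →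
      (Accepts kp P ⟨x, (V x).encode, encodeNat (f (n, k)), W⟩ ↔
        (a : ℝ) * (V x).probPost (witness W (V x).w 0) (witness W (V x).w 1) <
          2 ^ k * (V x).probOutPost (witness W (V x).w 0) (witness W (V x).w 1)) := by
    intro W hW
    rw [accepts_iff (V x) rfl hW (show _ ≤ P.eval n by omega)
      (show (encodeNat (f (n, k))).length ≤ P.eval n by omega)
      (show k ≤ P.eval n by omega)]
    dsimp only
    rw [sum_encodeNat]
  have hpost' : ∀ ψ₁ ψ₂ : EuclideanSpace ℂ (Fin (V x).w → Bool), ‖ψ₁‖ = 1 → ‖ψ₂‖ = 1 →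
      1 / 2 ^ lp.eval n ≤ (V x).probPost ψ₁ ψ₂ := by
    intro ψ₁ ψ₂ h₁ h₂
    refine le_trans ?_ (hpost ψ₁ ψ₂ h₁ h₂)
    rw [one_div, ← zpow_natCast, ← zpow_neg]
    exact zpow_le_zpow_right₀ (by norm_num) (neg_le_neg (hlp n))
  constructor
  · intro hxL
    obtain ⟨ψ₁, ψ₂, h₁, h₂, hc⟩ := hyes hxL
    have hp := hpost' ψ₁ ψ₂ h₁ h₂
    have hp0 : 0 < (V x).probPost ψ₁ ψ₂ := lt_of_lt_of_le (by positivity) hp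
    rw [Verifier.probCond, le_div_iff₀ hp0] at hc
    -- The threshold `a / 2 ^ k` lies below the completeness by a margin.
    have hmargin : 2 + (a : ℝ) ≤ 2 ^ k * c n := by
      have h3 : (4 : ℝ) ≤ 2 ^ k * (1 / (q.eval n : ℕ)) := by
        have h4 : ((q.eval n : ℕ) : ℝ) ≤ 2 ^ q.eval n := by exact_mod_cast Nat.lt_two_pow_self.le
        have h5 : (0 : ℝ) < (q.eval n : ℕ) := by exact_mod_cast hq0
        rw [mul_one_div, le_div_iff₀ h5, hk2, pow_add]
        linarith
      have h6 := mul_le_mul_of_nonneg_left hgap.le h2k.le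
      rw [ha]
      push_cast
      linarith
    have haa : a ≤ 2 ^ (k + 1) := by
      have h3 : (2 : ℝ) ^ k * s n ≤ 2 ^ k := mul_le_of_le_one_right h2k.le (h.s_mem n).2
      have h4 : (4 : ℝ) ≤ 2 ^ k := by
        have : (2 : ℝ) ^ 2 ≤ 2 ^ k := pow_le_pow_right₀ (by norm_num) (by omega)
        linarith
      have : (a : ℝ) ≤ 2 ^ (k + 1) := by
        rw [ha, pow_succ]
        push_cast
        linarith
      exact_mod_cast this
    obtain ⟨W, hW, hlt⟩ := exists_accepts (V x) (l := lp.eval n) haa h₁ h₂ (by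
      have h3 := mul_le_mul_of_nonneg_left hc h2k.le
      have h4 := mul_le_mul_of_nonneg_right hmargin hp0.le
      have h5 : (2 : ℝ) / 2 ^ lp.eval n = 2 * (1 / 2 ^ lp.eval n) := by ring
      rw [h5]
      linarith) le_rfl (P := P.eval n) (by omega)
    exact ⟨W, hW, .inr ⟨by omega, (hacc W hW).2 hlt⟩⟩
  · rintro ⟨W, hW, hW' | ⟨-, hW'⟩⟩
    · exact hW'.2
    · by_contra hxL
      exact not_accepts (V x) hsa (fun ψ₁ ψ₂ h₁ h₂ =>
        lt_of_lt_of_le (by positivity) (hpost' ψ₁ ψ₂ h₁ h₂)) (hno hxL) _ _ ((hacc W hW).1 hW')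

end PathSum

end

end StackProgram

theorem proposition1 (c s : ℕ → ℝ) (h : QuantumComplexity.Thresholds c s) :
    QuantumComplexity.PostQMA2 c s ⊆ QuantumComplexity.NEXP :=
  StackProgram.PathSum.postQMA2_subset_NEXP h
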